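/- Let $n\ge 1$ sites be given by a distance function $d$ on ordered pairs of sites, with values in a totally ordered abelian group (for instance $\mathbb R$); neither symmetry nor the triangle inequality is assumed. A tour of some of the sites is a cyclic sequence of distinct sites, and its length is the sum of $d(a,b)$ over its edges, the pairs $(a,b)$ of cyclically consecutive sites. (A tour of one site $s$ has the single edge $(s,s)$.) The cheapest insertion heuristic starts with the tour that consists of a given start site. As long as some site is missing from the tour, it adds a site $x$ not in the tour by replacing an edge $(a,b)$ of the tour by the two edges $(a,x)$ and $(x,b)$, where the pair of $x$ and $(a,b)$ is chosen so that the additional length $d(a,x)+d(x,b)-d(a,b)$ is least. Ties may be broken arbitrarily. Its result is the tour of all sites obtained in this way. The model of computation is a random access machine in which each of the following takes one step: evaluating $d$ at two given sites; copying, adding, subtracting or comparing two distances; arithmetic ($+$, truncated $-$, $\cdot$, integer division), copying and comparison of integers, which are natural numbers of $O(\log n)$ bits; setting an integer register to a constant of the program; and reading or writing an array cell. A cell holds one integer or one distance. Initially two registers hold $n$ and the start site and all other cells are zero. Space is the number of cells, not counting the distance function, which is given as a black box. **Theorem.** The cheapest insertion heuristic can be implemented in time $O(n^2)$. It can also be implemented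 in time $O(n^2\log^2 n)$ and space $O(n)$. That is, for each of the two bounds there is one program which, for all $n$, all $d$ and all start sites, outputs a possible result of the heuristic within the bound; the implied constants are absolute. -/

import Mathlib

open Filter Asymptotics

universe u

/-! ## The cheapest insertion heuristic

A tour of some of the sites is a list of sites, read cyclically: its edges lead from each entry to
the next one and from the last entry back to the first. (A tour of one site `s` has the single,
degenerate edge from `s` to `s`.) -/

namespace CheapestInsertion

section Heuristic

variable {α : Type*} {R : Type u}

/-- Length of a closed tour: the sum of `d a b` over its edges `(a, b)`. -/
def tourLength [AddCommGroup R] (d : α → α → R) (l : List α) : R :=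
  (List.zipWith d l (l.rotate 1)).sum

/-- `l'` arises from the tour `l` by adding one site `x` not yet in the tour, replacing the edge
that leaves position `i` by two edges through `x`. (If `i` is the last position, this is the
edge that closes the tour.) -/
def IsInsertion (l l' : List α) : Prop :=
  ∃ x, x ∉ l ∧ ∃ i, i < l.length ∧ l' = l.insertIdx (i + 1) x

/-- One step of the heuristic: an insertion that causes the least additional length.
Ties may be broken in any way. -/
def Step [AddCommGroup R] [LinearOrder R] (d : α → α → R) (l l' : List α) : Prop :=
  IsInsertion l l' ∧ ∀ l'', IsInsertion l l'' →
    tourLength d l' - tourLength d l ≤ tourLength d l'' - tourLength d l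

/-- `l` is a possible result of cheapest insertion started at the site `s`:
it arises from the one-site tour `[s]` by steps of the heuristic, and it visits all sites. -/
def IsResult [AddCommGroup R] [LinearOrder R] (d : α → α → R) (s : α) (l : List α) : Prop :=
  Relation.ReflTransGen (Step d) [s] l ∧ ∀ x, x ∈ l

end Heuristic

/-! ## The machine model

A random access machine with two sorts of data: natural numbers of bounded size, used for indices,
and distances, which can only be obtained from the distance function, copied, added, subtracted and
compared. A program has a constant number of registers and a constant number of arrays, each array
having `S` cells. -/

/-- State of the machine; `R` is the type of distances. -/
structure State (R : Type u) where
  /-- integer registers -/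
  reg : ℕ → ℕ
  /-- distance registers -/
  dreg : ℕ → R
  /-- `mem a j` is the `j`-th cell of the `a`-th array of integers -/
  mem : ℕ → ℕ → ℕ
  /-- `dmem a j` is the `j`-th cell of the `a`-th array of distances -/
  dmem : ℕ → ℕ → R

/-- Elementary instructions. Registers and arrays are named by numbers fixed in the program. -/
inductive Instr where
  /-- `reg x := c` -/
  | const (x c : ℕ)
  /-- `reg x := reg y` -/
  | copy (x y : ℕ)
  /-- `reg x := reg y + reg z` -/
  | add (x y z : ℕ)
  /-- `reg x := reg y - reg z` (zero if negative) -/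
  | sub (x y z : ℕ)
  /-- `reg x := reg y * reg z` -/
  | mul (x y z : ℕ)
  /-- `reg x := reg y / reg z` (rounded down; zero if `reg z = 0`) -/
  | div (x y z : ℕ)
  /-- `reg x := mem a (reg y)` -/
  | load (x a y : ℕ)
  /-- `mem a (reg y) := reg x` -/
  | store (a y x : ℕ)
  /-- `dreg x := d (reg y) (reg z)`: evaluation of the distance function at two sites -/
  | dist (x y z : ℕ)
  /-- `dreg x := dreg y` -/
  | dcopy (x y : ℕ)
  /-- `dreg x := dreg y + dreg z` -/
  | dadd (x y z : ℕ)
  /-- `dreg x := dreg y - dreg z` -/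
  | dsub (x y z : ℕ)
  /-- `dreg x := dmem a (reg y)` -/
  | dload (x a y : ℕ)
  /-- `dmem a (reg y) := dreg x` -/
  | dstore (a y x : ℕ)

/-- Elementary tests. -/
inductive Test where
  /-- `reg x < reg y` -/
  | lt (x y : ℕ)
  /-- `reg x = reg y` -/
  | eq (x y : ℕ)
  /-- `dreg x < dreg y`: comparison of two distances -/
  | dlt (x y : ℕ)
  /-- negation of a test -/
  | not (b : Test)

/-- Programs. -/
inductive Prog where
  | skip
  | instr (i : Instr)
  | seq (p q : Prog)
  | ite (b : Test) (p q : Prog)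
  | loop (b : Test) (p : Prog)

namespace State

variable {R : Type u}

/-- Write `v` to the integer register `x`; a fault if `v` exceeds the largest machine integer. -/
def setReg (W : ℕ) (σ : State R) (x v : ℕ) : Option (State R) :=
  if v ≤ W then some { σ with reg := Function.update σ.reg x v } else none

/-- Write `v` to the distance register `x`. -/
def setDReg (σ : State R) (x : ℕ) (v : R) : State R :=
  { σ with dreg := Function.update σ.dreg x v }

/-- Write `v` to the `j`-th cell of the integer array `a`. -/
def setMem (σ : State R) (a j v : ℕ) : State R :=
  { σ with mem := Function.update σ.mem a (Function.update (σ.mem a) j v) }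

/-- Write `v` to the `j`-th cell of the distance array `a`. -/
def setDMem (σ : State R) (a j : ℕ) (v : R) : State R :=
  { σ with dmem := Function.update σ.dmem a (Function.update (σ.dmem a) j v) }

end State

section Semantics

variable {R : Type u} [AddCommGroup R] [LinearOrder R]

/-- Effect of an instruction on a machine with arrays of `S` cells and integers at most `W`, for
the distance function `d` on the sites `0, …, n - 1`. The value `none` is a fault: an integer
overflow, an array index that is not below `S`, or a site number that is not below `n`. -/
def Instr.exec {n : ℕ} (d : Fin n → Fin n → R) (S W : ℕ) :
    Instr → State R → Option (State R)
  | .const x c, σ => σ.setReg W x c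
  | .copy x y, σ => σ.setReg W x (σ.reg y)
  | .add x y z, σ => σ.setReg W x (σ.reg y + σ.reg z)
  | .sub x y z, σ => σ.setReg W x (σ.reg y - σ.reg z)
  | .mul x y z, σ => σ.setReg W x (σ.reg y * σ.reg z)
  | .div x y z, σ => σ.setReg W x (σ.reg y / σ.reg z)
  | .load x a y, σ => if σ.reg y < S then σ.setReg W x (σ.mem a (σ.reg y)) else none
  | .store a y x, σ => if σ.reg y < S then some (σ.setMem a (σ.reg y) (σ.reg x)) else none
  | .dist x y z, σ =>
      if h : σ.reg y < n ∧ σ.reg z < n then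
        some (σ.setDReg x (d ⟨σ.reg y, h.1⟩ ⟨σ.reg z, h.2⟩))
      else none
  | .dcopy x y, σ => some (σ.setDReg x (σ.dreg y))
  | .dadd x y z, σ => some (σ.setDReg x (σ.dreg y + σ.dreg z))
  | .dsub x y z, σ => some (σ.setDReg x (σ.dreg y - σ.dreg z))
  | .dload x a y, σ => if σ.reg y < S then some (σ.setDReg x (σ.dmem a (σ.reg y))) else none
  | .dstore a y x, σ => if σ.reg y < S then some (σ.setDMem a (σ.reg y) (σ.dreg x)) else none

/-- Truth of a test in a state. -/
def Test.Holds : Test → State R → Prop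
  | .lt x y, σ => σ.reg x < σ.reg y
  | .eq x y, σ => σ.reg x = σ.reg y
  | .dlt x y, σ => σ.dreg x < σ.dreg y
  | .not b, σ => ¬ b.Holds σ

/-- `Exec d S W p σ t σ'`: started in the state `σ`, the program `p` runs without a fault and halts
in the state `σ'` after `t` steps. Each instruction and each evaluation of a test is one step. -/
inductive Exec {n : ℕ} (d : Fin n → Fin n → R) (S W : ℕ) :
    Prog → State R → ℕ → State R → Prop
  | skip (σ : State R) : Exec d S W .skip σ 0 σ
  | instr {i : Instr} {σ σ' : State R} (h : i.exec d S W σ = some σ') :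
      Exec d S W (.instr i) σ 1 σ'
  | seq {p q : Prog} {σ σ' σ'' : State R} {t t' : ℕ} (hp : Exec d S W p σ t σ')
      (hq : Exec d S W q σ' t' σ'') : Exec d S W (.seq p q) σ (t + t') σ''
  | ite_true {b : Test} {p q : Prog} {σ σ' : State R} {t : ℕ} (hb : b.Holds σ)
      (hp : Exec d S W p σ t σ') : Exec d S W (.ite b p q) σ (t + 1) σ'
  | ite_false {b : Test} {p q : Prog} {σ σ' : State R} {t : ℕ} (hb : ¬ b.Holds σ)
      (hq : Exec d S W q σ t σ') : Exec d S W (.ite b p q) σ (t + 1) σ'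
  | loop_true {b : Test} {p : Prog} {σ σ' σ'' : State R} {t t' : ℕ} (hb : b.Holds σ)
      (hp : Exec d S W p σ t σ') (hl : Exec d S W (.loop b p) σ' t' σ'') :
      Exec d S W (.loop b p) σ (t + t' + 1) σ''
  | loop_false {b : Test} {p : Prog} {σ : State R} (hb : ¬ b.Holds σ) :
      Exec d S W (.loop b p) σ 1 σ

/-- Initial state: register `0` holds the number `n` of sites, register `1` holds the start site,
and everything else is zero. -/
def initState (R : Type u) [AddCommGroup R] {n : ℕ} (s : Fin n) : State R where
  reg := fun x => if x = 0 then n else if x = 1 then (s : ℕ) else 0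
  dreg := fun _ => 0
  mem := fun _ _ => 0
  dmem := fun _ _ => 0

end Semantics

/-- The program `P` implements the cheapest insertion heuristic in time `T`, with arrays of size `S`
and integers at most `W` (functions of the number `n` of sites): for every distance function on `n`
sites with values in any totally ordered abelian group and every start site, it halts within `T n`
steps without a fault, and then the first `n` cells of the integer array `0` hold the sites of a
tour produced by the heuristic, in the order of the tour. -/
def Implements (P : Prog) (T S W : ℕ → ℕ) : Prop :=
  ∀ (R : Type u) [AddCommGroup R] [LinearOrder R] [IsOrderedAddMonoid R]
    (n : ℕ) (d : Fin n → Fin n → R) (s : Fin n),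
    ∃ (t : ℕ) (σ : State R), t ≤ T n ∧ Exec d (S n) (W n) P (initState R s) t σ ∧
      ∃ l : List (Fin n), IsResult d s l ∧
        l.map Fin.val = (List.range n).map (σ.mem 0)

/-- The machine integers have `O(log n)` bits, that is, they are bounded by a polynomial in `n`. -/
def PolyBounded (W : ℕ → ℕ) : Prop :=
  ∃ k : ℕ, (fun n => (W n : ℝ)) =O[atTop] fun n : ℕ => (n : ℝ) ^ k

end CheapestInsertion

namespace CheapestInsertion

set_option linter.unusedSectionVars false
set_option linter.unusedSimpArgs false

/-! ## Reasoning about programs -/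

/-! Both programs run the same main loop, `driver`. It stores the tour as a linked list, that is, by
a membership flag and a successor for each site. A data structure supplies a pair of a tour site `a`
and a missing site `x` with least `insCost`. By `Represents.insert`, splicing `x` in after `a` is a
step of the heuristic. Flags and successors then change only at `a` and `x`, so the data structure
has to survive `n` updates, each at two sites. `Maintains` is its contract, and
`Maintains.runs_driver` sums the update times.

Quadratic time: the pyramid. Over a binary tree on the sites, each pair of nodes of the same level
stores the best candidate below it, found by comparing four cells one level down. A change at a site
spoils only the row and the column of its ancestor on each level. The level sizes form a geometric
series, so an update takes linear time (`runs_pyrUpdate`).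

Linear space: conga lines. Although `d` is asymmetric, a pair of a tour site and a missing site has
one cost, `pairCost`, so the task is to maintain a closest pair of two colours. A path visits all
owners, always moving on to the cheapest unvisited site of the other colour; each move is a record.
For a pair that contains an owner, the site processed first had the other as a candidate, so its
record is at most as expensive (`PathCov.push`). Since one of two consecutive sites must be an
owner, `N` owners cause at most `3 * N` records.

The paths form a stack. Update `t` discards what was pushed since update `t - gcd (2 ^ k) t`, or
everything if `2 ^ k` divides `t`. The changed sites, the sources of records that lead to them, and
the owners of the discarded part become the owners of a new path; at a full rebuild all sites do.
All other pairs remain covered (`covered_of_change`). Down the stack the gcds at least double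
(`two_mul_gcd_le`). Hence there are at most `k + 1` segments, few records lead to any site, the
height is linear for a period near `n / log n`, and the number of new owners is `O(log n)` times the
gcd (`StackBefore.unvisited_le`). A record costs a linear scan, and the gcds sum to `O(n log n)`
(`sum_gcd_two_pow_le`), which gives the two logarithms. -/

/-- Straight-line code. -/
def Prog.block : List Instr → Prog
  | [] => .skip
  | i :: is => .seq (.instr i) (Prog.block is)

infixr:60 " ;; " => Prog.seq

section Logic

variable {R : Type u} [AddCommGroup R] [LinearOrder R] {n : ℕ}

/-- The distance function as a function of natural numbers. -/
def extDist (d : Fin n → Fin n → R) (p q : ℕ) : R :=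
  if h : p < n ∧ q < n then d ⟨p, h.1⟩ ⟨q, h.2⟩ else 0

/-- From `σ`, the program `p` halts within `T` steps in a state that satisfies `Q`. -/
def Runs (d : Fin n → Fin n → R) (S W : ℕ) (p : Prog) (T : ℕ) (σ : State R)
    (Q : State R → Prop) : Prop :=
  ∃ t σ', t ≤ T ∧ Exec d S W p σ t σ' ∧ Q σ'

/-- Weakest precondition of an instruction. -/
def wpi (d : Fin n → Fin n → R) (S W : ℕ) (i : Instr) (Q : State R → Prop) (σ : State R) : Prop :=
  ∃ σ', i.exec d S W σ = some σ' ∧ Q σ'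

/-- Weakest precondition of a program without loops. -/
def wp (d : Fin n → Fin n → R) (S W : ℕ) : Prog → (State R → Prop) → State R → Prop
  | .skip, Q, σ => Q σ
  | .instr i, Q, σ => wpi d S W i Q σ
  | .seq p q, Q, σ => wp d S W p (wp d S W q Q) σ
  | .ite b p q, Q, σ => (b.Holds σ → wp d S W p Q σ) ∧ (¬ b.Holds σ → wp d S W q Q σ)
  | .loop _ _, _, _ => False

/-- Bound for the number of steps of a program without loops. -/
def Prog.cost : Prog → ℕ
  | .skip => 0
  | .instr _ => 1
  | .seq p q => p.cost + q.cost
  | .ite _ p q => max p.cost q.cost + 1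
  | .loop _ _ => 0

variable {d : Fin n → Fin n → R} {S W : ℕ}

/-! ### Weakest preconditions as rewriting rules -/

section wp

variable (Q : State R → Prop) (σ : State R) (x y z a c : ℕ) (b : Test) (i : Instr)
  (is : List Instr) (p q : Prog)

theorem exists_setReg_iff (v : ℕ) : (∃ σ', σ.setReg W x v = some σ' ∧ Q σ') ↔
    v ≤ W ∧ Q ⟨Function.update σ.reg x v, σ.dreg, σ.mem, σ.dmem⟩ := by
  unfold State.setReg
  split_ifs with h <;> simp [h]

theorem wpi_const : wpi d S W (.const x c) Q σ ↔
    c ≤ W ∧ Q ⟨Function.update σ.reg x c, σ.dreg, σ.mem, σ.dmem⟩ := exists_setReg_iff ..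

theorem wpi_copy : wpi d S W (.copy x y) Q σ ↔
    σ.reg y ≤ W ∧ Q ⟨Function.update σ.reg x (σ.reg y), σ.dreg, σ.mem, σ.dmem⟩ :=
  exists_setReg_iff ..

theorem wpi_add : wpi d S W (.add x y z) Q σ ↔ σ.reg y + σ.reg z ≤ W ∧
    Q ⟨Function.update σ.reg x (σ.reg y + σ.reg z), σ.dreg, σ.mem, σ.dmem⟩ :=
  exists_setReg_iff ..

theorem wpi_sub : wpi d S W (.sub x y z) Q σ ↔ σ.reg y - σ.reg z ≤ W ∧
    Q ⟨Function.update σ.reg x (σ.reg y - σ.reg z), σ.dreg, σ.mem, σ.dmem⟩ :=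
  exists_setReg_iff ..

theorem wpi_mul : wpi d S W (.mul x y z) Q σ ↔ σ.reg y * σ.reg z ≤ W ∧
    Q ⟨Function.update σ.reg x (σ.reg y * σ.reg z), σ.dreg, σ.mem, σ.dmem⟩ :=
  exists_setReg_iff ..

theorem wpi_div : wpi d S W (.div x y z) Q σ ↔ σ.reg y / σ.reg z ≤ W ∧
    Q ⟨Function.update σ.reg x (σ.reg y / σ.reg z), σ.dreg, σ.mem, σ.dmem⟩ :=
  exists_setReg_iff ..

theorem wpi_load : wpi d S W (.load x a y) Q σ ↔ σ.reg y < S ∧ σ.mem a (σ.reg y) ≤ W ∧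
    Q ⟨Function.update σ.reg x (σ.mem a (σ.reg y)), σ.dreg, σ.mem, σ.dmem⟩ := by
  by_cases h : σ.reg y < S <;> simp [wpi, Instr.exec, exists_setReg_iff, h]

theorem wpi_store : wpi d S W (.store a y x) Q σ ↔ σ.reg y < S ∧
    Q ⟨σ.reg, σ.dreg,
      Function.update σ.mem a (Function.update (σ.mem a) (σ.reg y) (σ.reg x)), σ.dmem⟩ := by
  by_cases h : σ.reg y < S <;> simp [wpi, Instr.exec, State.setMem, h]

theorem wpi_dist : wpi d S W (.dist x y z) Q σ ↔ (σ.reg y < n ∧ σ.reg z < n) ∧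
    Q ⟨σ.reg, Function.update σ.dreg x (extDist d (σ.reg y) (σ.reg z)), σ.mem, σ.dmem⟩ := by
  unfold wpi Instr.exec State.setDReg extDist
  split_ifs with h <;> simp [h]

theorem wpi_dcopy : wpi d S W (.dcopy x y) Q σ ↔
    Q ⟨σ.reg, Function.update σ.dreg x (σ.dreg y), σ.mem, σ.dmem⟩ := by
  simp [wpi, Instr.exec, State.setDReg]

theorem wpi_dadd : wpi d S W (.dadd x y z) Q σ ↔
    Q ⟨σ.reg, Function.update σ.dreg x (σ.dreg y + σ.dreg z), σ.mem, σ.dmem⟩ := by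
  simp [wpi, Instr.exec, State.setDReg]

theorem wpi_dsub : wpi d S W (.dsub x y z) Q σ ↔
    Q ⟨σ.reg, Function.update σ.dreg x (σ.dreg y - σ.dreg z), σ.mem, σ.dmem⟩ := by
  simp [wpi, Instr.exec, State.setDReg]

theorem wpi_dload : wpi d S W (.dload x a y) Q σ ↔ σ.reg y < S ∧
    Q ⟨σ.reg, Function.update σ.dreg x (σ.dmem a (σ.reg y)), σ.mem, σ.dmem⟩ := by
  by_cases h : σ.reg y < S <;> simp [wpi, Instr.exec, State.setDReg, h]

theorem wpi_dstore : wpi d S W (.dstore a y x) Q σ ↔ σ.reg y < S ∧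
    Q ⟨σ.reg, σ.dreg, σ.mem,
      Function.update σ.dmem a (Function.update (σ.dmem a) (σ.reg y) (σ.dreg x))⟩ := by
  by_cases h : σ.reg y < S <;> simp [wpi, Instr.exec, State.setDMem, h]

theorem wp_skip : wp d S W .skip Q σ ↔ Q σ := Iff.rfl
theorem wp_seq : wp d S W (p ;; q) Q σ ↔ wp d S W p (wp d S W q Q) σ := Iff.rfl
theorem wp_ite : wp d S W (.ite b p q) Q σ ↔
    (b.Holds σ → wp d S W p Q σ) ∧ (¬ b.Holds σ → wp d S W q Q σ) := Iff.rfl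
theorem wp_nil : wp d S W (.block []) Q σ ↔ Q σ := Iff.rfl
theorem wp_cons : wp d S W (.block (i :: is)) Q σ ↔ wpi d S W i (wp d S W (.block is) Q) σ :=
  Iff.rfl

theorem holds_lt : (Test.lt x y).Holds σ ↔ σ.reg x < σ.reg y := Iff.rfl
theorem holds_eq : (Test.eq x y).Holds σ ↔ σ.reg x = σ.reg y := Iff.rfl
theorem holds_dlt : (Test.dlt x y).Holds σ ↔ σ.dreg x < σ.dreg y := Iff.rfl

end wp

/-- Turns symbolic execution by `simp` into a timed run. Loops are excluded because their weakest
precondition is `False`; they are treated by the loop rules below. -/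
theorem Runs.of_wp {p : Prog} {σ : State R} {Q : State R → Prop} (h : wp d S W p Q σ) :
    Runs d S W p p.cost σ Q := by
  induction p generalizing σ Q with
  | skip => exact ⟨0, σ, le_rfl, .skip σ, h⟩
  | instr i => obtain ⟨σ', h, hQ⟩ := h; exact ⟨1, σ', le_rfl, .instr h, hQ⟩
  | seq p q ihp ihq =>
    obtain ⟨t, σ', ht, he, h'⟩ := ihp h
    obtain ⟨t', σ'', ht', he', h''⟩ := ihq h'
    exact ⟨t + t', σ'', add_le_add ht ht', he.seq he', h''⟩
  | ite b p q ihp ihq =>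
    by_cases hb : b.Holds σ
    · obtain ⟨t, σ', ht, he, h'⟩ := ihp (h.1 hb)
      exact ⟨t + 1, σ', by simp only [Prog.cost]; omega, .ite_true hb he, h'⟩
    · obtain ⟨t, σ', ht, he, h'⟩ := ihq (h.2 hb)
      exact ⟨t + 1, σ', by simp only [Prog.cost]; omega, .ite_false hb he, h'⟩
  | loop b p => exact h.elim

theorem Runs.of_wp_le {p : Prog} {σ : State R} {Q : State R → Prop} {T : ℕ}
    (h : wp d S W p Q σ) (hT : p.cost ≤ T) : Runs d S W p T σ Q := by
  obtain ⟨t, σ', ht, h⟩ := Runs.of_wp h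
  exact ⟨t, σ', ht.trans hT, h⟩

theorem Runs.mono {p : Prog} {T T' : ℕ} {σ : State R} {Q Q' : State R → Prop}
    (h : Runs d S W p T σ Q) (hT : T ≤ T') (hQ : ∀ σ', Q σ' → Q' σ') : Runs d S W p T' σ Q' := by
  obtain ⟨t, σ', ht, he, h⟩ := h
  exact ⟨t, σ', ht.trans hT, he, hQ σ' h⟩

theorem Runs.seq {p q : Prog} {T T' : ℕ} {σ : State R} {P Q : State R → Prop}
    (h : Runs d S W p T σ P) (h' : ∀ σ', P σ' → Runs d S W q T' σ' Q) :
    Runs d S W (p ;; q) (T + T') σ Q := by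
  obtain ⟨t, σ', ht, he, h⟩ := h
  obtain ⟨t', σ'', ht', he', h'⟩ := h' σ' h
  exact ⟨t + t', σ'', add_le_add ht ht', he.seq he', h'⟩

theorem Runs.ite {b : Test} {p q : Prog} {T : ℕ} {σ : State R} {Q : State R → Prop}
    (hp : b.Holds σ → Runs d S W p T σ Q) (hq : ¬ b.Holds σ → Runs d S W q T σ Q) :
    Runs d S W (.ite b p q) (T + 1) σ Q := by
  by_cases hb : b.Holds σ
  · obtain ⟨t, σ', ht, he, h⟩ := hp hb
    exact ⟨t + 1, σ', by omega, .ite_true hb he, h⟩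
  · obtain ⟨t, σ', ht, he, h⟩ := hq hb
    exact ⟨t + 1, σ', by omega, .ite_false hb he, h⟩

/-- Loops with a potential function that pays for the steps. -/
theorem Runs.loop_potential {b : Test} {p : Prog} (I : State R → Prop) (Φ : State R → ℕ)
    (h : ∀ σ, I σ → b.Holds σ → ∃ c, Runs d S W p c σ fun σ' => I σ' ∧ Φ σ' + c + 1 ≤ Φ σ)
    {σ : State R} (hσ : I σ) :
    Runs d S W (.loop b p) (Φ σ + 1) σ fun σ' => I σ' ∧ ¬ b.Holds σ' := by
  -- Each round, with its test, is paid for by the drop of `Φ`; the additional step is the last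
  -- test, which fails.
  induction hm : Φ σ using Nat.strong_induction_on generalizing σ with
  | _ m ih =>
  by_cases hb : b.Holds σ
  · obtain ⟨c, t, σ', ht, he, hI, hΦ⟩ := h σ hσ hb
    obtain ⟨t', σ'', ht', he', h'⟩ := ih (Φ σ') (by omega) hI rfl
    exact ⟨t + t' + 1, σ'', by omega, .loop_true hb he he', h'⟩
  · exact ⟨1, σ, by omega, .loop_false hb, hσ, hb⟩

/-- Loops whose body takes at most `c` steps and decreases a measure. -/
theorem Runs.loop_measure {b : Test} {p : Prog} (I : State R → Prop) (μ : State R → ℕ) (c : ℕ)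
    (h : ∀ σ, I σ → b.Holds σ → Runs d S W p c σ fun σ' => I σ' ∧ μ σ' < μ σ)
    {σ : State R} (hσ : I σ) :
    Runs d S W (.loop b p) ((c + 1) * μ σ + 1) σ fun σ' => I σ' ∧ ¬ b.Holds σ' := by
  refine Runs.loop_potential I (fun σ => (c + 1) * μ σ) (fun σ hI hb => ⟨c, ?_⟩) hσ
  refine (h σ hI hb).mono le_rfl fun σ' h' => ⟨h'.1, ?_⟩
  have := Nat.mul_le_mul_left (c + 1) (Nat.succ_le_of_lt h'.2)
  rw [Nat.mul_succ] at this
  omega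

/-- Counting loops. The invariant may speak of the counter. -/
theorem Runs.loop_count {x y m : ℕ} {p : Prog} (I : ℕ → State R → Prop) (c : ℕ)
    (hI : ∀ k σ, I k σ → σ.reg x = k ∧ σ.reg y = m)
    (h : ∀ k σ, k < m → I k σ → Runs d S W p c σ (I (k + 1)))
    {σ : State R} {k₀ : ℕ} (hk : k₀ ≤ m) (hσ : I k₀ σ) :
    Runs d S W (.loop (.lt x y) p) ((c + 1) * (m - k₀) + 1) σ (I m) := by
  have := Runs.loop_measure (d := d) (S := S) (W := W) (b := .lt x y) (p := p)
    (fun σ => ∃ k ≤ m, I k σ) (fun σ => m - σ.reg x) c ?_ ⟨k₀, hk, hσ⟩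
  · rw [(hI _ _ hσ).1] at this
    refine this.mono le_rfl ?_
    rintro σ' ⟨⟨k, hk, h'⟩, hb⟩
    obtain ⟨h1, h2⟩ := hI _ _ h'
    rw [holds_lt, h1, h2] at hb
    rwa [show m = k by omega]
  · rintro σ ⟨k, hk, h'⟩ hb
    obtain ⟨h1, h2⟩ := hI _ _ h'
    rw [holds_lt, h1, h2] at hb
    refine (h k σ hb h').mono le_rfl fun σ' h'' => ⟨⟨k + 1, hb, h''⟩, ?_⟩
    obtain ⟨h3, _⟩ := hI _ _ h''
    rw [h1, h3]
    omega

end Logic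

/-! ## Best candidates -/

section Best

variable {ι : Type*} {R : Type u} [LinearOrder R]

/-- The flag `f` tells whether some index satisfies `P`; if so, `j` is one with the least value
`w` of `v`. -/
def IsBest (P : ι → Prop) (v : ι → R) (f : ℕ) (j : ι) (w : R) : Prop :=
  (f = 1 ∧ P j ∧ w = v j ∧ ∀ k, P k → v j ≤ v k) ∨ (f = 0 ∧ ∀ k, ¬ P k)

theorem IsBest.congr {P P' : ι → Prop} {v v' : ι → R} {f : ℕ} {j : ι} {w : R}
    (h : IsBest P v f j w) (hP : ∀ k, P' k ↔ P k) (hv : ∀ k, P k → v' k = v k) :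
    IsBest P' v' f j w := by
  rcases h with ⟨h1, h2, h3, h4⟩ | ⟨h1, h2⟩
  · refine .inl ⟨h1, (hP j).2 h2, by rw [h3, hv j h2], fun k hk => ?_⟩
    rw [hv j h2, hv k ((hP k).1 hk)]
    exact h4 k ((hP k).1 hk)
  · exact .inr ⟨h1, fun k hk => h2 k ((hP k).1 hk)⟩

/-- The first of two best candidates is best if the second is missing or not better. -/
theorem IsBest.left {P P' : ι → Prop} {v : ι → R} {f f' : ℕ} {j j' : ι} {w w' : R}
    (h : IsBest P v f j w) (h' : IsBest P' v f' j' w')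
    (hc : f' ≠ 1 ∨ (f = 1 ∧ ¬ w' < w)) : IsBest (fun k => P k ∨ P' k) v f j w := by
  rcases h with ⟨h1, h2, h3, h4⟩ | ⟨h1, h2⟩ <;> rcases h' with ⟨h5, h6, h7, h8⟩ | ⟨h5, h6⟩
  · refine .inl ⟨h1, .inl h2, h3, fun k hk => hk.elim (h4 k) fun hk => ?_⟩
    have := hc.resolve_left (by simp [h5])
    rw [h7, h3] at this
    exact (not_lt.1 this.2).trans (h8 k hk)
  · exact .inl ⟨h1, .inl h2, h3, fun k hk => hk.elim (h4 k) fun hk => (h6 k hk).elim⟩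
  · exact absurd (hc.resolve_left (by simp [h5])).1 (by omega)
  · exact .inr ⟨h1, fun k hk => hk.elim (h2 k) (h6 k)⟩

/-- The second of two best candidates is best if the first is missing or not better. -/
theorem IsBest.right {P P' : ι → Prop} {v : ι → R} {f f' : ℕ} {j j' : ι} {w w' : R}
    (h : IsBest P v f j w) (h' : IsBest P' v f' j' w') (hf' : f' = 1)
    (hc : f ≠ 1 ∨ w' < w) : IsBest (fun k => P k ∨ P' k) v f' j' w' := by
  have := h'.left h (hc.imp id fun hw => ⟨hf', hw.not_gt⟩)
  exact this.congr (fun k => or_comm) fun _ _ => rfl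

theorem isBest_single {P : ι → Prop} {v : ι → R} {j : ι} {w : R} (hP : ∀ k, P k ↔ k = j)
    (hw : w = v j) : IsBest P v 1 j w :=
  .inl ⟨rfl, (hP j).2 rfl, hw, fun k hk => by rw [(hP k).1 hk]⟩

theorem isBest_none {P : ι → Prop} {v : ι → R} {j : ι} {w : R} (hP : ∀ k, ¬ P k) :
    IsBest P v 0 j w := .inr ⟨rfl, hP⟩

end Best

/-! ## Tours as linked lists -/

section Tours

variable {R : Type u} [AddCommGroup R] [LinearOrder R] {n : ℕ}

/-- Additional length caused by the insertion of `x` after `a`, if `f` maps each site of the tour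
to the next one. -/
def insCost (d : Fin n → Fin n → R) (f : ℕ → ℕ) (a x : ℕ) : R :=
  extDist d a x + extDist d x (f a) - extDist d a (f a)

/-- The function `f` maps each entry of `c :: w` to the next one, and the last entry to `z`. -/
def Linked (f : ℕ → ℕ) : Fin n → List (Fin n) → Fin n → Prop
  | c, [], z => f c = z
  | c, b :: w, z => f c = b ∧ Linked f b w z

/-- Length of the path that visits `c`, the entries of `w`, and `z`. -/
def pathLength (d : Fin n → Fin n → R) : Fin n → List (Fin n) → Fin n → R
  | c, [], z => d c z
  | c, b :: w, z => d c b + pathLength d b w z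

theorem tourLength_cons (d : Fin n → Fin n → R) (c : Fin n) (w : List (Fin n)) :
    tourLength d (c :: w) = pathLength d c w c := by
  -- The end of the path is separated from its start, because the induction moves the start only.
  have key : ∀ (w : List (Fin n)) (c z : Fin n),
      (List.zipWith d (c :: w) (w ++ [z])).sum = pathLength d c w z := by
    intro w
    induction w with
    | nil => intro c z; simp [pathLength]
    | cons b w ih => intro c z; simp [pathLength, ← ih b z]
  rw [tourLength, List.rotate_cons_succ, List.rotate_zero, key]

theorem extDist_val (d : Fin n → Fin n → R) (a b : Fin n) : extDist d a b = d a b := by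
  simp [extDist]

theorem Linked.congr {f g : ℕ → ℕ} {c z : Fin n} {w : List (Fin n)} (h : Linked f c w z)
    (hfg : ∀ p ∈ c :: w, g p = f p) : Linked g c w z := by
  induction w generalizing c with
  | nil => exact (hfg c (by simp)).trans h
  | cons b w ih =>
    exact ⟨(hfg c (by simp)).trans h.1, ih h.2 fun p hp => hfg p (List.mem_cons_of_mem _ hp)⟩

/-- A single edge is replaced, the one that leaves entry `i` of `c :: w`; index `i` of `w` is the
place right after that entry. -/
theorem pathLength_insertIdx (d : Fin n → Fin n → R) {f : ℕ → ℕ} {c z x : Fin n}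
    {w : List (Fin n)} (h : Linked f c w z) (i : ℕ) (hi : i < (c :: w).length) :
    pathLength d c (w.insertIdx i x) z = pathLength d c w z + insCost d f (c :: w)[i] x := by
  induction w generalizing c i with
  | nil =>
    obtain rfl : i = 0 := by simpa using hi
    have h' : f c = z := h
    simp [pathLength, insCost, h', extDist_val]
  | cons b w ih =>
    cases i with
    | zero =>
      simp only [List.insertIdx_zero, pathLength, List.getElem_cons_zero, insCost, h.1,
        extDist_val]
      abel
    | succ i =>
      simp only [List.insertIdx_succ_cons, pathLength, List.getElem_cons_succ]
      rw [ih h.2 i (by simpa using hi)]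
      exact (add_assoc _ _ _).symm

/-- Two pointer writes splice `x` in. They spoil no other link because the entries are distinct and
`x` is new. -/
theorem Linked.insertIdx {f : ℕ → ℕ} {c z x : Fin n} {w : List (Fin n)} (h : Linked f c w z)
    (hn : (c :: w).Nodup) (hx : x ∉ c :: w) (i : ℕ) (hi : i < (c :: w).length) :
    Linked (Function.update (Function.update f x (f (c :: w)[i])) (c :: w)[i] x) c
      (w.insertIdx i x) z := by
  induction w generalizing c i with
  | nil =>
    obtain rfl : i = 0 := by simpa using hi
    have hxc : (x : ℕ) ≠ c := by simpa [Fin.ext_iff] using hx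
    have h' : f c = z := h
    simp [Linked, hxc, h']
  | cons b w ih =>
    have hxc : (x : ℕ) ≠ c := fun h => hx (by simp [Fin.ext_iff, h])
    have hmem : ∀ p ∈ b :: w, (p : ℕ) ≠ c ∧ (p : ℕ) ≠ x := by
      intro p hp
      refine ⟨fun h => ?_, fun h => ?_⟩
      · rw [Fin.val_inj] at h; subst h; exact (List.nodup_cons.1 hn).1 hp
      · rw [Fin.val_inj] at h; subst h; exact hx (List.mem_cons_of_mem _ hp)
    cases i with
    | zero =>
      refine ⟨by simp, ?_, ?_⟩
      · simp [hxc, h.1]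
      · refine h.2.congr fun p hp => ?_
        simp [(hmem p hp).1, (hmem p hp).2]
    | succ i =>
      have hi' : i < (b :: w).length := by simpa using hi
      refine ⟨?_, ?_⟩
      · have := hmem ((b :: w)[i]) (List.getElem_mem hi')
        simp only [List.getElem_cons_succ]
        rw [Function.update_of_ne (Ne.symm this.1), Function.update_of_ne (Ne.symm hxc), h.1]
      · exact ih h.2 (List.nodup_cons.1 hn).2 (fun h => hx (List.mem_cons_of_mem _ h)) i hi'

/-- The site `p` is in the tour and the site `q` is not, if `g` is the indicator function of the
tour. -/
def Valid (n : ℕ) (g : ℕ → ℕ) (p q : ℕ) : Prop := (p < n ∧ q < n) ∧ g p = 1 ∧ g q = 0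

/-- A cheapest insertion. -/
def MinPair (d : Fin n → Fin n → R) (g f : ℕ → ℕ) (a x : ℕ) : Prop :=
  Valid n g a x ∧ ∀ p q, Valid n g p q → insCost d f a x ≤ insCost d f p q

/-- The functions `g` and `f` represent a tour `s :: w` produced by the heuristic. -/
structure Represents (d : Fin n → Fin n → R) (s : Fin n) (g f : ℕ → ℕ) (w : List (Fin n)) :
    Prop where
  nodup : (s :: w).Nodup
  steps : Relation.ReflTransGen (Step d) [s] (s :: w)
  linked : Linked f s w s
  flag : ∀ p : Fin n, g p = if p ∈ s :: w then 1 else 0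

/-- The bridge from flags and pointers to the heuristic on lists: a cheapest pair yields a
legitimate `Step`. -/
theorem Represents.insert {d : Fin n → Fin n → R} {s : Fin n}
    {g f : ℕ → ℕ} {w : List (Fin n)} (h : Represents d s g f w) {a x : ℕ}
    (hm : MinPair d g f a x) :
    ∃ w', w'.length = w.length + 1 ∧ Represents d s (Function.update g x 1)
      (Function.update (Function.update f x (f a)) a x) w' := by
  obtain ⟨⟨⟨ha, hx⟩, hga, hgx⟩, hmin⟩ := hm
  lift a to Fin n using ha
  lift x to Fin n using hx
  have ha : a ∈ s :: w := by
    by_contra hc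
    rw [h.flag, if_neg hc] at hga
    omega
  have hx : x ∉ s :: w := by
    intro hc
    rw [h.flag, if_pos hc] at hgx
    omega
  obtain ⟨i, hi, rfl⟩ := List.getElem_of_mem ha
  have hlen : i ≤ w.length := by simpa [Nat.lt_succ_iff] using hi
  refine ⟨w.insertIdx i x, List.length_insertIdx_of_le_length hlen _, ?_⟩
  have hperm : (s :: w.insertIdx i x).Perm (x :: s :: w) :=
    ((List.perm_insertIdx x w hlen).cons s).trans (List.Perm.swap ..)
  -- This holds for every possible insertion, so minimality of `insCost` over pairs is the
  -- minimality that `Step` demands.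
  have hcost : ∀ (j : ℕ) (hj : j < (s :: w).length) (y : Fin n),
      tourLength d ((s :: w).insertIdx (j + 1) y) - tourLength d (s :: w) =
        insCost d f (s :: w)[j] y := by
    intro j hj y
    rw [List.insertIdx_succ_cons, tourLength_cons, tourLength_cons,
      pathLength_insertIdx d h.linked j hj, add_sub_cancel_left]
  refine ⟨?_, h.steps.tail ⟨⟨x, hx, i, hi, by rw [List.insertIdx_succ_cons]⟩, ?_⟩,
    h.linked.insertIdx h.nodup hx i hi, ?_⟩
  · rw [hperm.nodup_iff, List.nodup_cons]
    exact ⟨hx, h.nodup⟩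
  · rintro _ ⟨y, hy, j, hj, rfl⟩
    have := hcost i hi x
    rw [List.insertIdx_succ_cons] at this
    rw [this, hcost j hj y]
    refine hmin _ _ ⟨⟨Fin.is_lt _, Fin.is_lt _⟩, ?_, ?_⟩
    · rw [h.flag, if_pos (List.getElem_mem hj)]
    · rw [h.flag, if_neg hy]
  · intro p
    simp only [hperm.mem_iff, List.mem_cons (a := p) (b := x)]
    by_cases hp : p = x
    · simp [hp]
    · rw [Function.update_of_ne (by simpa [Fin.ext_iff] using hp), h.flag]
      simp [hp]

theorem represents_singleton (d : Fin n → Fin n → R) (s : Fin n) {g f : ℕ → ℕ}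
    (hg : ∀ p, g p = if p = s then 1 else 0) (hf : f s = s) : Represents d s g f [] :=
  ⟨by simp, .refl, hf, fun p => by simp [hg, Fin.val_inj]⟩

theorem Represents.mem_of_length {d : Fin n → Fin n → R} {s : Fin n} {g f : ℕ → ℕ}
    {w : List (Fin n)} (h : Represents d s g f w) (hw : w.length + 1 = n) (p : Fin n) :
    p ∈ s :: w := by
  have h1 : (s :: w).toFinset.card = n := by
    rw [List.toFinset_card_of_nodup h.nodup]; simpa using hw
  have := Finset.eq_univ_of_card (s :: w).toFinset (by simpa using h1)
  rw [← List.mem_toFinset, this]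
  exact Finset.mem_univ p

theorem Represents.exists_valid {d : Fin n → Fin n → R} {s : Fin n} {g f : ℕ → ℕ}
    {w : List (Fin n)} (h : Represents d s g f w) (hw : w.length + 1 < n) :
    ∃ p q, Valid n g p q := by
  have : ∃ q, q ∉ s :: w := by
    by_contra! hc
    have h1 : (s :: w).toFinset = Finset.univ := by ext p; simpa using hc p
    have h2 := List.toFinset_card_of_nodup h.nodup
    rw [h1, Finset.card_univ, Fintype.card_fin, List.length_cons] at h2
    omega
  obtain ⟨q, hq⟩ := this
  exact ⟨s, q, ⟨s.2, q.2⟩, by simp [h.flag], by rw [h.flag, if_neg hq]⟩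

/-- The output loop follows successors; this identifies what it writes with the tour. -/
theorem Linked.iterate {f : ℕ → ℕ} {c z : Fin n} {w : List (Fin n)} (h : Linked f c w z) :
    (c :: w).map Fin.val = (List.range (w.length + 1)).map fun k => f^[k] c := by
  induction w generalizing c with
  | nil => simp
  | cons b w ih =>
    rw [List.map_cons, ih h.2, List.length_cons, List.range_succ_eq_map (n := w.length + 1),
      List.map_cons, List.map_map]
    congr 1
    refine List.map_congr_left fun k _ => ?_
    simp [Function.iterate_succ_apply, h.1]

end Tours

/-! ## The main loop -/

/-- Cheapest insertion with a data structure that supplies the cheapest insertion. Register `0`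
holds the number of sites, register `2` holds one, registers `4` and `5` the insertion to be made,
and register `6` the number of insertions made. The integer array `1` holds the indicator function
of the tour, and the integer array `2` maps each site of the tour to the next one. -/
def driver (init update : Prog) : Prog :=
  (.block [.const 2 1, .store 1 1 2, .store 2 1 1, .copy 4 1, .copy 5 1] ;; init ;; update ;;
    .block [.const 6 1]) ;;
  .loop (.lt 6 0) (.block [.load 20 2 4, .store 2 5 20, .store 2 4 5, .store 1 5 2] ;;
    update ;; .block [.add 6 6 2]) ;;
  .block [.copy 20 1, .const 21 0] ;;
  .loop (.lt 21 0) (.block [.store 0 21 20, .load 20 2 20, .add 21 21 2])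

section Driver

variable {R : Type u} [AddCommGroup R] [LinearOrder R] {n : ℕ}

/-- The state `σ'` agrees with `σ` on the registers of the main loop that its data structure must
not change, and on the arrays that hold the tour. -/
structure Keeps (σ σ' : State R) : Prop where
  reg : ∀ r < 7, r ≠ 4 → r ≠ 5 → σ'.reg r = σ.reg r
  mem : ∀ a < 3, σ'.mem a = σ.mem a

/-- The state is ready for an update after a change of the tour at two sites. The tour before the
change is given by `g` and `f`. -/
structure Ready (n t : ℕ) (g f : ℕ → ℕ) (σ : State R) : Prop where
  reg_zero : σ.reg 0 = n
  reg_two : σ.reg 2 = 1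
  reg_three : σ.reg 3 = 0
  reg_four : σ.reg 4 < n
  reg_five : σ.reg 5 < n
  reg_six : σ.reg 6 = t
  flag_le : ∀ p, σ.mem 1 p ≤ 1
  next_lt : ∀ p, σ.mem 2 p < n
  flag_eq : ∀ p, p ≠ σ.reg 4 → p ≠ σ.reg 5 → σ.mem 1 p = g p
  next_eq : ∀ p, p ≠ σ.reg 4 → p ≠ σ.reg 5 → σ.mem 2 p = f p

/-- Requirements on a data structure. The invariant `J t g f` says that it is up to date for the
tour given by `g` and `f`, after `t` updates. -/
structure Maintains (d : Fin n → Fin n → R) (S W : ℕ) (init update : Prog) (T : ℕ) (T' : ℕ → ℕ)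
    (J : ℕ → (ℕ → ℕ) → (ℕ → ℕ) → State R → Prop) : Prop where
  congr : ∀ {t g f σ σ'}, J t g f σ → (∀ r, 10 ≤ r → r < 20 → σ'.reg r = σ.reg r) →
    (∀ a, 3 ≤ a → σ'.mem a = σ.mem a) → σ'.dmem = σ.dmem → J t g f σ'
  init : ∀ σ, σ.reg 0 = n → σ.reg 2 = 1 → (∀ r, 6 ≤ r → σ.reg r = 0) →
    (∀ a, 3 ≤ a → ∀ j, σ.mem a j = 0) → Runs d S W init T σ fun σ' =>
      J 0 (fun _ => 0) (fun _ => 0) σ' ∧ Keeps σ σ' ∧ σ'.reg 4 = σ.reg 4 ∧ σ'.reg 5 = σ.reg 5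
  update : ∀ t g f σ, t < n → J t g f σ → Ready n t g f σ →
    Runs d S W update (T' t) σ fun σ' =>
      J (t + 1) (σ.mem 1) (σ.mem 2) σ' ∧ Keeps σ σ' ∧
      ((∃ p q, Valid n (σ.mem 1) p q) →
        MinPair d (σ.mem 1) (σ.mem 2) (σ'.reg 4) (σ'.reg 5))

/-- The invariant of the main loop. -/
structure MainInv (d : Fin n → Fin n → R) (s : Fin n)
    (J : ℕ → (ℕ → ℕ) → (ℕ → ℕ) → State R → Prop) (t : ℕ) (σ : State R) : Prop where
  reg_zero : σ.reg 0 = n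
  reg_one : σ.reg 1 = s
  reg_two : σ.reg 2 = 1
  reg_three : σ.reg 3 = 0
  reg_six : σ.reg 6 = t
  le : t ≤ n
  flag_le : ∀ p, σ.mem 1 p ≤ 1
  next_lt : ∀ p, σ.mem 2 p < n
  tour : ∃ w, w.length + 1 = t ∧ Represents d s (σ.mem 1) (σ.mem 2) w
  inv : J t (σ.mem 1) (σ.mem 2) σ
  minPair : t < n → MinPair d (σ.mem 1) (σ.mem 2) (σ.reg 4) (σ.reg 5)

variable {d : Fin n → Fin n → R} {S W : ℕ} {init update : Prog} {T : ℕ} {T' : ℕ → ℕ}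
  {J : ℕ → (ℕ → ℕ) → (ℕ → ℕ) → State R → Prop}

/-- The writes touch flags and successors only at the sites in registers 4 and 5, which is the
damage that `Ready` allows. The update repairs the data structure and supplies the next insertion if
a site is still missing. -/
theorem Maintains.step (h : Maintains d S W init update T T' J) (hS : n ≤ S) (hW : n + 1 ≤ W)
    {s : Fin n} {t : ℕ} {σ : State R} (hσ : MainInv d s J t σ) (ht : t < n) :
    Runs d S W (.block [.load 20 2 4, .store 2 5 20, .store 2 4 5, .store 1 5 2] ;;
      update ;; .block [.add 6 6 2]) (4 + (T' t + 1)) σ (MainInv d s J (t + 1)) := by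
  have hm := hσ.minPair ht
  obtain ⟨w, hw, hr⟩ := hσ.tour
  obtain ⟨w', hw', hr'⟩ := hr.insert hm
  obtain ⟨⟨⟨ha, hx⟩, hga, hgx⟩, -⟩ := hm
  have hax : σ.reg 4 ≠ σ.reg 5 := fun h => by rw [h, hgx] at hga; omega
  refine Runs.seq (P := fun σ' => Represents d s (σ'.mem 1) (σ'.mem 2) w' ∧
    Ready n t (σ.mem 1) (σ.mem 2) σ' ∧ J t (σ.mem 1) (σ.mem 2) σ' ∧ σ'.reg 1 = s)
    (Runs.of_wp ?_) ?_
  · have h1 := hσ.next_lt (σ.reg 4)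
    simp [wp_cons, wp_nil, wpi_load, wpi_store, hσ.reg_two]
    refine ⟨by omega, by omega, by omega, by omega, by omega, hr', ?_, ?_, hσ.reg_one⟩
    · constructor <;> simp
      · exact hσ.reg_zero
      · exact hσ.reg_two
      · exact hσ.reg_three
      · exact ha
      · exact hx
      · exact hσ.reg_six
      · intro p
        have := hσ.flag_le p
        rw [Function.update_apply]
        split_ifs <;> omega
      · intro p
        have := hσ.next_lt p
        rw [Function.update_apply, Function.update_apply]
        split_ifs <;> omega
      · intro p hp hp'
        rw [Function.update_of_ne hp']
      · intro p hp hp'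
        rw [Function.update_of_ne hp, Function.update_of_ne hp']
    · exact h.congr hσ.inv (by intros; simp (disch := omega)) (by intros; simp (disch := omega)) rfl
  · rintro σ₁ ⟨hr₁, hready, hJ, hs⟩
    refine (h.update t _ _ σ₁ ht hJ hready).seq ?_
    rintro σ₂ ⟨hJ₂, hk, hmin⟩
    have hg := hk.mem 1 (by omega)
    have hf := hk.mem 2 (by omega)
    have h6 := hk.reg 6 (by omega) (by omega) (by omega)
    have h2 := hk.reg 2 (by omega) (by omega) (by omega)
    rw [hready.reg_six] at h6
    rw [hready.reg_two] at h2
    refine Runs.of_wp ?_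
    simp only [wp_cons, wp_nil, wpi_add, h6, h2]
    refine ⟨by omega, ?_⟩
    rw [← hg, ← hf] at hJ₂ hmin hr₁
    constructor <;> simp
    · rw [hk.reg 0 (by omega) (by omega) (by omega), hready.reg_zero]
    · rw [hk.reg 1 (by omega) (by omega) (by omega), hs]
    · exact h2
    · rw [hk.reg 3 (by omega) (by omega) (by omega), hready.reg_three]
    · omega
    · rw [hg]; exact hready.flag_le
    · rw [hf]; exact hready.next_lt
    · exact ⟨w', by omega, hr₁⟩
    · exact h.congr hJ₂ (by intros; simp (disch := omega)) (by simp) rfl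
    · intro ht'
      exact hmin (hr₁.exists_valid (by omega))

/-- The one-site tour is treated as a change of the empty tour, whose flags are zero, at one site:
registers 4 and 5 both hold `s`. Thus update number 0 is an ordinary update. -/
theorem Maintains.start (h : Maintains d S W init update T T' J) (hS : n ≤ S) (hW : n + 1 ≤ W)
    (s : Fin n) :
    Runs d S W (.block [.const 2 1, .store 1 1 2, .store 2 1 1, .copy 4 1, .copy 5 1] ;; init ;;
      update ;; .block [.const 6 1]) (5 + (T + (T' 0 + 1))) (initState R s)
      (MainInv d s J 1) := by
  have hs := s.2
  refine Runs.seq (P := fun σ => Ready n 0 (fun _ => 0) (fun _ => 0) σ ∧ σ.reg 1 = s ∧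
    Represents d s (σ.mem 1) (σ.mem 2) [] ∧ (∀ r, 6 ≤ r → σ.reg r = 0) ∧
    ∀ a, 3 ≤ a → ∀ j, σ.mem a j = 0) (Runs.of_wp ?_) ?_
  · simp [wp_cons, wp_nil, wpi_const, wpi_copy, wpi_store, initState]
    refine ⟨by omega, by omega, by omega, ?_, ?_, ?_, ?_⟩
    · constructor <;> simp
      · intro p
        rw [Function.update_apply]
        split_ifs <;> omega
      · intro p
        rw [Function.update_apply]
        split_ifs <;> omega
      · intro p hp
        rw [Function.update_of_ne hp]
      · intro p hp
        rw [Function.update_of_ne hp]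
    · refine represents_singleton d s (fun p => ?_) (by simp)
      rw [Function.update_apply]
    · intro r hr
      rw [Function.update_of_ne (by omega), Function.update_of_ne (by omega),
        Function.update_of_ne (by omega), if_neg (by omega), if_neg (by omega)]
    · intro a ha j
      simp (disch := omega)
  · rintro σ ⟨hready, h1, hrep, hregs, hmem⟩
    refine (h.init σ hready.reg_zero hready.reg_two hregs hmem).seq ?_
    rintro σ₁ ⟨hJ, hk, h4, h5⟩
    have hg := hk.mem 1 (by omega)
    have hf := hk.mem 2 (by omega)
    have hready₁ : Ready n 0 (fun _ => 0) (fun _ => 0) σ₁ := by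
      constructor
      · rw [hk.reg 0 (by omega) (by omega) (by omega), hready.reg_zero]
      · rw [hk.reg 2 (by omega) (by omega) (by omega), hready.reg_two]
      · rw [hk.reg 3 (by omega) (by omega) (by omega), hready.reg_three]
      · rw [h4]; exact hready.reg_four
      · rw [h5]; exact hready.reg_five
      · rw [hk.reg 6 (by omega) (by omega) (by omega), hready.reg_six]
      · rw [hg]; exact hready.flag_le
      · rw [hf]; exact hready.next_lt
      · rw [h4, h5, hg]; exact hready.flag_eq
      · rw [h4, h5, hf]; exact hready.next_eq
    refine (h.update 0 _ _ σ₁ (by omega) hJ hready₁).seq ?_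
    rintro σ₂ ⟨hJ₂, hk₂, hmin⟩
    have hg₂ := hk₂.mem 1 (by omega)
    have hf₂ := hk₂.mem 2 (by omega)
    rw [← hg, ← hf, ← hg₂, ← hf₂] at hrep
    rw [← hg₂, ← hf₂] at hJ₂ hmin
    refine Runs.of_wp ?_
    simp only [wp_cons, wp_nil, wpi_const]
    refine ⟨by omega, ?_⟩
    constructor <;> try simp
    · rw [hk₂.reg 0 (by omega) (by omega) (by omega), hready₁.reg_zero]
    · rw [hk₂.reg 1 (by omega) (by omega) (by omega), hk.reg 1 (by omega) (by omega) (by omega),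
        h1]
    · rw [hk₂.reg 2 (by omega) (by omega) (by omega), hready₁.reg_two]
    · rw [hk₂.reg 3 (by omega) (by omega) (by omega), hready₁.reg_three]
    · omega
    · rw [hg₂]; exact hready₁.flag_le
    · rw [hf₂]; exact hready₁.next_lt
    · exact hrep
    · exact h.congr hJ₂ (by intros; simp (disch := omega)) (fun _ _ => rfl) rfl
    · intro ht
      exact hmin (hrep.exists_valid (by simpa using ht))

/-- The tour is copied to the output array. -/
theorem runs_output (hS : n ≤ S) (hW : n + 1 ≤ W) {s : Fin n} {σ : State R}
    (h0 : σ.reg 0 = n) (h1 : σ.reg 1 = s) (h2 : σ.reg 2 = 1) (hf : ∀ p, σ.mem 2 p < n) :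
    Runs d S W (.block [.copy 20 1, .const 21 0] ;;
      .loop (.lt 21 0) (.block [.store 0 21 20, .load 20 2 20, .add 21 21 2]))
      (2 + ((3 + 1) * (n - 0) + 1)) σ fun σ' => ∀ k < n, σ'.mem 0 k = (σ.mem 2)^[k] s := by
  have hs := s.2
  have hlt : ∀ k, (σ.mem 2)^[k] s < n := by
    intro k
    cases k with
    | zero => exact hs
    | succ k => rw [Function.iterate_succ_apply']; exact hf _
  let I : ℕ → State R → Prop := fun k σ' => σ'.reg 21 = k ∧ σ'.reg 0 = n ∧ σ'.reg 2 = 1 ∧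
    σ'.mem 2 = σ.mem 2 ∧ σ'.reg 20 = (σ.mem 2)^[k] s ∧
    ∀ j < k, σ'.mem 0 j = (σ.mem 2)^[j] s
  refine Runs.seq (P := I 0) (Runs.of_wp ?_) fun σ' h' => ?_
  · simp [wp_cons, wp_nil, wpi_const, wpi_copy, I, h0, h1, h2]
    omega
  · refine (Runs.loop_count I 3 (fun k σ h => ⟨h.1, h.2.1⟩) ?_ (Nat.zero_le n) h').mono le_rfl
      fun σ h => h.2.2.2.2.2
    rintro k σ' hk ⟨h21, h0, h2, hm, h20, hout⟩
    refine Runs.of_wp ?_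
    have := hlt k
    have h3 := hlt (k + 1)
    simp only [Function.iterate_succ_apply'] at h3
    simp [wp_cons, wp_nil, wpi_store, wpi_load, wpi_add, I, h0, h2, hm, h20, h21,
      Function.iterate_succ_apply']
    refine ⟨by omega, by omega, by omega, by omega, fun j hj => ?_⟩
    rw [Function.update_apply]
    split_ifs with h
    · rw [h]
    · exact hout j (by omega)

/-- The times of the updates are summed rather than bounded by the worst one. The stack of conga
lines needs this, since its rebuilds are expensive but rare. -/
theorem Maintains.runs_driver (h : Maintains d S W init update T T' J) (hS : n ≤ S)
    (hW : n + 1 ≤ W) (s : Fin n) :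
    Runs d S W (driver init update) (T + ∑ t ∈ Finset.range n, (T' t + 10) + 10)
      (initState R s) fun σ => ∃ l : List (Fin n), IsResult d s l ∧
        l.map Fin.val = (List.range n).map (σ.mem 0) := by
  have hs := s.2
  have hloop : ∀ σ, MainInv d s J 1 σ → Runs d S W (.loop (.lt 6 0)
      (.block [.load 20 2 4, .store 2 5 20, .store 2 4 5, .store 1 5 2] ;;
        update ;; .block [.add 6 6 2])) (∑ t ∈ Finset.Ico 1 n, (T' t + 6) + 1) σ
      (MainInv d s J n) := by
    intro σ hσ
    have := Runs.loop_potential (d := d) (S := S) (W := W) (b := .lt 6 0)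
      (p := .block [.load 20 2 4, .store 2 5 20, .store 2 4 5, .store 1 5 2] ;;
        update ;; .block [.add 6 6 2]) (fun σ => ∃ t, MainInv d s J t σ)
      -- Besides the update, a round has five instructions and one test.
      (fun σ => ∑ t ∈ Finset.Ico (σ.reg 6) n, (T' t + 6)) ?_ ⟨1, hσ⟩
    · rw [hσ.reg_six] at this
      refine this.mono le_rfl ?_
      rintro σ' ⟨⟨t, ht⟩, hb⟩
      rw [holds_lt, ht.reg_six, ht.reg_zero] at hb
      have := ht.le
      obtain rfl : t = n := by omega
      exact ht
    · rintro σ ⟨t, ht⟩ hb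
      rw [holds_lt, ht.reg_six, ht.reg_zero] at hb
      refine ⟨_, (h.step hS hW ht hb).mono le_rfl fun σ' h' => ⟨⟨t + 1, h'⟩, ?_⟩⟩
      rw [ht.reg_six, h'.reg_six, Finset.sum_eq_sum_Ico_succ_bot hb]
      omega
  -- Update 0 belongs to the start; the term `4 * n` is the copying of the tour to the output.
  have hsum : T' 0 + ∑ t ∈ Finset.Ico 1 n, (T' t + 6) + 4 * n + 6 ≤
      ∑ t ∈ Finset.range n, (T' t + 10) := by
    rw [Finset.range_eq_Ico, Finset.sum_eq_sum_Ico_succ_bot (a := 0) (by omega)]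
    have : ∑ t ∈ Finset.Ico 1 n, (T' t + 10) = ∑ t ∈ Finset.Ico 1 n, (T' t + 6) + 4 * (n - 1) := by
      have h4 : ∑ t ∈ Finset.Ico 1 n, (T' t + 10) = ∑ t ∈ Finset.Ico 1 n, ((T' t + 6) + 4) := rfl
      rw [h4, Finset.sum_add_distrib, Finset.sum_const, Nat.card_Ico, smul_eq_mul, mul_comm]
    simp only [zero_add]
    omega
  have key := (h.start hS hW s).seq fun σ hσ => (hloop σ hσ).seq fun σ hσ =>
    (runs_output (d := d) (S := S) (W := W) hS hW hσ.reg_zero hσ.reg_one hσ.reg_two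
      hσ.next_lt).mono le_rfl fun σ' h' =>
      (show ∃ l : List (Fin n), IsResult d s l ∧ l.map Fin.val = (List.range n).map (σ'.mem 0) by
        obtain ⟨w, hw, hr⟩ := hσ.tour
        refine ⟨s :: w, ⟨hr.steps, hr.mem_of_length hw⟩, ?_⟩
        rw [hr.linked.iterate, hw]
        refine List.map_congr_left fun k hk => ?_
        rw [h' k (List.mem_range.1 hk)])
  exact key.mono (by omega) fun _ h => h

theorem implements_driver {S W T T'' : ℕ → ℕ} {T' : ℕ → ℕ → ℕ} (hS : ∀ n, n ≤ S n)
    (hW : ∀ n, 1 ≤ n → n + 1 ≤ W n)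
    (hT : ∀ n, 1 ≤ n → T n + ∑ t ∈ Finset.range n, (T' n t + 10) + 10 ≤ T'' n)
    (h : ∀ (R : Type u) [AddCommGroup R] [LinearOrder R] (n : ℕ) (d : Fin n → Fin n → R), 1 ≤ n →
      ∃ J, Maintains d (S n) (W n) init update (T n) (T' n) J) :
    Implements.{u} (driver init update) T'' S W := by
  intro R _ _ _ n d s
  have hn : 1 ≤ n := by have := s.2; omega
  obtain ⟨J, hJ⟩ := h R n d hn
  obtain ⟨t, σ, ht, he, hl⟩ := hJ.runs_driver (hS n) (hW n hn) s
  exact ⟨t, σ, ht.trans (hT n hn), he, hl⟩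

end Driver

/-! ## The pyramid

The nodes of a complete binary tree with `N` leaves are numbered in heap order, and site `p`
belongs to the leaf `N + p`. For each pair of nodes `u`, `v` of the same level, a cell holds the
cheapest insertion of a site below `v` after a site below `u`. -/

/-- Replace the candidate in the registers by that of the cell at address `reg 53` if the latter is
better. -/
def pyrTake : Prog :=
  .block [.load 57 5 53] ;;
  .ite (.eq 57 2)
    (.block [.dload 3 0 53] ;;
      .ite (.eq 54 2)
        (.ite (.dlt 3 2) (.block [.copy 54 57, .load 55 3 53, .load 56 4 53, .dcopy 2 3]) .skip)
        (.block [.copy 54 57, .load 55 3 53, .load 56 4 53, .dcopy 2 3]))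
    .skip

/-- Find the best candidate of the four cells below. -/
def pyrInner : Prog :=
  (.block [.add 53 52 52] ;; pyrTake) ;; (.block [.add 53 53 2] ;; pyrTake) ;;
  (.block [.add 53 53 11] ;; pyrTake) ;; (.block [.sub 53 53 2] ;; pyrTake)

/-- Find the candidate of a pair of leaves. -/
def pyrLeaf : Prog :=
  .block [.sub 55 50 10, .sub 56 51 10] ;;
  .ite (.lt 55 0)
    (.ite (.lt 56 0)
      (.block [.load 57 1 55, .load 58 1 56] ;;
        .ite (.eq 57 2)
          (.ite (.eq 58 3)
            (.block [.load 59 2 55, .dist 2 55 56, .dist 3 56 59, .dadd 2 2 3, .dist 3 55 59,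
              .dsub 2 2 3, .const 54 1])
            .skip)
          .skip)
      .skip)
    .skip

/-- Recompute the cell of the nodes `reg 50` and `reg 51`. -/
def pyrCell : Prog :=
  .block [.mul 52 50 11, .add 52 52 51, .const 54 0] ;;
  .ite (.lt 50 10) pyrInner pyrLeaf ;;
  .block [.store 5 52 54, .store 3 52 55, .store 4 52 56, .dstore 0 52 2]

/-- Recompute the row and the column of the node `reg 29` on the level with `reg 26` nodes. -/
def pyrCross : Prog :=
  .block [.copy 27 26, .add 28 26 26] ;;
  .loop (.lt 27 28) (.block [.copy 50 29, .copy 51 27] ;; pyrCell ;;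
    .block [.copy 50 27, .copy 51 29] ;; pyrCell ;; .block [.add 27 27 2])

/-- Registers 24 and 25 climb from the leaves of the changed sites to the root. Register 26, the
size of their level, is halved until it is zero. The cell of the root pair `(1, 1)` has the address
`reg 11 + 1`. -/
def pyrUpdate : Prog :=
  .block [.add 24 10 4, .add 25 10 5, .copy 26 10, .const 30 2] ;;
  .loop (.lt 3 26) ((.block [.copy 29 24] ;; pyrCross) ;; (.block [.copy 29 25] ;; pyrCross) ;;
    .block [.div 24 24 30, .div 25 25 30, .div 26 26 30]) ;;
  .block [.add 20 11 2, .load 21 5 20] ;;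
  .ite (.eq 21 2) (.block [.load 4 3 20, .load 5 4 20]) .skip

/-- Register 10 becomes the number of leaves, a power of two that is at least the number of sites;
its double in register 11 is the row length of the address scheme. -/
def pyrInit : Prog :=
  .block [.const 10 1] ;; .loop (.lt 10 0) (.block [.add 10 10 10]) ;; .block [.add 11 10 10]

section Pyramid

variable {R : Type u} [AddCommGroup R] [LinearOrder R] {n : ℕ}

/-- The node `u` is an ancestor of the leaf of the site `p` in the tree with `2 ^ e` leaves. -/
def Under (e p u : ℕ) : Prop := (2 ^ e + p) / 2 ^ (e - Nat.log 2 u) = u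

theorem under_leaf {e p u : ℕ} (hu : 2 ^ e ≤ u) (hu' : u < 2 ^ (e + 1)) :
    Under e p u ↔ 2 ^ e + p = u := by
  rw [Under, Nat.log_eq_of_pow_le_of_lt_pow hu hu']
  simp

/-- The ancestor on the level of `u` is half, rounded down, of the ancestor on the next level. -/
theorem under_iff {e p u : ℕ} (hu : u < 2 ^ e) (hu0 : u ≠ 0) :
    Under e p u ↔ Under e p (2 * u) ∨ Under e p (2 * u + 1) := by
  have h1 : Nat.log 2 u < e := Nat.log_lt_of_lt_pow hu0 hu
  have h2 : Nat.log 2 (2 * u) = Nat.log 2 u + 1 := by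
    rw [mul_comm]; exact Nat.log_mul_base (by omega) hu0
  have h3 : Nat.log 2 (2 * u + 1) = Nat.log 2 u + 1 := by
    rw [Nat.log_of_one_lt_of_le (by omega) (by omega)]
    congr 2
    omega
  rw [Under, Under, Under, h2, h3]
  obtain ⟨k, hk⟩ : ∃ k, e = Nat.log 2 u + 1 + k := ⟨e - (Nat.log 2 u + 1), by omega⟩
  rw [show e - Nat.log 2 u = k + 1 by omega, show e - (Nat.log 2 u + 1) = k by omega, pow_succ,
    ← Nat.div_div_eq_div_mul]
  omega

/-- The cell of the nodes `u` and `v` is up to date for the tour given by `g` and `f`. -/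
def Cell (d : Fin n → Fin n → R) (e : ℕ) (g f : ℕ → ℕ) (u v : ℕ) (σ : State R) : Prop :=
  IsBest (fun c : ℕ × ℕ => Valid n g c.1 c.2 ∧ Under e c.1 u ∧ Under e c.2 v)
    (fun c => insCost d f c.1 c.2) (σ.mem 5 (u * 2 ^ (e + 1) + v))
    (σ.mem 3 (u * 2 ^ (e + 1) + v), σ.mem 4 (u * 2 ^ (e + 1) + v))
    (σ.dmem 0 (u * 2 ^ (e + 1) + v))

/-- The environment in which cells are recomputed. -/
structure PyrEnv (n e : ℕ) (g f : ℕ → ℕ) (σ : State R) : Prop where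
  reg_zero : σ.reg 0 = n
  reg_two : σ.reg 2 = 1
  reg_three : σ.reg 3 = 0
  reg_ten : σ.reg 10 = 2 ^ e
  reg_eleven : σ.reg 11 = 2 ^ (e + 1)
  mem_one : σ.mem 1 = g
  mem_two : σ.mem 2 = f

variable {d : Fin n → Fin n → R} {S W e : ℕ} {g f : ℕ → ℕ}

theorem runs_pyrTake {P P' : ℕ × ℕ → Prop} {v : ℕ × ℕ → R} {σ : State R} (h2 : σ.reg 2 = 1)
    (hn : n ≤ W) (h1 : 1 ≤ W) (hA : σ.reg 53 < S)
    (h : IsBest P v (σ.reg 54) (σ.reg 55, σ.reg 56) (σ.dreg 2))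
    (h' : IsBest P' v (σ.mem 5 (σ.reg 53)) (σ.mem 3 (σ.reg 53), σ.mem 4 (σ.reg 53))
      (σ.dmem 0 (σ.reg 53))) (hP' : ∀ c, P' c → c.1 < n ∧ c.2 < n) :
    Runs d S W pyrTake 9 σ fun σ' => (∀ r < 54, σ'.reg r = σ.reg r) ∧ σ'.mem = σ.mem ∧
      σ'.dmem = σ.dmem ∧
      IsBest (fun c => P c ∨ P' c) v (σ'.reg 54) (σ'.reg 55, σ'.reg 56) (σ'.dreg 2) := by
  refine Runs.of_wp_le ?_ (by decide)
  have hf : σ.mem 5 (σ.reg 53) ≤ 1 := by rcases h' with ⟨h, -⟩ | ⟨h, -⟩ <;> omega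
  -- Sites are copied to registers only from flagged cells, where they are below `n`; this rules out
  -- an overflow.
  have hb : σ.mem 5 (σ.reg 53) = 1 → σ.mem 3 (σ.reg 53) < n ∧ σ.mem 4 (σ.reg 53) < n := by
    intro hf
    rcases h' with ⟨-, h, -⟩ | ⟨h, -⟩
    · exact hP' _ h
    · omega
  simp [pyrTake, wp_cons, wp_nil, wp_seq, wp_ite, wp_skip, wpi_load, wpi_dload, wpi_copy,
    wpi_dcopy, holds_eq, holds_lt, holds_dlt, h2, hA]
  refine ⟨by omega, fun hc => ⟨fun hc' => ⟨fun hlt => ?_, fun hlt => ?_⟩, fun hc' => ?_⟩,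
    fun hc => ?_⟩
  · have := hb hc
    refine ⟨by omega, by omega, by omega, by intros; simp (disch := omega), ?_⟩
    exact h.right h' hc (.inr hlt)
  · refine ⟨by intros; simp (disch := omega), ?_⟩
    exact h.left h' (.inr ⟨hc', hlt.not_gt⟩)
  · have := hb hc
    refine ⟨by omega, by omega, by omega, by intros; simp (disch := omega), ?_⟩
    exact h.right h' hc (.inl hc')
  · refine ⟨by intros; simp (disch := omega), ?_⟩
    exact h.left h' (.inl hc)

theorem pyr_address_lt {u v : ℕ} (hu : u < 2 ^ (e + 1)) (hv : v < 2 ^ (e + 1)) :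
    u * 2 ^ (e + 1) + v < 2 ^ (e + 1) * 2 ^ (e + 1) := by
  have := Nat.mul_le_mul_right (2 ^ (e + 1)) (Nat.succ_le_of_lt hu)
  rw [Nat.succ_mul] at this
  omega

/-- The state `σ'` arises from `σ` by a search among the cells below; the candidates considered so
far are given by `P`, and the last address by `A`. -/
structure PyrPartial (σ : State R) (P : ℕ × ℕ → Prop) (v : ℕ × ℕ → R) (A : ℕ) (σ' : State R) :
    Prop where
  reg : ∀ r < 53, σ'.reg r = σ.reg r
  mem : σ'.mem = σ.mem
  dmem : σ'.dmem = σ.dmem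
  reg_53 : σ'.reg 53 = A
  best : IsBest P v (σ'.reg 54) (σ'.reg 55, σ'.reg 56) (σ'.dreg 2)

/-- One link in the chain of comparisons. Hypothesis `hi` abstracts from the instruction that moves
the address, which may be an addition or a subtraction. -/
theorem PyrPartial.runs {σ σ' : State R} {P P' : ℕ × ℕ → Prop} {v : ℕ × ℕ → R} {A A' : ℕ}
    {i : Instr} (h : PyrPartial σ P v A σ') (h2 : σ.reg 2 = 1) (hn : n ≤ W) (h1 : 1 ≤ W)
    (hA : A' < S) (h' : IsBest P' v (σ.mem 5 A') (σ.mem 3 A', σ.mem 4 A') (σ.dmem 0 A'))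
    (hP' : ∀ c, P' c → c.1 < n ∧ c.2 < n)
    (hi : ∀ Q : State R → Prop,
      Q ⟨Function.update σ'.reg 53 A', σ'.dreg, σ'.mem, σ'.dmem⟩ → wpi d S W i Q σ') :
    Runs d S W (.block [i] ;; pyrTake) 10 σ' (PyrPartial σ (fun c => P c ∨ P' c) v A') := by
  obtain ⟨hr, hm, hd, -, hb⟩ := h
  refine Runs.mono (T := 1 + 9) (Runs.seq (P := PyrPartial σ P v A')
    (Runs.of_wp (hi _ ⟨?_, hm, hd, by simp, by simpa using hb⟩)) ?_) le_rfl fun _ h => h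
  · intro r hr'
    simp (disch := omega) [hr r hr']
  · rintro σ₁ ⟨hr, hm, hd, ha, hb⟩
    refine (runs_pyrTake (P' := P') (by rw [hr 2 (by omega), h2]) hn h1 (by rwa [ha]) hb
      (by rw [ha, hm, hd]; exact h') hP').mono le_rfl ?_
    rintro σ₂ ⟨h1, h2, h3, h4⟩
    exact ⟨fun r hr' => by rw [h1 r (by omega), hr r hr'], by rw [h2, hm], by rw [h3, hd],
      by rw [h1 53 (by omega), ha], h4⟩

/-- Addresses are linear in the pair, so doubling the address of `(u, v)` gives that of `(2u, 2v)`.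
Adding 1, adding the row length and subtracting 1 then visits the other three children. By
`under_iff` they account for all candidates. -/
theorem runs_pyrInner {u v : ℕ} {σ : State R} (henv : PyrEnv n e g f σ)
    (hS : 2 ^ (e + 1) * 2 ^ (e + 1) ≤ S) (hW : 2 ^ (e + 1) * 2 ^ (e + 1) ≤ W) (hn : n ≤ W)
    (hu : u < 2 ^ e) (hv : v < 2 ^ e) (hu0 : u ≠ 0) (hv0 : v ≠ 0)
    (h52 : σ.reg 52 = u * 2 ^ (e + 1) + v) (h54 : σ.reg 54 = 0)
    (h : ∀ u', u' / 2 = u → ∀ v', v' / 2 = v → Cell d e g f u' v' σ) :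
    Runs d S W pyrInner 40 σ fun σ' => (∀ r < 53, σ'.reg r = σ.reg r) ∧ σ'.mem = σ.mem ∧
      σ'.dmem = σ.dmem ∧
      IsBest (fun c : ℕ × ℕ => Valid n g c.1 c.2 ∧ Under e c.1 u ∧ Under e c.2 v)
        (fun c => insCost d f c.1 c.2) (σ'.reg 54) (σ'.reg 55, σ'.reg 56) (σ'.dreg 2) := by
  have hpow : 2 ^ (e + 1) = 2 * 2 ^ e := by rw [pow_succ, mul_comm]
  have hmax := pyr_address_lt (e := e) (u := 2 * u + 1) (v := 2 * v + 1) (by omega) (by omega)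
  have hexp : (2 * u + 1) * 2 ^ (e + 1) = 2 * (u * 2 ^ (e + 1)) + 2 ^ (e + 1) := by ring
  have hexp' : (2 * u) * 2 ^ (e + 1) = 2 * (u * 2 ^ (e + 1)) := by ring
  have c00 := h (2 * u) (by omega) (2 * v) (by omega)
  have c01 := h (2 * u) (by omega) (2 * v + 1) (by omega)
  have c10 := h (2 * u + 1) (by omega) (2 * v) (by omega)
  have c11 := h (2 * u + 1) (by omega) (2 * v + 1) (by omega)
  have hval : ∀ {u v : ℕ} (c : ℕ × ℕ), (Valid n g c.1 c.2 ∧ Under e c.1 u ∧ Under e c.2 v) →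
      c.1 < n ∧ c.2 < n := fun c hc => hc.1.1
  unfold Cell at c00 c01 c10 c11
  have h2 := henv.reg_two
  have h11 := henv.reg_eleven
  rw [hexp] at c10 c11 hmax
  rw [hexp'] at c00 c01
  generalize u * 2 ^ (e + 1) = U at *
  generalize hM : 2 ^ (e + 1) * 2 ^ (e + 1) = M at *
  generalize 2 ^ (e + 1) = N at *
  let V : ℕ → ℕ → ℕ × ℕ → Prop := fun u v c => Valid n g c.1 c.2 ∧ Under e c.1 u ∧ Under e c.2 v
  have start : PyrPartial σ (fun _ => False) (fun c => insCost d f c.1 c.2) (σ.reg 53) σ :=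
    ⟨fun _ _ => rfl, rfl, rfl, rfl, .inr ⟨h54, by simp⟩⟩
  refine Runs.mono (T := 10 + (10 + (10 + 10)))
    (Q := PyrPartial σ (fun c => (((False ∨ V (2 * u) (2 * v) c) ∨ V (2 * u) (2 * v + 1) c) ∨
      V (2 * u + 1) (2 * v + 1) c) ∨ V (2 * u + 1) (2 * v) c)
      (fun c => insCost d f c.1 c.2) (2 * U + N + 2 * v)) ?_ (by omega) ?_
  · refine Runs.seq (start.runs h2 hn (by omega) (by omega) c00 hval ?_) fun σ₁ k₁ => ?_
    · intro Q hQ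
      rw [wpi_add, h52]
      exact ⟨by omega, by convert hQ using 3; omega⟩
    refine Runs.seq (k₁.runs h2 hn (by omega) (by omega) c01 hval ?_) fun σ₂ k₂ => ?_
    · intro Q hQ
      rw [wpi_add, k₁.reg_53, k₁.reg 2 (by omega), h2]
      exact ⟨by omega, by convert hQ using 3; omega⟩
    refine Runs.seq (k₂.runs h2 hn (by omega) (by omega) c11 hval ?_) fun σ₃ k₃ => ?_
    · intro Q hQ
      rw [wpi_add, k₂.reg_53, k₂.reg 11 (by omega), h11]
      exact ⟨by omega, by convert hQ using 3; omega⟩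
    refine k₃.runs h2 hn (by omega) (by omega) c10 hval ?_
    · intro Q hQ
      rw [wpi_sub, k₃.reg_53, k₃.reg 2 (by omega), h2]
      exact ⟨by omega, by convert hQ using 3; omega⟩
  · rintro σ' ⟨hr, hm, hd, -, hb⟩
    refine ⟨hr, hm, hd, hb.congr (fun c => ?_) fun _ _ => rfl⟩
    rw [under_iff hu hu0, under_iff hv hv0]
    tauto

/-- Two leaves have at most one candidate. Leaves that belong to no site have none, so rounding up
to a power of two is harmless. -/
theorem runs_pyrLeaf {u v : ℕ} {σ : State R} (henv : PyrEnv n e g f σ) (hn : 1 ≤ n)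
    (hne : n ≤ 2 ^ e) (hS : 2 ^ (e + 1) ≤ S) (hW : 2 ^ (e + 1) ≤ W)
    (hg : ∀ p, g p ≤ 1) (hf : ∀ p, f p < n) (hu : 2 ^ e ≤ u) (hv : 2 ^ e ≤ v)
    (hu' : u < 2 ^ (e + 1)) (hv' : v < 2 ^ (e + 1)) (h50 : σ.reg 50 = u) (h51 : σ.reg 51 = v)
    (h54 : σ.reg 54 = 0) :
    Runs d S W pyrLeaf 40 σ fun σ' => (∀ r < 53, σ'.reg r = σ.reg r) ∧ σ'.mem = σ.mem ∧
      σ'.dmem = σ.dmem ∧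
      IsBest (fun c : ℕ × ℕ => Valid n g c.1 c.2 ∧ Under e c.1 u ∧ Under e c.2 v)
        (fun c => insCost d f c.1 c.2) (σ'.reg 54) (σ'.reg 55, σ'.reg 56) (σ'.dreg 2) := by
  refine Runs.of_wp_le ?_ (by decide)
  simp only [under_leaf hu hu', under_leaf hv hv']
  obtain ⟨p, rfl⟩ : ∃ p, u = 2 ^ e + p := ⟨u - 2 ^ e, by omega⟩
  obtain ⟨q, rfl⟩ : ∃ q, v = 2 ^ e + q := ⟨v - 2 ^ e, by omega⟩
  have hgp := hg p
  have hgq := hg q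
  have hfp := hf p
  rw [pow_succ] at *
  simp [pyrLeaf, wp_cons, wp_nil, wp_seq, wp_ite, wp_skip, wpi_load, wpi_sub, wpi_const, wpi_dist,
    wpi_dadd, wpi_dsub, holds_eq, holds_lt, h50, h51, h54, henv.reg_ten, henv.reg_zero,
    henv.reg_two, henv.reg_three, henv.mem_one, henv.mem_two]
  have hframe : ∀ r < 53, r ≠ 54 ∧ r ≠ 55 ∧ r ≠ 56 ∧ r ≠ 57 ∧ r ≠ 58 ∧ r ≠ 59 := by omega
  refine ⟨by omega, by omega, fun hp => ⟨fun hq => ⟨by omega, by omega, by omega, by omega,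
    fun h1 => ⟨fun h0 => ⟨by omega, by omega, ⟨hp, hq⟩, ⟨hq, hfp⟩, ⟨hp, hfp⟩, by omega, ?_, ?_⟩,
    fun h0 => ⟨?_, ?_⟩⟩, fun h1 => ⟨?_, ?_⟩⟩, fun hq => ⟨?_, ?_⟩⟩, fun hp => ⟨?_, ?_⟩⟩
  · intro r hr; simp (disch := omega)
  · refine isBest_single (fun c => ?_) rfl
    constructor
    · rintro ⟨-, h1, h2⟩; ext <;> simp_all
    · rintro rfl; exact ⟨⟨⟨hp, hq⟩, h1, h0⟩, rfl, rfl⟩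
  · intro r hr; simp (disch := omega)
  · refine isBest_none fun c hc => h0 ?_
    rw [← hc.2.2]; exact hc.1.2.2
  · intro r hr; simp (disch := omega)
  · refine isBest_none fun c hc => h1 ?_
    rw [← hc.2.1]; exact hc.1.2.1
  · intro r hr; simp (disch := omega)
  · refine isBest_none fun c hc => absurd hc.1.1.2 ?_
    rw [hc.2.2]; omega
  · intro r hr; simp (disch := omega)
  · refine isBest_none fun c hc => absurd hc.1.1.1 ?_
    rw [hc.2.1]; omega

end Pyramid

/-! ### Recomputing a cell and a cross of the pyramid -/

section Pyramid

variable {R : Type u} [AddCommGroup R] [LinearOrder R] {n : ℕ}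
variable {d : Fin n → Fin n → R} {S W e : ℕ} {g f : ℕ → ℕ}

/-- The nodes `u` and `v` of the tree with `2 ^ e` leaves lie on the same level. -/
structure PyrPos (e u v : ℕ) : Prop where
  left_ne : u ≠ 0
  right_ne : v ≠ 0
  left_lt : u < 2 ^ (e + 1)
  right_lt : v < 2 ^ (e + 1)
  log_eq : Nat.log 2 u = Nat.log 2 v

/-- Bounds that rule out faults. -/
structure PyrBounds (n S W e : ℕ) (g f : ℕ → ℕ) : Prop where
  pos : 1 ≤ n
  le_pow : n ≤ 2 ^ e
  space : 2 ^ (e + 1) * 2 ^ (e + 1) ≤ S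
  word : 2 ^ (e + 1) * 2 ^ (e + 1) ≤ W
  flag_le : ∀ p, g p ≤ 1
  next_lt : ∀ p, f p < n

theorem PyrEnv.of_reg {σ σ' : State R} (h : PyrEnv n e g f σ) (hr : ∀ r < 12, σ'.reg r = σ.reg r)
    (hm : ∀ a < 3, σ'.mem a = σ.mem a) : PyrEnv n e g f σ' :=
  ⟨by rw [hr 0 (by omega), h.reg_zero], by rw [hr 2 (by omega), h.reg_two],
    by rw [hr 3 (by omega), h.reg_three], by rw [hr 10 (by omega), h.reg_ten],
    by rw [hr 11 (by omega), h.reg_eleven], by rw [hm 1 (by omega), h.mem_one],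
    by rw [hm 2 (by omega), h.mem_two]⟩

theorem Cell.congr {u v : ℕ} {σ σ' : State R} (h : Cell d e g f u v σ)
    (h5 : σ'.mem 5 = σ.mem 5) (h3 : σ'.mem 3 = σ.mem 3) (h4 : σ'.mem 4 = σ.mem 4)
    (h0 : σ'.dmem 0 = σ.dmem 0) : Cell d e g f u v σ' := by
  rw [Cell, h5, h3, h4, h0]; exact h

/-- The children must be correct only for inner nodes; the cell of two leaves depends on the tour
alone. -/
theorem runs_pyrCell (hb : PyrBounds n S W e g f) {u v : ℕ} {σ : State R}
    (henv : PyrEnv n e g f σ) (hp : PyrPos e u v) (h50 : σ.reg 50 = u) (h51 : σ.reg 51 = v)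
    (h : u < 2 ^ e → ∀ u', u' / 2 = u → ∀ v', v' / 2 = v → Cell d e g f u' v' σ) :
    Runs d S W pyrCell 48 σ fun σ' => (∀ r < 50, σ'.reg r = σ.reg r) ∧
      (∀ a < 3, σ'.mem a = σ.mem a) ∧
      ∀ u' v', PyrPos e u' v' → (u' = u ∧ v' = v) ∨ Cell d e g f u' v' σ →
        Cell d e g f u' v' σ' := by
  obtain ⟨hu0, hv0, hu, hv, hlog⟩ := hp
  have hA := pyr_address_lt hu hv
  have hle : 2 ^ (e + 1) ≤ 2 ^ (e + 1) * 2 ^ (e + 1) := Nat.le_mul_of_pos_left _ (by positivity)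
  have hpow : 2 ^ (e + 1) = 2 * 2 ^ e := by rw [pow_succ, mul_comm]
  have hS := hb.space
  have hW := hb.word
  have hne := hb.le_pow
  -- On a common level both nodes are inner or both are leaves, so testing `u` suffices.
  have huv : u < 2 ^ e ↔ v < 2 ^ e := by
    rw [← Nat.log_lt_iff_lt_pow (by omega) hu0, hlog, Nat.log_lt_iff_lt_pow (by omega) hv0]
  refine Runs.mono (T := 3 + (41 + 4)) (Runs.seq (P := fun σ' => PyrEnv n e g f σ' ∧
    (∀ r < 50, σ'.reg r = σ.reg r) ∧ σ'.mem = σ.mem ∧ σ'.dmem = σ.dmem ∧ σ'.reg 50 = u ∧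
    σ'.reg 51 = v ∧ σ'.reg 52 = u * 2 ^ (e + 1) + v ∧ σ'.reg 54 = 0) (Runs.of_wp ?_) ?_)
    (by omega) fun _ h => h
  · have hframe : ∀ r < 50, Function.update (Function.update σ.reg 52 (u * 2 ^ (e + 1) + v)) 54 0 r
        = σ.reg r := by
      intro r hr
      simp (disch := omega)
    simp [wp_cons, wp_nil, wpi_mul, wpi_add, wpi_const, h50, h51, henv.reg_eleven]
    exact ⟨by omega, by omega, henv.of_reg (fun r hr => hframe r (by omega)) fun _ _ => rfl, hframe⟩
  · rintro σ₁ ⟨henv₁, hr₁, hm₁, hd₁, h50₁, h51₁, h52₁, h54₁⟩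
    refine Runs.seq (P := fun σ' => (∀ r < 53, σ'.reg r = σ₁.reg r) ∧ σ'.mem = σ₁.mem ∧
      σ'.dmem = σ₁.dmem ∧
      IsBest (fun c : ℕ × ℕ => Valid n g c.1 c.2 ∧ Under e c.1 u ∧ Under e c.2 v)
        (fun c => insCost d f c.1 c.2) (σ'.reg 54) (σ'.reg 55, σ'.reg 56) (σ'.dreg 2))
      (Runs.ite (fun hc => ?_) fun hc => ?_) ?_
    · rw [holds_lt, h50₁, henv₁.reg_ten] at hc
      refine runs_pyrInner henv₁ hS hW (by omega) hc (huv.1 hc) hu0 hv0 h52₁ h54₁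
        fun u' hu' v' hv' => (h hc u' hu' v' hv').congr ?_ ?_ ?_ ?_ <;> simp [hm₁, hd₁]
    · rw [holds_lt, h50₁, henv₁.reg_ten] at hc
      exact runs_pyrLeaf henv₁ hb.pos hne (by omega) (by omega) hb.flag_le hb.next_lt (by omega)
        (by omega) hu hv h50₁ h51₁ h54₁
    · rintro σ₂ ⟨hr₂, hm₂, hd₂, hbest⟩
      refine Runs.of_wp ?_
      have h52₂ := hr₂ 52 (by omega)
      rw [h52₁] at h52₂
      simp [wp_cons, wp_nil, wpi_store, wpi_dstore, h52₂, hm₂, hd₂, hm₁, hd₁]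
      refine ⟨by omega, fun r hr => by rw [hr₂ r (by omega), hr₁ r hr],
        fun a ha => by simp (disch := omega), ?_⟩
      rintro u' v' ⟨hu0', hv0', hu', hv', hlog'⟩ h'
      unfold Cell
      by_cases heq : u' = u ∧ v' = v
      · obtain ⟨rfl, rfl⟩ := heq
        simpa using hbest
      -- Quotient and remainder by the row length recover the pair from the address, so no other
      -- cell is overwritten.
      · have hne : u' * 2 ^ (e + 1) + v' ≠ u * 2 ^ (e + 1) + v := by
          intro hc
          apply heq
          have h1 := congrArg (· / 2 ^ (e + 1)) hc
          have h2 := congrArg (· % 2 ^ (e + 1)) hc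
          have hpos : 0 < 2 ^ (e + 1) := by positivity
          simp only [Nat.mul_add_mod_self_right, Nat.mod_eq_of_lt hv, Nat.mod_eq_of_lt hv',
            mul_comm _ (2 ^ (e + 1)), Nat.mul_add_div hpos, Nat.div_eq_of_lt hv,
            Nat.div_eq_of_lt hv', Nat.mul_add_mod_self_left] at h1 h2
          omega
        have := h'.resolve_left heq
        unfold Cell at this
        simpa [hne] using this

theorem pow_le_of_log {j u : ℕ} (hu : u ≠ 0) (h : Nat.log 2 u = j) :
    2 ^ j ≤ u ∧ u < 2 ^ (j + 1) := by
  subst h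
  exact ⟨Nat.pow_log_le_self 2 hu, Nat.lt_pow_succ_log_self (by omega) u⟩

/-- A round repairs one cell of the row and one of the column within 102 steps, including the test.
This relies on level `j + 1` being correct already. -/
theorem runs_pyrCross (hb : PyrBounds n S W e g f) {w j : ℕ} {σ : State R}
    (henv : PyrEnv n e g f σ) (hj : j ≤ e) (hw : 2 ^ j ≤ w) (hw' : w < 2 ^ (j + 1))
    (h26 : σ.reg 26 = 2 ^ j) (h29 : σ.reg 29 = w)
    (h : ∀ u v, PyrPos e u v → Nat.log 2 u = j + 1 → Cell d e g f u v σ) :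
    Runs d S W pyrCross (2 + (102 * 2 ^ j + 1)) σ fun σ' => (∀ r < 27, σ'.reg r = σ.reg r) ∧
      σ'.reg 30 = σ.reg 30 ∧ (∀ a < 3, σ'.mem a = σ.mem a) ∧
      ∀ u v, PyrPos e u v → (Nat.log 2 u = j ∧ (u = w ∨ v = w)) ∨ Cell d e g f u v σ →
        Cell d e g f u v σ' := by
  have hpow : 2 ^ (j + 1) = 2 * 2 ^ j := by rw [pow_succ, mul_comm]
  have hle : 2 ^ (j + 1) ≤ 2 ^ (e + 1) := Nat.pow_le_pow_right (by omega) (by omega)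
  have hle' : 2 ^ (e + 1) ≤ 2 ^ (e + 1) * 2 ^ (e + 1) := Nat.le_mul_of_pos_left _ (by positivity)
  have hpos : 0 < 2 ^ j := by positivity
  have hW := hb.word
  have hw0 : w ≠ 0 := by omega
  have hlogw : Nat.log 2 w = j := Nat.log_eq_of_pow_le_of_lt_pow hw hw'
  let I : ℕ → State R → Prop := fun k σ' => (σ'.reg 27 = k ∧ σ'.reg 28 = 2 ^ (j + 1)) ∧
    2 ^ j ≤ k ∧ (∀ r < 27, σ'.reg r = σ.reg r) ∧ σ'.reg 29 = w ∧ σ'.reg 30 = σ.reg 30 ∧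
    (∀ a < 3, σ'.mem a = σ.mem a) ∧
    ∀ u v, PyrPos e u v → (Nat.log 2 u = j ∧ (u = w ∧ v < k ∨ v = w ∧ u < k)) ∨
      Cell d e g f u v σ → Cell d e g f u v σ'
  refine Runs.seq (P := I (2 ^ j)) (Runs.of_wp ?_) fun σ' h' => ?_
  · simp [wp_cons, wp_nil, wpi_copy, wpi_add, I, h26, h29]
    refine ⟨by omega, by omega, by omega, by intros; simp (disch := omega), ?_⟩
    rintro u v hp (⟨h1, h2⟩ | h1)
    · have := (pow_le_of_log hp.left_ne h1).1
      have := (pow_le_of_log hp.right_ne (hp.log_eq ▸ h1)).1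
      omega
    · exact h1
  · have := Runs.loop_count (d := d) (S := S) (W := W) (x := 27) (y := 28) (m := 2 ^ (j + 1))
      (p := .block [.copy 50 29, .copy 51 27] ;; pyrCell ;;
        .block [.copy 50 27, .copy 51 29] ;; pyrCell ;; .block [.add 27 27 2]) I 101
      (fun k σ h => h.1) ?_ (by omega) h'
    · refine this.mono (by rw [hpow]; omega) ?_
      rintro σ'' ⟨-, -, h1, h2, h3, h4, h5⟩
      refine ⟨h1, h3, h4, fun u v hp hc => h5 u v hp (hc.imp_left fun ⟨ha, hc⟩ => ⟨ha, ?_⟩)⟩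
      have := (pow_le_of_log hp.left_ne ha).2
      have := (pow_le_of_log hp.right_ne (hp.log_eq ▸ ha)).2
      omega
    · rintro k σ₁ hk ⟨⟨h27, h28⟩, hjk, hr, h29, h30, hm, hc⟩
      have hlogk : Nat.log 2 k = j := Nat.log_eq_of_pow_le_of_lt_pow hjk hk
      have henv₁ : PyrEnv n e g f σ₁ := henv.of_reg (fun r hr' => hr r (by omega)) hm
      have hp : PyrPos e w k := ⟨hw0, by omega, by omega, by omega, by omega⟩
      have hp' : PyrPos e k w := ⟨by omega, hw0, by omega, by omega, by omega⟩
      have child : ∀ u v, PyrPos e u v → Nat.log 2 u = j → u < 2 ^ e → ∀ u', u' / 2 = u →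
          ∀ v', v' / 2 = v → PyrPos e u' v' ∧ Nat.log 2 u' = j + 1 := by
        intro u v hp hl hu u' hu' v' hv'
        have h1 := pow_le_of_log hp.left_ne hl
        have h2 := pow_le_of_log hp.right_ne (hp.log_eq ▸ hl)
        have h5 : j < e := (Nat.pow_lt_pow_iff_right (a := 2) (by omega)).1 (by omega)
        have h6 : 2 ^ (j + 1 + 1) ≤ 2 ^ (e + 1) := Nat.pow_le_pow_right (by omega) (by omega)
        have h7 : 2 ^ (j + 1 + 1) = 2 * 2 ^ (j + 1) := by rw [pow_succ, mul_comm]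
        have h3 : Nat.log 2 u' = j + 1 := Nat.log_eq_of_pow_le_of_lt_pow (by omega) (by omega)
        have h4 : Nat.log 2 v' = j + 1 := Nat.log_eq_of_pow_le_of_lt_pow (by omega) (by omega)
        exact ⟨⟨by omega, by omega, by omega, by omega, by omega⟩, h3⟩
      refine Runs.mono (T := 2 + (48 + (2 + (48 + 1)))) (Runs.seq (P := fun σ' =>
        (σ'.reg 50 = w ∧ σ'.reg 51 = k) ∧ (∀ r < 50, σ'.reg r = σ₁.reg r) ∧ σ'.mem = σ₁.mem ∧
        σ'.dmem = σ₁.dmem) (Runs.of_wp ?_) ?_) (by omega) fun _ h => h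
      · simp [wp_cons, wp_nil, wpi_copy, h27, h29]
        exact ⟨by omega, by omega, by intros; simp (disch := omega)⟩
      rintro σ₂ ⟨⟨h50, h51⟩, hr₂, hm₂, hd₂⟩
      have hc₂ : ∀ u v, Cell d e g f u v σ₁ → Cell d e g f u v σ₂ := fun u v hc =>
        hc.congr (by rw [hm₂]) (by rw [hm₂]) (by rw [hm₂]) (by rw [hd₂])
      refine Runs.seq (runs_pyrCell hb (henv₁.of_reg (fun r hr' => hr₂ r (by omega))
        (fun a _ => by rw [hm₂])) hp h50 h51 fun hu u' hu' v' hv' => ?_) ?_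
      · obtain ⟨h1, h2⟩ := child w k hp hlogw hu u' hu' v' hv'
        exact hc₂ _ _ (hc _ _ h1 (.inr (h _ _ h1 h2)))
      rintro σ₃ ⟨hr₃, hm₃, hc₃⟩
      have h27₃ : σ₃.reg 27 = k := by rw [hr₃ 27 (by omega), hr₂ 27 (by omega), h27]
      have h29₃ : σ₃.reg 29 = w := by rw [hr₃ 29 (by omega), hr₂ 29 (by omega), h29]
      refine Runs.seq (P := fun σ' =>
        (σ'.reg 50 = k ∧ σ'.reg 51 = w) ∧ (∀ r < 50, σ'.reg r = σ₁.reg r) ∧ σ'.mem = σ₃.mem ∧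
        σ'.dmem = σ₃.dmem) (Runs.of_wp ?_) ?_
      · simp [wp_cons, wp_nil, wpi_copy, h27₃, h29₃]
        refine ⟨by omega, by omega, fun r hr' => ?_⟩
        simp (disch := omega)
        rw [hr₃ r hr', hr₂ r hr']
      rintro σ₄ ⟨⟨h50, h51⟩, hr₄, hm₄, hd₄⟩
      have hc₄ : ∀ u v, Cell d e g f u v σ₃ → Cell d e g f u v σ₄ := fun u v hc =>
        hc.congr (by rw [hm₄]) (by rw [hm₄]) (by rw [hm₄]) (by rw [hd₄])
      refine Runs.seq (runs_pyrCell hb (henv₁.of_reg (fun r hr' => hr₄ r (by omega))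
        (fun a ha => by rw [hm₄, hm₃ a ha, hm₂])) hp' h50 h51 fun hu u' hu' v' hv' => ?_) ?_
      · obtain ⟨h1, h2⟩ := child k w hp' hlogk hu u' hu' v' hv'
        exact hc₄ _ _ (hc₃ _ _ h1 (.inr (hc₂ _ _ (hc _ _ h1 (.inr (h _ _ h1 h2))))))
      rintro σ₅ ⟨hr₅, hm₅, hc₅⟩
      have hr₅' : ∀ r < 50, σ₅.reg r = σ₁.reg r := fun r hr' => by rw [hr₅ r hr', hr₄ r hr']
      refine Runs.of_wp ?_
      simp [wp_cons, wp_nil, wpi_add, I, hr₅', hr 2, henv.reg_two, h27, h28, h29, h30]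
      refine ⟨by omega, by omega, fun r hr' => ?_, fun a ha => ?_, fun u v hpos hcell => ?_⟩
      · simp (disch := omega)
        rw [hr₅' r (by omega), hr r hr']
      · rw [hm₅ a ha, hm₄, hm₃ a ha, hm₂, hm a ha]
      · refine Cell.congr (σ := σ₅) (hc₅ u v hpos ?_) rfl rfl rfl rfl
        by_cases h1 : u = k ∧ v = w
        · exact .inl h1
        refine .inr (hc₄ _ _ (hc₃ u v hpos ?_))
        by_cases h2 : u = w ∧ v = k
        · exact .inl h2
        refine .inr (hc₂ _ _ (hc u v hpos (hcell.imp_left fun h3 => ⟨h3.1, ?_⟩)))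
        omega

end Pyramid

/-! ### Updating the whole pyramid -/

section Pyramid

variable {R : Type u} [AddCommGroup R] [LinearOrder R] {n : ℕ}
variable {d : Fin n → Fin n → R} {S W e : ℕ} {g f : ℕ → ℕ}

theorem pow_add_div_bounds {e i p : ℕ} (hi : i ≤ e) (hp : p < 2 ^ e) :
    2 ^ (e - i) ≤ (2 ^ e + p) / 2 ^ i ∧ (2 ^ e + p) / 2 ^ i < 2 ^ (e - i + 1) := by
  have hpos : 0 < 2 ^ i := by positivity
  have h1 : 2 ^ e = 2 ^ (e - i) * 2 ^ i := by rw [← pow_add]; congr 1; omega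
  constructor
  · rw [Nat.le_div_iff_mul_le hpos]; omega
  · rw [Nat.div_lt_iff_lt_mul hpos, pow_succ, mul_right_comm, ← h1]; omega

theorem runs_pyrCross_copy (hb : PyrBounds n S W e g f) {w j r : ℕ} {σ : State R}
    (henv : PyrEnv n e g f σ) (hj : j ≤ e) (hw : 2 ^ j ≤ w) (hw' : w < 2 ^ (j + 1))
    (h26 : σ.reg 26 = 2 ^ j) (hrw : σ.reg r = w)
    (h : ∀ u v, PyrPos e u v → Nat.log 2 u = j + 1 → Cell d e g f u v σ) :
    Runs d S W (.block [.copy 29 r] ;; pyrCross) (102 * 2 ^ j + 4) σ fun σ' =>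
      (∀ r < 27, σ'.reg r = σ.reg r) ∧ σ'.reg 30 = σ.reg 30 ∧ (∀ a < 3, σ'.mem a = σ.mem a) ∧
      ∀ u v, PyrPos e u v → (Nat.log 2 u = j ∧ (u = w ∨ v = w)) ∨ Cell d e g f u v σ →
        Cell d e g f u v σ' := by
  have hW := hb.word
  have hle : 2 ^ (e + 1) ≤ 2 ^ (e + 1) * 2 ^ (e + 1) := Nat.le_mul_of_pos_left _ (by positivity)
  have hle' : 2 ^ (j + 1) ≤ 2 ^ (e + 1) := Nat.pow_le_pow_right (by omega) (by omega)
  refine Runs.mono (T := 1 + (2 + (102 * 2 ^ j + 1))) (Runs.seq (P := fun σ' =>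
    σ' = ⟨Function.update σ.reg 29 w, σ.dreg, σ.mem, σ.dmem⟩) (Runs.of_wp ?_) ?_) (by omega)
    fun _ h => h
  · simp [wp_cons, wp_nil, wpi_copy, hrw]
    omega
  · rintro _ rfl
    have hc : ∀ u v, Cell d e g f u v σ →
        Cell d e g f u v ⟨Function.update σ.reg 29 w, σ.dreg, σ.mem, σ.dmem⟩ :=
      fun u v hc => hc.congr rfl rfl rfl rfl
    have henv' : PyrEnv n e g f ⟨Function.update σ.reg 29 w, σ.dreg, σ.mem, σ.dmem⟩ :=
      henv.of_reg (fun r hr => Function.update_of_ne (by omega) _ _) fun _ _ => rfl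
    refine (runs_pyrCross hb (w := w) henv' hj hw hw' (by simpa using h26) (by simp)
      fun u v hp hl => hc u v (h u v hp hl)).mono le_rfl ?_
    rintro σ' ⟨h1, h2, h3, h4⟩
    exact ⟨fun r hr => by rw [h1 r hr]; simp (disch := omega), by simpa using h2, h3,
      fun u v hp hcell => h4 u v hp (hcell.imp_right (hc u v))⟩

/-- The invariant of the loop over the levels: `i` levels are done. -/
structure PyrLoop (d : Fin n → Fin n → R) (e : ℕ) (g f : ℕ → ℕ) (a x : ℕ) (σ₀ : State R) (i : ℕ)
    (σ : State R) : Prop where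
  reg : ∀ r < 20, σ.reg r = σ₀.reg r
  reg_24 : σ.reg 24 = (2 ^ e + a) / 2 ^ i
  reg_25 : σ.reg 25 = (2 ^ e + x) / 2 ^ i
  reg_26 : σ.reg 26 = 2 ^ e / 2 ^ i
  reg_30 : σ.reg 30 = 2
  mem : ∀ k < 3, σ.mem k = σ₀.mem k
  cell : ∀ u v, PyrPos e u v → (e < Nat.log 2 u + i ∨ ¬ Under e a u ∧ ¬ Under e a v ∧
    ¬ Under e x u ∧ ¬ Under e x v) → Cell d e g f u v σ

/-- On each level `a` and `x` have one ancestor each, so the two crosses through these ancestors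
contain every stale cell of the level. -/
theorem PyrLoop.step (hb : PyrBounds n S W e g f) {a x i : ℕ} {σ₀ σ : State R}
    (henv₀ : PyrEnv n e g f σ₀) (ha : a < n) (hx : x < n) (h : PyrLoop d e g f a x σ₀ i σ)
    (hi : i ≤ e) :
    Runs d S W ((.block [.copy 29 24] ;; pyrCross) ;; (.block [.copy 29 25] ;; pyrCross) ;;
      .block [.div 24 24 30, .div 25 25 30, .div 26 26 30]) (204 * 2 ^ (e - i) + 11) σ
      (PyrLoop d e g f a x σ₀ (i + 1)) := by
  have hne := hb.le_pow
  have hwa := pow_add_div_bounds (e := e) (i := i) (p := a) hi (by omega)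
  have hwx := pow_add_div_bounds (e := e) (i := i) (p := x) hi (by omega)
  have hW := hb.word
  have hle : 2 ^ (e + 1) ≤ 2 ^ (e + 1) * 2 ^ (e + 1) := Nat.le_mul_of_pos_left _ (by positivity)
  have hle' : 2 ^ (e - i + 1) ≤ 2 ^ (e + 1) := Nat.pow_le_pow_right (by omega) (by omega)
  have hpow : 2 ^ (e - i + 1) = 2 * 2 ^ (e - i) := by rw [pow_succ, mul_comm]
  have h26 : σ.reg 26 = 2 ^ (e - i) := by rw [h.reg_26, Nat.pow_div hi (by omega)]
  have henv : PyrEnv n e g f σ := henv₀.of_reg (fun r hr => h.reg r (by omega)) h.mem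
  have hdone : ∀ u v, PyrPos e u v → Nat.log 2 u = e - i + 1 → Cell d e g f u v σ :=
    fun u v hp hl => h.cell u v hp (.inl (by omega))
  have hunder : ∀ p u, Nat.log 2 u = e - i → Under e p u → u = (2 ^ e + p) / 2 ^ i := by
    intro p u hl hu
    rw [Under, hl, show e - (e - i) = i by omega] at hu
    exact hu.symm
  have h24 := h.reg_24
  have h25 := h.reg_25
  generalize hwa' : (2 ^ e + a) / 2 ^ i = wa at *
  generalize hwx' : (2 ^ e + x) / 2 ^ i = wx at *
  have hdone' : ∀ σ' : State R, (∀ u v, PyrPos e u v → Cell d e g f u v σ → Cell d e g f u v σ') →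
      ∀ u v, PyrPos e u v → Nat.log 2 u = e - i + 1 → Cell d e g f u v σ' :=
    fun σ' hc u v hp hl => hc u v hp (hdone u v hp hl)
  refine Runs.mono (T := (102 * 2 ^ (e - i) + 4) + ((102 * 2 ^ (e - i) + 4) + 3))
    (Runs.seq (runs_pyrCross_copy hb henv (by omega) hwa.1 hwa.2 h26 h24 hdone) ?_)
    (by omega) fun _ h => h
  rintro σ₁ ⟨hr₁, h30₁, hm₁, hc₁⟩
  refine Runs.seq (runs_pyrCross_copy hb (r := 25) (w := wx)
    (henv.of_reg (fun r hr => hr₁ r (by omega)) hm₁) (by omega)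
    hwx.1 hwx.2 (by rw [hr₁ 26 (by omega), h26]) (by rw [hr₁ 25 (by omega), h25])
    (hdone' σ₁ fun u v hp hc => hc₁ u v hp (.inr hc))) ?_
  rintro σ₂ ⟨hr₂, h30₂, hm₂, hc₂⟩
  have hr : ∀ r < 27, σ₂.reg r = σ.reg r := fun r hr => by rw [hr₂ r hr, hr₁ r hr]
  have h30 : σ₂.reg 30 = 2 := by rw [h30₂, h30₁, h.reg_30]
  refine Runs.of_wp ?_
  simp [wp_cons, wp_nil, wpi_div, hr, h24, h25, h26, h30]
  refine ⟨by omega, by omega, by omega, fun r hr' => ?_, ?_, ?_, ?_, h30, fun k hk => ?_,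
    fun u v hp hcell => ?_⟩
  · simp (disch := omega)
    rw [hr r (by omega), h.reg r hr']
  · simp [← hwa', Nat.div_div_eq_div_mul, pow_succ]
  · simp [← hwx', Nat.div_div_eq_div_mul, pow_succ]
  · simp [← Nat.pow_div hi, Nat.div_div_eq_div_mul, pow_succ]
  · simp only
    rw [hm₂ k hk, hm₁ k hk, h.mem k hk]
  · refine Cell.congr (σ := σ₂) (hc₂ u v hp ?_) rfl rfl rfl rfl
    by_cases h1 : Nat.log 2 u = e - i ∧ (u = wx ∨ v = wx)
    · exact .inl h1
    refine .inr (hc₁ u v hp ?_)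
    by_cases h2 : Nat.log 2 u = e - i ∧ (u = wa ∨ v = wa)
    · exact .inl h2
    refine .inr (h.cell u v hp ?_)
    by_cases hl : Nat.log 2 u = e - i
    · have hlv := hp.log_eq ▸ hl
      refine .inr ⟨fun hu => h2 ⟨hl, .inl ?_⟩, fun hu => h2 ⟨hl, .inr ?_⟩,
        fun hu => h1 ⟨hl, .inl ?_⟩, fun hu => h1 ⟨hl, .inr ?_⟩⟩
      · rw [hunder a u hl hu, hwa']
      · rw [hunder a v hlv hu, hwa']
      · rw [hunder x u hl hu, hwx']
      · rw [hunder x v hlv hu, hwx']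
    · exact hcell.imp_left fun hlt => by omega

/-- The pyramid is up to date. -/
def PyrInv (d : Fin n → Fin n → R) (e : ℕ) (g f : ℕ → ℕ) (σ : State R) : Prop :=
  σ.reg 10 = 2 ^ e ∧ σ.reg 11 = 2 ^ (e + 1) ∧ ∀ u v, PyrPos e u v → Cell d e g f u v σ

/-- Repair proceeds from the leaves to the root, in time proportional to the sum of the level sizes.
-/
theorem runs_pyrUpdate {t : ℕ} {σ : State R} (hn : 1 ≤ n) (hne : n ≤ 2 ^ e)
    (hS : 2 ^ (e + 1) * 2 ^ (e + 1) ≤ S) (hW : 2 ^ (e + 1) * 2 ^ (e + 1) ≤ W)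
    (hinv : PyrInv d e g f σ) (h : Ready n t g f σ) :
    Runs d S W pyrUpdate (432 * 2 ^ e + 10) σ fun σ' =>
      PyrInv d e (σ.mem 1) (σ.mem 2) σ' ∧ Keeps σ σ' ∧
      ((∃ p q, Valid n (σ.mem 1) p q) →
        MinPair d (σ.mem 1) (σ.mem 2) (σ'.reg 4) (σ'.reg 5)) := by
  obtain ⟨h10, h11, hcell⟩ := hinv
  have hb : PyrBounds n S W e (σ.mem 1) (σ.mem 2) := ⟨hn, hne, hS, hW, h.flag_le, h.next_lt⟩
  have hle : 2 ^ (e + 1) ≤ 2 ^ (e + 1) * 2 ^ (e + 1) := Nat.le_mul_of_pos_left _ (by positivity)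
  have hpow : 2 ^ (e + 1) = 2 * 2 ^ e := by rw [pow_succ, mul_comm]
  have ha := h.reg_four
  have hx := h.reg_five
  have henv : PyrEnv n e (σ.mem 1) (σ.mem 2) σ :=
    ⟨h.reg_zero, h.reg_two, h.reg_three, h10, h11, rfl, rfl⟩
  refine Runs.mono (T := 4 + ((432 * 2 ^ e + 1) + (2 + 3)))
    (Runs.seq (P := PyrLoop d e (σ.mem 1) (σ.mem 2) (σ.reg 4) (σ.reg 5) σ 0)
    (Runs.of_wp ?_) fun σ₁ h₁ => Runs.seq
      (P := PyrLoop d e (σ.mem 1) (σ.mem 2) (σ.reg 4) (σ.reg 5) σ (e + 1)) ?_ ?_)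
    (by omega) fun _ h => h
  · simp [wp_cons, wp_nil, wpi_add, wpi_copy, wpi_const, h10]
    refine ⟨by omega, by omega, by omega, by omega, fun r hr => by simp (disch := omega), by simp,
      by simp, by simp, by simp, fun _ _ => rfl, fun u v hp hc => ?_⟩
    have hlog : Nat.log 2 u < e + 1 := Nat.log_lt_of_lt_pow hp.left_ne hp.left_lt
    obtain ⟨h1, h2, h3, h4⟩ := hc.resolve_left (by omega)
    -- Away from the changed sites, the flags of the candidates and the successors that enter their
    -- costs are as before.
    refine IsBest.congr (hcell u v hp) ?_ ?_
    · intro c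
      simp only [Valid]
      constructor <;> rintro ⟨⟨hlt, hg1, hg2⟩, hu, hv⟩ <;>
        have k1 : c.1 ≠ σ.reg 4 := (fun hc => h1 (hc ▸ hu)) <;>
        have k2 : c.1 ≠ σ.reg 5 := (fun hc => h3 (hc ▸ hu)) <;>
        have k3 : c.2 ≠ σ.reg 4 := (fun hc => h2 (hc ▸ hv)) <;>
        have k4 : c.2 ≠ σ.reg 5 := (fun hc => h4 (hc ▸ hv))
      · rw [h.flag_eq _ k1 k2] at hg1
        rw [h.flag_eq _ k3 k4] at hg2
        exact ⟨⟨hlt, hg1, hg2⟩, hu, hv⟩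
      · rw [← h.flag_eq _ k1 k2] at hg1
        rw [← h.flag_eq _ k3 k4] at hg2
        exact ⟨⟨hlt, hg1, hg2⟩, hu, hv⟩
    · rintro c ⟨-, hu, hv⟩
      have k1 : c.1 ≠ σ.reg 4 := fun hc => h1 (hc ▸ hu)
      have k2 : c.1 ≠ σ.reg 5 := fun hc => h3 (hc ▸ hu)
      simp only [insCost, h.next_eq _ k1 k2]
  · have := Runs.loop_potential (d := d) (S := S) (W := W) (b := .lt 3 26)
      (p := (.block [.copy 29 24] ;; pyrCross) ;; (.block [.copy 29 25] ;; pyrCross) ;;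
        .block [.div 24 24 30, .div 25 25 30, .div 26 26 30])
      (fun σ' => ∃ i ≤ e + 1,
        PyrLoop d e (σ.mem 1) (σ.mem 2) (σ.reg 4) (σ.reg 5) σ i σ')
      -- A level of `m` nodes takes `204 * m + 12 ≤ 216 * m` steps with its test, and halving
      -- register 26 releases at least `216 * m`.
      (fun σ' => 432 * σ'.reg 26) ?_ ⟨0, by omega, h₁⟩
    · refine this.mono (by rw [h₁.reg_26]; simp) ?_
      rintro σ' ⟨⟨i, hi, h'⟩, hcond⟩
      rw [holds_lt, h'.reg 3 (by omega), h.reg_three, h'.reg_26, not_lt, Nat.le_zero,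
        Nat.div_eq_zero_iff_lt (by positivity), Nat.pow_lt_pow_iff_right (by omega)] at hcond
      obtain rfl : i = e + 1 := by omega
      exact h'
    · rintro σ' ⟨i, hi, h'⟩ hcond
      rw [holds_lt, h'.reg 3 (by omega), h.reg_three, h'.reg_26,
        Nat.div_pos_iff, Nat.pow_le_pow_iff_right (by omega)] at hcond
      refine ⟨_, (h'.step hb henv ha hx hcond.2).mono le_rfl fun σ'' h'' =>
        ⟨⟨i + 1, by omega, h''⟩, ?_⟩⟩
      have hpos : 0 < 2 ^ (e - i) := by positivity
      rw [h''.reg_26, h'.reg_26, pow_succ, ← Nat.div_div_eq_div_mul, Nat.pow_div hcond.2 (by omega)]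
      omega
  · rintro σ₂ h₂
    have hbest := h₂.cell 1 1 ⟨by omega, by omega, by omega, by omega, rfl⟩ (.inl (by simp))
    have hfl : σ₂.mem 5 (2 ^ (e + 1) + 1) ≤ 1 := by
      unfold Cell at hbest
      rcases hbest with ⟨hc, -⟩ | ⟨hc, -⟩ <;> rw [one_mul] at hc <;> omega
    -- The root lies above every leaf, so its cell holds the best of all valid pairs.
    have hroot : ∀ p < n, Under e p 1 := by
      intro p hp
      simp only [Under, Nat.log_one_right, Nat.sub_zero]
      rw [Nat.add_div_left _ (by positivity), Nat.div_eq_of_lt (by omega)]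
    have hlt := pyr_address_lt (e := e) (u := 1) (v := 1) (by omega) (by omega)
    rw [one_mul] at hlt
    have hmp : σ₂.mem 5 (2 ^ (e + 1) + 1) = 1 → MinPair d (σ.mem 1) (σ.mem 2)
        (σ₂.mem 3 (2 ^ (e + 1) + 1)) (σ₂.mem 4 (2 ^ (e + 1) + 1)) := by
      intro h1
      unfold Cell at hbest
      rw [one_mul] at hbest
      rcases hbest with ⟨-, hc, -, hm⟩ | ⟨hc, -⟩
      · exact ⟨hc.1, fun p q hpq => hm (p, q) ⟨hpq, hroot p hpq.1.1, hroot q hpq.1.2⟩⟩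
      · omega
    have hno : σ₂.mem 5 (2 ^ (e + 1) + 1) ≠ 1 → ¬ ∃ p q, Valid n (σ.mem 1) p q := by
      rintro h1 ⟨p, q, hpq⟩
      unfold Cell at hbest
      rw [one_mul] at hbest
      rcases hbest with ⟨hc, -⟩ | ⟨-, hc⟩
      · omega
      · exact hc (p, q) ⟨hpq, hroot p hpq.1.1, hroot q hpq.1.2⟩
    have hcells : ∀ u v, PyrPos e u v → Cell d e (σ.mem 1) (σ.mem 2) u v σ₂ :=
      fun u v hp => h₂.cell u v hp (.inl (by omega))
    refine Runs.of_wp_le ?_ (T := 2 + 3) (by decide)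
    have hr := h₂.reg
    have hm := h₂.mem
    simp [wp_cons, wp_nil, wp_seq, wp_ite, wp_skip, wpi_add, wpi_load, holds_eq, hr, h11,
      h.reg_two]
    refine ⟨by omega, by omega, by omega, fun h1 => ?_, fun h1 => ?_⟩
    · have hmp := hmp h1
      have := hmp.1.1
      refine ⟨by omega, by omega, by omega, by omega, ⟨by simp [hr, h10], by simp [hr, h11],
        fun u v hp => (hcells u v hp).congr rfl rfl rfl rfl⟩, ⟨?_, hm⟩, fun _ _ _ => hmp⟩
      intro r hr' h4 h5
      simp (disch := omega) [hr r (by omega)]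
    · refine ⟨⟨by simp [hr, h10], by simp [hr, h11],
        fun u v hp => (hcells u v hp).congr rfl rfl rfl rfl⟩, ⟨?_, hm⟩, fun p q hpq =>
        absurd ⟨p, q, hpq⟩ (hno h1)⟩
      intro r hr' h4 h5
      simp (disch := omega) [hr r (by omega)]

theorem runs_pyrInit {σ : State R} (hn : 1 ≤ n) (hW : 2 ^ (Nat.clog 2 n + 1) ≤ W)
    (h0 : σ.reg 0 = n) :
    Runs d S W pyrInit (2 * n + 3) σ fun σ' => σ'.reg 10 = 2 ^ Nat.clog 2 n ∧
      σ'.reg 11 = 2 ^ (Nat.clog 2 n + 1) ∧ (∀ r < 10, σ'.reg r = σ.reg r) ∧ σ'.mem = σ.mem := by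
  have hpow : 2 ^ (Nat.clog 2 n + 1) = 2 * 2 ^ (Nat.clog 2 n) := by rw [pow_succ, mul_comm]
  have hpos : 0 < 2 ^ (Nat.clog 2 n) := by positivity
  let I : State R → Prop := fun σ' => (∃ k ≤ Nat.clog 2 n, σ'.reg 10 = 2 ^ k) ∧
    (∀ r < 10, σ'.reg r = σ.reg r) ∧ σ'.mem = σ.mem
  refine Runs.mono (T := 1 + (2 * n + 1 + 1)) (Runs.seq (P := I) (Runs.of_wp ?_) fun σ₁ h₁ =>
    Runs.seq (P := fun σ' => σ'.reg 10 = 2 ^ Nat.clog 2 n ∧ (∀ r < 10, σ'.reg r = σ.reg r) ∧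
      σ'.mem = σ.mem) ?_ fun σ₂ h₂ => Runs.of_wp ?_) (by omega) fun _ h => h
  · simp [wp_cons, wp_nil, wpi_const, I]
    exact ⟨by omega, ⟨0, by omega, rfl⟩, by intros; simp (disch := omega)⟩
  · refine (Runs.loop_measure (b := .lt 10 0) (p := .block [.add 10 10 10]) I
      (fun σ' => n - σ'.reg 10) 1 ?_ h₁).mono (by omega) ?_
    · rintro σ' ⟨⟨k, hk, h10⟩, hr, hm⟩ hlt
      rw [holds_lt, hr 0 (by omega), h0, h10] at hlt
      have hk' : k < Nat.clog 2 n := (Nat.lt_clog_iff_pow_lt (by omega)).2 hlt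
      have hle : 2 ^ (k + 1) ≤ 2 ^ Nat.clog 2 n := Nat.pow_le_pow_right (by omega) hk'
      have hkpos : 0 < 2 ^ k := by positivity
      rw [pow_succ] at hle
      refine Runs.of_wp ?_
      simp [wp_cons, wp_nil, wpi_add, I, h10]
      exact ⟨by omega, ⟨⟨k + 1, hk', by rw [pow_succ]; omega⟩,
        fun r hr' => by simp (disch := omega) [hr r hr'], hm⟩, by omega⟩
    · rintro σ' ⟨⟨⟨k, hk, h10⟩, hr, hm⟩, hlt⟩
      rw [holds_lt, hr 0 (by omega), h0, h10, not_lt, ← Nat.clog_le_iff_le_pow (by omega)] at hlt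
      exact ⟨by rw [h10, le_antisymm hk hlt], hr, hm⟩
  · obtain ⟨h10, hr, hm⟩ := h₂
    simp [wp_cons, wp_nil, wpi_add, h10]
    exact ⟨by omega, by omega, fun r hr' => by simp (disch := omega) [hr r hr'], hm⟩

/-- Initially no site has its flag set, so no pair is valid and zeroed cells are correct. -/
theorem maintains_pyramid (hn : 1 ≤ n)
    (hS : 2 ^ (Nat.clog 2 n + 1) * 2 ^ (Nat.clog 2 n + 1) ≤ S)
    (hW : 2 ^ (Nat.clog 2 n + 1) * 2 ^ (Nat.clog 2 n + 1) ≤ W) :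
    Maintains d S W pyrInit pyrUpdate (2 * n + 3) (fun _ => 432 * 2 ^ Nat.clog 2 n + 10)
      fun _ g f σ => PyrInv d (Nat.clog 2 n) g f σ where
  congr h hr hm hd := ⟨by rw [hr 10 (by omega) (by omega), h.1],
    by rw [hr 11 (by omega) (by omega), h.2.1], fun u v hp => (h.2.2 u v hp).congr
      (hm 5 (by omega)) (hm 3 (by omega)) (hm 4 (by omega)) (by rw [hd])⟩
  init σ h0 h2 hr hm := by
    have hle : 2 ^ (Nat.clog 2 n + 1) ≤ 2 ^ (Nat.clog 2 n + 1) * 2 ^ (Nat.clog 2 n + 1) :=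
      Nat.le_mul_of_pos_left _ (by positivity)
    refine (runs_pyrInit hn (hle.trans hW) h0).mono le_rfl ?_
    rintro σ' ⟨h10, h11, hr', hm'⟩
    refine ⟨⟨h10, h11, fun u v hp => .inr ⟨?_, ?_⟩⟩, ⟨fun r h _ _ => hr' r (by omega),
      fun a _ => by rw [hm']⟩, hr' 4 (by omega), hr' 5 (by omega)⟩
    · rw [hm', hm 5 (by omega)]
    · rintro c ⟨⟨-, hc, -⟩, -⟩
      exact absurd hc (by simp)
  update t g f σ _ hinv hready :=
    runs_pyrUpdate hn (Nat.le_pow_clog (by omega) n) hS hW hinv hready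

end Pyramid

/-! ## Conga lines

A stack of records, each of which leads from a site to a site, contains a cheapest pair of a site
in the tour and a site not in the tour. Each update pushes a path that starts at each site whose
pairs are to be considered anew, called an owner, and leads from each site to the nearest one not
yet visited. -/

/-- Cost of the pair of `reg 40` and `reg 41`, exactly one of which belongs to the tour. -/
def congaCost : Prog :=
  .ite (.eq 42 2) (.block [.copy 43 40, .copy 44 41]) (.block [.copy 43 41, .copy 44 40]) ;;
  .block [.load 45 2 43, .dist 0 43 44, .dist 1 44 45, .dadd 0 0 1, .dist 1 43 45, .dsub 0 0 1]

/-- Compare that pair, whose index is `reg 29`, with the best one found so far. -/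
def congaConsider : Prog :=
  congaCost ;;
  .ite (.eq 30 2) (.ite (.dlt 0 2) (.block [.const 30 1, .copy 31 29, .dcopy 2 0]) .skip)
    (.block [.const 30 1, .copy 31 29, .dcopy 2 0])

/-- Find an owner that has not been visited. -/
def congaFindOwner : Prog :=
  .block [.const 29 0, .const 30 0] ;;
  .loop (.lt 29 0) (.block [.load 32 8 29, .load 33 7 29] ;;
    .ite (.eq 33 2) (.ite (.eq 32 3) (.block [.const 30 1, .copy 31 29]) .skip) .skip ;;
    .block [.add 29 29 2])

/-- Find the next site of a path. -/
def congaFindNext : Prog :=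
  .block [.const 29 0, .const 30 0] ;;
  .loop (.lt 29 0) ((.block [.load 32 8 29, .load 33 7 29, .load 34 1 29, .add 35 27 33] ;;
    .ite (.eq 32 3) (.ite (.eq 34 28) .skip (.ite (.lt 3 35)
      (.block [.copy 40 26, .copy 41 29, .copy 42 28] ;; congaConsider) .skip)) .skip) ;;
    .block [.add 29 29 2])

/-- Find the cheapest record. -/
def congaFindMin : Prog :=
  .block [.const 29 0, .const 30 0] ;;
  .loop (.lt 29 11) ((.block [.load 40 3 29, .load 41 4 29, .load 42 1 40, .load 34 1 41] ;;
    .ite (.eq 42 34) .skip congaConsider) ;;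
    .block [.add 29 29 2])

section Conga

variable {R : Type u} [AddCommGroup R] [LinearOrder R] {n : ℕ}

/-- Exactly one of the sites `p` and `q` belongs to the tour. -/
def Opp (n : ℕ) (g : ℕ → ℕ) (p q : ℕ) : Prop := Valid n g p q ∨ Valid n g q p

theorem Opp.symm {g : ℕ → ℕ} {p q : ℕ} (h : Opp n g p q) : Opp n g q p := Or.symm h

theorem Opp.ne {g : ℕ → ℕ} {p q : ℕ} (h : Opp n g p q) : p ≠ q := by
  rintro rfl
  rcases h with ⟨-, h1, h2⟩ | ⟨-, h1, h2⟩ <;> omega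

theorem opp_iff {g : ℕ → ℕ} (hg : ∀ p, g p ≤ 1) {p q : ℕ} :
    Opp n g p q ↔ p < n ∧ q < n ∧ g p ≠ g q := by
  have := hg p
  have := hg q
  simp only [Opp, Valid]
  omega

/-- Cost of the insertion given by a pair of sites in any order. -/
def pairCost (d : Fin n → Fin n → R) (g f : ℕ → ℕ) (p q : ℕ) : R :=
  if g p = 1 then insCost d f p q else insCost d f q p

/-- The flags tell which of the two is the tour site, so an asymmetric distance still gives a cost
of unordered pairs. -/
theorem pairCost_comm (d : Fin n → Fin n → R) {g f : ℕ → ℕ} {p q : ℕ} (h : Opp n g p q) :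
    pairCost d g f p q = pairCost d g f q p := by
  rcases h with ⟨-, h1, h2⟩ | ⟨-, h1, h2⟩ <;> simp [pairCost, h1, h2]

variable {d : Fin n → Fin n → R} {S W : ℕ} {g f : ℕ → ℕ}

theorem runs_congaConsider {P : ℕ → Prop} {v : ℕ → R} {σ : State R} {p q : ℕ}
    (h2 : σ.reg 2 = 1) (hm2 : σ.mem 2 = f) (hf : ∀ p, f p < n)
    (hS : n ≤ S) (hW : n ≤ W) (hopp : Opp n g p q) (h40 : σ.reg 40 = p) (h41 : σ.reg 41 = q)
    (h42 : σ.reg 42 = g p) (h29 : σ.reg 29 ≤ W) (hv : v (σ.reg 29) = pairCost d g f p q)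
    (hb : IsBest P v (σ.reg 30) (σ.reg 31) (σ.dreg 2)) :
    Runs d S W congaConsider 14 σ fun σ' => (∀ r < 30, σ'.reg r = σ.reg r) ∧ σ'.mem = σ.mem ∧
      σ'.dmem = σ.dmem ∧
      IsBest (fun k => P k ∨ k = σ.reg 29) v (σ'.reg 30) (σ'.reg 31) (σ'.dreg 2) := by
  have hlt : p < n ∧ q < n := by
    rcases hopp with ⟨⟨h1, h2⟩, -⟩ | ⟨⟨h1, h2⟩, -⟩ <;> exact ⟨by assumption, by assumption⟩
  have hnew : ∀ w : R, w = pairCost d g f p q → IsBest (fun k => k = σ.reg 29) v 1 (σ.reg 29) w :=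
    fun w hw => isBest_single (fun _ => Iff.rfl) (by rw [hw, hv])
  refine Runs.mono (T := 9 + 5) (Runs.seq (P := fun σ' => (∀ r < 40, σ'.reg r = σ.reg r) ∧
    σ'.mem = σ.mem ∧ σ'.dmem = σ.dmem ∧ σ'.dreg 2 = σ.dreg 2 ∧
    σ'.dreg 0 = pairCost d g f p q) (Runs.of_wp_le ?_ (by decide)) fun σ₁ h₁ =>
    Runs.of_wp_le ?_ (by decide)) (by omega) fun _ h => h
  · have hfp := hf p
    have hfq := hf q
    simp [congaCost, wp_cons, wp_nil, wp_seq, wp_ite, wp_skip, wpi_load, wpi_copy, wpi_dist,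
      wpi_dadd, wpi_dsub, holds_eq, h40, h41, h42, h2, hm2]
    refine ⟨fun hg => ⟨by omega, by omega, by omega, by omega, hlt, ⟨hlt.2, hfp⟩,
      ⟨hlt.1, hfp⟩, fun r hr => by simp (disch := omega), by simp [pairCost, hg, insCost]⟩,
      fun hg => ⟨by omega, by omega, by omega, by omega, hlt.symm, ⟨hlt.1, hfq⟩,
      ⟨hlt.2, hfq⟩, fun r hr => by simp (disch := omega), by simp [pairCost, hg, insCost]⟩⟩
  · obtain ⟨hr, hm, hd, hd2, hd0⟩ := h₁
    simp [wp_cons, wp_nil, wp_seq, wp_ite, wp_skip, wpi_const, wpi_copy, wpi_dcopy, holds_eq,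
      holds_dlt, hr, hd2, h2]
    refine ⟨fun h30 => ⟨fun hlt' => ⟨by omega, h29, fun r hr' => ?_, hm, hd, ?_⟩, fun hlt' =>
      ⟨fun r hr' => hr r (by omega), hm, hd, ?_⟩⟩, fun h30 => ⟨by omega, h29, fun r hr' => ?_, hm,
      hd, ?_⟩⟩
    · simp (disch := omega) [hr r (by omega)]
    · exact hb.right (hnew _ hd0) rfl (.inr hlt')
    · exact hb.left (hnew _ hd0) (.inr ⟨h30, not_lt.2 hlt'⟩)
    · simp (disch := omega) [hr r (by omega)]
    · exact hb.right (hnew _ hd0) rfl (.inl h30)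

theorem runs_congaFindOwner {σ : State R} (h0 : σ.reg 0 = n) (h2 : σ.reg 2 = 1)
    (h3 : σ.reg 3 = 0) (hS : n ≤ S) (hW : n ≤ W) (hW1 : 1 ≤ W) (hv : ∀ p < n, σ.mem 8 p ≤ 1)
    (ho : ∀ p < n, σ.mem 7 p ≤ 1) :
    Runs d S W congaFindOwner (8 * n + 3) σ fun σ' => (∀ r < 29, σ'.reg r = σ.reg r) ∧
      σ'.mem = σ.mem ∧ σ'.dmem = σ.dmem ∧
      ((σ'.reg 30 = 1 ∧ σ'.reg 31 < n ∧ σ.mem 7 (σ'.reg 31) = 1 ∧ σ.mem 8 (σ'.reg 31) = 0) ∨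
        (σ'.reg 30 = 0 ∧ ∀ p < n, σ.mem 7 p = 1 → σ.mem 8 p = 1)) := by
  let I : ℕ → State R → Prop := fun k σ' => (σ'.reg 29 = k ∧ σ'.reg 0 = n) ∧
    (∀ r < 29, σ'.reg r = σ.reg r) ∧ σ'.mem = σ.mem ∧ σ'.dmem = σ.dmem ∧
      ((σ'.reg 30 = 1 ∧ σ'.reg 31 < n ∧ σ.mem 7 (σ'.reg 31) = 1 ∧ σ.mem 8 (σ'.reg 31) = 0) ∨
        (σ'.reg 30 = 0 ∧ ∀ p < k, σ.mem 7 p = 1 → σ.mem 8 p = 1))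
  refine Runs.mono (T := 2 + ((7 + 1) * (n - 0) + 1)) (Runs.seq (P := I 0) (Runs.of_wp ?_)
    fun σ₁ h₁ => (Runs.loop_count I 7 (fun k σ h => h.1) ?_ (Nat.zero_le n) h₁).mono le_rfl
      fun σ h => h.2) (by omega) fun _ h => h
  · simp [wp_cons, wp_nil, wpi_const, I, h0]
    exact fun r hr => by simp (disch := omega)
  · rintro k σ' hk ⟨⟨h29, h0'⟩, hr, hm, hd, hc⟩
    have hvk := hv k hk
    have hok := ho k hk
    refine Runs.of_wp_le ?_ (by decide)
    simp [wp_cons, wp_nil, wp_seq, wp_ite, wp_skip, wpi_const, wpi_copy, wpi_load, wpi_add,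
      holds_eq, I, h29, hr, hm, h0, h2, h3]
    have hframe : ∀ c d e r : ℕ, r < 29 → Function.update (Function.update (Function.update
        σ'.reg 32 c) 33 d) 29 e r = σ.reg r := by
      intro c d e r hr'
      simp (disch := omega) [hr r hr']
    refine ⟨by omega, by omega, by omega, by omega, fun h7 => ⟨fun h8 => ⟨by omega, by omega,
      by omega, fun r hr' => ?_, hd, hk, h7, h8⟩, fun h8 => ⟨by omega, hframe _ _ _, hd, ?_⟩⟩,
      fun h7 => ⟨by omega, hframe _ _ _, hd, ?_⟩⟩
    · simp (disch := omega) [hr r hr']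
    · refine hc.imp_right fun ⟨h1, h2⟩ => ⟨h1, fun p hp hp' => ?_⟩
      rcases hp.lt_or_eq with hp | rfl
      · exact h2 p hp hp'
      · omega
    · refine hc.imp_right fun ⟨h1, h2⟩ => ⟨h1, fun p hp hp' => ?_⟩
      rcases hp.lt_or_eq with hp | rfl
      · exact h2 p hp hp'
      · omega

/-- In a search that started in the state `σ`, the indices below `k` have been considered, and the
current index is `i`. -/
structure ScanInv (σ : State R) (P : ℕ → Prop) (v : ℕ → R) (i k : ℕ) (σ' : State R) : Prop where
  idx : σ'.reg 29 = i
  reg : ∀ r < 29, σ'.reg r = σ.reg r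
  mem : σ'.mem = σ.mem
  dmem : σ'.dmem = σ.dmem
  best : IsBest (fun j => j < k ∧ P j) v (σ'.reg 30) (σ'.reg 31) (σ'.dreg 2)

variable {P : ℕ → Prop} {v : ℕ → R} {σ σ' σ'' : State R} {i k : ℕ}

theorem ScanInv.skip (h : ScanInv σ P v i k σ') (hP : ¬ P k) : ScanInv σ P v i (k + 1) σ' := by
  refine ⟨h.idx, h.reg, h.mem, h.dmem, h.best.congr (fun q => ?_) fun _ _ => rfl⟩
  rw [Nat.lt_succ_iff_lt_or_eq]
  constructor
  · rintro ⟨h1 | rfl, h2⟩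
    · exact ⟨h1, h2⟩
    · exact absurd h2 hP
  · exact fun ⟨h1, h2⟩ => ⟨.inl h1, h2⟩

theorem ScanInv.congr (h : ScanInv σ P v i k σ') (hr : ∀ r < 32, σ''.reg r = σ'.reg r)
    (hm : σ''.mem = σ'.mem) (hd : σ''.dmem = σ'.dmem) (hd2 : σ''.dreg 2 = σ'.dreg 2) :
    ScanInv σ P v i k σ'' :=
  ⟨by rw [hr 29 (by omega), h.idx], fun r hr' => by rw [hr r (by omega), h.reg r hr'],
    by rw [hm, h.mem], by rw [hd, h.dmem],
    by rw [hr 30 (by omega), hr 31 (by omega), hd2]; exact h.best⟩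

theorem ScanInv.consider {p q : ℕ} (h : ScanInv σ P v k k σ') (hP : P k)
    (h2 : σ.reg 2 = 1) (hm2 : σ.mem 2 = f) (hf : ∀ p, f p < n)
    (hS : n ≤ S) (hW : n ≤ W) (hk : k ≤ W) (hopp : Opp n g p q) (h40 : σ'.reg 40 = p)
    (h41 : σ'.reg 41 = q) (h42 : σ'.reg 42 = g p) (hv : v k = pairCost d g f p q) :
    Runs d S W congaConsider 14 σ' (ScanInv σ P v k (k + 1)) := by
  refine (runs_congaConsider (by rw [h.reg 2 (by omega), h2]) (by rw [h.mem, hm2]) hf hS hW hopp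
    h40 h41 h42 (by rw [h.idx]; exact hk) (by rw [h.idx, hv]) h.best).mono le_rfl ?_
  rintro σ₃ ⟨hr₃, hm₃, hd₃, hb₃⟩
  refine ⟨by rw [hr₃ 29 (by omega), h.idx], fun r hr' => by rw [hr₃ r (by omega), h.reg r hr'],
    by rw [hm₃, h.mem], by rw [hd₃, h.dmem], hb₃.congr (fun q => ?_) fun _ _ => rfl⟩
  rw [h.idx, Nat.lt_succ_iff_lt_or_eq]
  constructor
  · rintro ⟨h1 | rfl, h2⟩
    · exact .inl ⟨h1, h2⟩
    · exact .inr rfl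
  · rintro (⟨h1, h2⟩ | rfl)
    · exact ⟨.inl h1, h2⟩
    · exact ⟨.inr rfl, hP⟩

/-- Shared by the searches for the next site of a path and for the cheapest record, which differ in
the body only. -/
theorem runs_scan {body : Prog} {b c m : ℕ} (hb : b < 29) (hm : σ.reg b = m) (h2 : σ.reg 2 = 1)
    (hmW : m ≤ W) (hbody : ∀ k σ', k < m → ScanInv σ P v k k σ' →
      Runs d S W body c σ' (ScanInv σ P v k (k + 1))) :
    Runs d S W (.block [.const 29 0, .const 30 0] ;;
      .loop (.lt 29 b) (body ;; .block [.add 29 29 2])) ((c + 2) * m + 3) σ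
      (ScanInv σ P v m m) := by
  refine Runs.mono (T := 2 + ((c + 1 + 1) * (m - 0) + 1)) (Runs.seq (P := ScanInv σ P v 0 0)
    (Runs.of_wp ?_) fun σ₁ h₁ => (Runs.loop_count (fun k => ScanInv σ P v k k) (c + 1)
      (fun k σ h => ⟨h.idx, by rw [h.reg b hb, hm]⟩) ?_ (Nat.zero_le m) h₁)) (by
        rw [Nat.sub_zero, add_assoc c 1 1]; omega) fun _ h => h
  · simp only [wp_cons, wp_nil, wpi_const]
    exact ⟨by omega, by omega, by simp, fun r hr => by simp (disch := omega),
      rfl, rfl, .inr ⟨by simp, fun k hk => by omega⟩⟩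
  · intro k σ₁ hk h₁
    refine (hbody k σ₁ hk h₁).seq fun σ₂ h => Runs.of_wp ?_
    simp only [wp_cons, wp_nil, wpi_add, h.idx, h.reg 2 (by omega), h2]
    exact ⟨by omega, by simp, fun r hr => by simp (disch := omega) [h.reg r hr], h.mem, h.dmem,
      by simpa using h.best⟩

/-- A positive sum of the two owner flags is required, so a non-owner is never followed by a
non-owner. This keeps paths short. -/
theorem runs_congaFindNext {c : ℕ} (h0 : σ.reg 0 = n) (h2 : σ.reg 2 = 1)
    (h3 : σ.reg 3 = 0) (hS : n ≤ S) (hW : n ≤ W) (hW2 : 2 ≤ W) (hv : ∀ p < n, σ.mem 8 p ≤ 1)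
    (ho : ∀ p < n, σ.mem 7 p ≤ 1) (hm1 : σ.mem 1 = g) (hm2 : σ.mem 2 = f) (hg : ∀ p, g p ≤ 1)
    (hf : ∀ p, f p < n) (h26 : σ.reg 26 = c) (hc : c < n) (h27 : σ.reg 27 = σ.mem 7 c)
    (h28 : σ.reg 28 = g c) :
    Runs d S W congaFindNext (26 * n + 3) σ (ScanInv σ
      (fun q => Opp n g c q ∧ σ.mem 8 q = 0 ∧ (σ.mem 7 c = 1 ∨ σ.mem 7 q = 1))
      (fun q => pairCost d g f c q) n n) := by
  refine runs_scan (c := 24) (by omega) h0 h2 hW fun k σ' hk h => ?_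
  have hvk := hv k hk
  have hok := ho k hk
  have hoc := ho c hc
  have hgk := hg k
  have hgc := hg c
  refine Runs.mono (T := 4 + 20) (Runs.seq (P := fun σ'' => ScanInv σ
    (fun q => Opp n g c q ∧ σ.mem 8 q = 0 ∧ (σ.mem 7 c = 1 ∨ σ.mem 7 q = 1))
    (fun q => pairCost d g f c q) k k σ'' ∧ σ''.reg 32 = σ.mem 8 k ∧ σ''.reg 34 = g k ∧
    σ''.reg 35 = σ.mem 7 c + σ.mem 7 k) (Runs.of_wp ?_) ?_) (by omega) fun _ h => h
  · simp [wp_cons, wp_nil, wpi_load, wpi_add, h.idx, h.mem, h.reg, h27, hm1]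
    exact ⟨by omega, by omega, by omega, by omega, by omega, by omega, by omega,
      h.congr (fun r hr' => by simp (disch := omega)) h.mem.symm rfl rfl⟩
  rintro σ₁ ⟨h₁, h32, h34, h35⟩
  have hPk : (Opp n g c k ∧ σ.mem 8 k = 0 ∧ (σ.mem 7 c = 1 ∨ σ.mem 7 k = 1)) ↔
      (k < n ∧ g c ≠ g k) ∧ σ.mem 8 k = 0 ∧ (σ.mem 7 c = 1 ∨ σ.mem 7 k = 1) := by
    simp only [opp_iff hg, hc, true_and]
  have hskip : (¬ ((k < n ∧ g c ≠ g k) ∧ σ.mem 8 k = 0 ∧ (σ.mem 7 c = 1 ∨ σ.mem 7 k = 1))) →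
      ∀ T, Runs d S W .skip T σ₁ (ScanInv σ
        (fun q => Opp n g c q ∧ σ.mem 8 q = 0 ∧ (σ.mem 7 c = 1 ∨ σ.mem 7 q = 1))
        (fun q => pairCost d g f c q) k (k + 1)) := by
    intro hP T
    rw [← hPk] at hP
    exact Runs.of_wp_le (h₁.skip hP) (Nat.zero_le _)
  refine (Runs.ite (T := 19) (fun h8 => Runs.ite (T := 18) (fun hcol => hskip ?_ _) fun hcol =>
    Runs.ite (T := 17) (fun hown => ?_) fun hown => hskip ?_ _) fun h8 => hskip ?_ _)
  · rw [holds_eq, h34, h₁.reg 28 (by omega), h28] at hcol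
    omega
  · rw [holds_eq, h32, h₁.reg 3 (by omega), h3] at h8
    rw [holds_eq, h34, h₁.reg 28 (by omega), h28] at hcol
    rw [holds_lt, h35, h₁.reg 3 (by omega), h3] at hown
    have hP := hPk.2 ⟨⟨hk, Ne.symm hcol⟩, h8, by omega⟩
    refine Runs.mono (T := 3 + 14) (Runs.seq (P := fun σ'' =>
      (σ''.reg 40 = c ∧ σ''.reg 41 = k ∧ σ''.reg 42 = g c) ∧ ScanInv σ
        (fun q => Opp n g c q ∧ σ.mem 8 q = 0 ∧ (σ.mem 7 c = 1 ∨ σ.mem 7 q = 1))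
        (fun q => pairCost d g f c q) k k σ'') (Runs.of_wp ?_) ?_)
      (by omega) fun _ h => h
    · simp [wp_cons, wp_nil, wpi_copy, h₁.idx, h₁.reg, h26, h28]
      exact ⟨by omega, by omega, by omega,
        h₁.congr (fun r hr' => by simp (disch := omega)) rfl rfl rfl⟩
    · rintro σ₂ ⟨⟨h40, h41, h42⟩, h₂⟩
      exact h₂.consider hP h2 hm2 hf hS hW (by omega) hP.1 h40 h41 h42 rfl
  · rw [holds_lt, h35, h₁.reg 3 (by omega), h3] at hown
    omega
  · rw [holds_eq, h32, h₁.reg 3 (by omega), h3] at h8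
    tauto

theorem runs_congaFindMin {h : ℕ} (h2 : σ.reg 2 = 1) (h11 : σ.reg 11 = h)
    (hS : n ≤ S) (hW : n ≤ W) (hW1 : 1 ≤ W) (hhS : h ≤ S) (hhW : h ≤ W)
    (hsrc : ∀ j < h, σ.mem 3 j < n) (htgt : ∀ j < h, σ.mem 4 j < n)
    (hm1 : σ.mem 1 = g) (hm2 : σ.mem 2 = f) (hg : ∀ p, g p ≤ 1) (hf : ∀ p, f p < n) :
    Runs d S W congaFindMin (21 * h + 3) σ (ScanInv σ
      (fun j => Opp n g (σ.mem 3 j) (σ.mem 4 j))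
      (fun j => pairCost d g f (σ.mem 3 j) (σ.mem 4 j)) h h) := by
  refine runs_scan (c := 19) (by omega) h11 h2 hhW fun k σ' hk h => ?_
  have hs := hsrc k hk
  have ht := htgt k hk
  have hgs := hg (σ.mem 3 k)
  have hgt := hg (σ.mem 4 k)
  refine Runs.mono (T := 4 + (14 + 1)) (Runs.seq (P := fun σ'' => ScanInv σ
    (fun j => Opp n g (σ.mem 3 j) (σ.mem 4 j))
    (fun j => pairCost d g f (σ.mem 3 j) (σ.mem 4 j)) k k σ'' ∧ σ''.reg 40 = σ.mem 3 k ∧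
    σ''.reg 41 = σ.mem 4 k ∧ σ''.reg 42 = g (σ.mem 3 k) ∧ σ''.reg 34 = g (σ.mem 4 k))
    (Runs.of_wp ?_) ?_) (by omega) fun _ h => h
  · simp [wp_cons, wp_nil, wpi_load, h.idx, h.mem, hm1]
    exact ⟨by omega, by omega, by omega, by omega, by omega, by omega, by omega, by omega,
      h.congr (fun r hr' => by simp (disch := omega)) h.mem.symm rfl rfl⟩
  rintro σ₁ ⟨h₁, h40, h41, h42, h34⟩
  refine Runs.ite (fun heq => ?_) fun heq => ?_
  · rw [holds_eq, h42, h34] at heq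
    refine Runs.of_wp_le (h₁.skip ?_) (Nat.zero_le _)
    rw [opp_iff hg]; tauto
  · rw [holds_eq, h42, h34] at heq
    have hP := (opp_iff hg).2 ⟨hs, ht, heq⟩
    exact h₁.consider hP h2 hm2 hf hS hW (by omega) hP h40 h41 h42 rfl

end Conga

/-! ### What a path covers, and how long it can be -/

section CongaPath

variable {R : Type u} [AddCommGroup R] [LinearOrder R] {n : ℕ}

/-- Among the records from `b` to `h - 1`, some record of `p` or `q` is at most as expensive as the
pair of `p` and `q`, and it is not above some record of `p` or `q` as an owner. -/
def Covered (d : Fin n → Fin n → R) (g f : ℕ → ℕ) (b h : ℕ) (src tgt own : ℕ → ℕ) (p q : ℕ) :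
    Prop :=
  ∃ i < h, ∃ j ≤ i, b ≤ j ∧ own i = 1 ∧ (src i = p ∨ src i = q) ∧ (src j = p ∨ src j = q) ∧
    Opp n g (src j) (tgt j) ∧ pairCost d g f (src j) (tgt j) ≤ pairCost d g f p q

/-- The records from `b` to `h - 1` are those of a path through the sites that satisfy `proc`. -/
structure PathCov (d : Fin n → Fin n → R) (g f o : ℕ → ℕ) (b h : ℕ) (src tgt own : ℕ → ℕ)
    (proc : ℕ → Prop) : Prop where
  owner : ∀ p q, proc p → o p = 1 → Opp n g p q → Covered d g f b h src tgt own p q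
  other : ∀ p q, proc p → o p ≠ 1 → ¬ proc q → o q = 1 → Opp n g p q →
    ∃ j < h, b ≤ j ∧ src j = p ∧ Opp n g (src j) (tgt j) ∧
      pairCost d g f (src j) (tgt j) ≤ pairCost d g f p q

variable {d : Fin n → Fin n → R} {g f o : ℕ → ℕ} {b h : ℕ} {src tgt own : ℕ → ℕ}
  {proc : ℕ → Prop}

theorem Covered.symm {p q : ℕ} (hc : Covered d g f b h src tgt own p q) (hopp : Opp n g p q) :
    Covered d g f b h src tgt own q p := by
  obtain ⟨i, hi, j, hj, hb, ho, h1, h2, h3, h4⟩ := hc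
  exact ⟨i, hi, j, hj, hb, ho, h1.symm, h2.symm, h3, by rwa [pairCost_comm d hopp.symm]⟩

theorem Covered.congr {p q h' : ℕ} {src' tgt' own' : ℕ → ℕ}
    (hc : Covered d g f b h src tgt own p q) (hh : h ≤ h')
    (he : ∀ j < h, src' j = src j ∧ tgt' j = tgt j ∧ own' j = own j) :
    Covered d g f b h' src' tgt' own' p q := by
  obtain ⟨i, hi, j, hj, hb, ho, h1, h2, h3, h4⟩ := hc
  obtain ⟨e1, -, e3⟩ := he i hi
  obtain ⟨e4, e5, -⟩ := he j (by omega)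
  exact ⟨i, by omega, j, hj, hb, by rwa [e3], by rwa [e1], by rwa [e4], by rwa [e4, e5],
    by rwa [e4, e5]⟩

/-- The conga line argument: of two sites, the one processed first chose its record while the other
was still a candidate. The clause `other` keeps this for non-owners until the owner's own record
arrives. -/
theorem PathCov.push {c q₀ : ℕ} (hp : PathCov d g f o b h src tgt own proc) (hb : b ≤ h)
    (hc : ¬ proc c) (hbest : ∀ q, ¬ proc q → Opp n g c q → o c = 1 ∨ o q = 1 →
      Opp n g c q₀ ∧ pairCost d g f c q₀ ≤ pairCost d g f c q) :
    PathCov d g f o b (h + 1) (Function.update src h c) (Function.update tgt h q₀)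
      (Function.update own h (o c)) (fun p => proc p ∨ p = c) := by
  have hne : ∀ j < h, Function.update src h c j = src j ∧ Function.update tgt h q₀ j = tgt j ∧
      Function.update own h (o c) j = own j := by
    intro j hj
    have : j ≠ h := by omega
    simp [this]
  refine ⟨fun p q hpp hop hopp => ?_, fun p q hpp hop hq hoq hopp => ?_⟩
  · rcases hpp with hpp | rfl
    · exact (hp.owner p q hpp hop hopp).congr (by omega) hne
    -- If `q` came first and is an owner, the pair is covered by symmetry. If it is not an owner,
    -- its record is the cheap one, and the new record of `p`, which lies above it, is the owner
    -- record.
    · by_cases hq : proc q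
      · by_cases hoq : o q = 1
        · exact ((hp.owner q p hq hoq hopp.symm).congr (by omega) hne).symm hopp.symm
        · obtain ⟨j, hj, hbj, h1, h2, h3⟩ := hp.other q p hq hoq hc hop hopp.symm
          obtain ⟨e1, e2, -⟩ := hne j hj
          refine ⟨h, by omega, j, by omega, hbj, by simpa using hop, .inl (by simp),
            .inr (by rw [e1, h1]), by rwa [e1, e2], ?_⟩
          rw [e1, e2, pairCost_comm d hopp]
          exact h3
      · obtain ⟨h1, h2⟩ := hbest q hq hopp (.inl hop)
        exact ⟨h, by omega, h, le_rfl, hb, by simpa using hop, .inl (by simp), .inl (by simp),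
          by simpa using h1, by simpa using h2⟩
  · simp only [not_or] at hq
    rcases hpp with hpp | rfl
    · obtain ⟨j, hj, hbj, h1, h2, h3⟩ := hp.other p q hpp hop hq.1 hoq hopp
      obtain ⟨e1, e2, -⟩ := hne j hj
      exact ⟨j, by omega, hbj, by rw [e1, h1], by rwa [e1, e2], by rwa [e1, e2]⟩
    · obtain ⟨h1, h2⟩ := hbest q hq.1 hopp (.inr hoq)
      exact ⟨h, by omega, hb, by simp, by simpa using h1, by simpa using h2⟩

theorem PathCov.congr_proc {proc' : ℕ → Prop} (hp : PathCov d g f o b h src tgt own proc)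
    (he : ∀ p, proc' p ↔ proc p) : PathCov d g f o b h src tgt own proc' := by
  obtain rfl : proc' = proc := funext fun p => propext (he p)
  exact hp

/-- Number of owners that have not been visited. -/
def unvisited (n : ℕ) (o vis : ℕ → ℕ) : ℕ :=
  ((Finset.range n).filter fun p => o p = 1 ∧ vis p = 0).card

theorem unvisited_update {vis : ℕ → ℕ} {p : ℕ} (hp : p < n) (ho : o p = 1) (hv : vis p = 0) :
    unvisited n o (Function.update vis p 1) + 1 = unvisited n o vis := by
  unfold unvisited
  rw [← Finset.card_erase_add_one (a := p)
    (s := (Finset.range n).filter fun p => o p = 1 ∧ vis p = 0) (by simp [hp, ho, hv])]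
  congr 2
  ext q
  by_cases hq : q = p <;> simp [hq]

theorem unvisited_update_of_ne {vis : ℕ → ℕ} {p : ℕ} (ho : o p ≠ 1) :
    unvisited n o (Function.update vis p 1) = unvisited n o vis := by
  unfold unvisited
  congr 1
  ext q
  by_cases hq : q = p
  · subst hq; simp [ho]
  · simp [hq]

/-- Bound for the number of records still to be pushed. -/
def pathPotential (n : ℕ) (o vis : ℕ → ℕ) (hv cur : ℕ) : ℕ :=
  3 * unvisited n o vis + if hv = 1 then (if o cur = 1 then 2 else 1) else 0

/-- The invariant of the construction of a path. There are `N` owners, marked by `o`. The path has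
a current end `cur` if `hv` is one, and the construction goes on if `go` is one. -/
structure PathInv (d : Fin n → Fin n → R) (g f o : ℕ → ℕ) (b N : ℕ) (src₀ tgt₀ own₀ : ℕ → ℕ)
    (src tgt own vis : ℕ → ℕ) (h hv go cur : ℕ) : Prop where
  le : b ≤ h
  old : ∀ j < b, src j = src₀ j ∧ tgt j = tgt₀ j ∧ own j = own₀ j
  record : ∀ j, b ≤ j → j < h → src j < n ∧ tgt j < n ∧ own j = o (src j)
  inj : ∀ i j, b ≤ i → i < h → b ≤ j → j < h → tgt i = tgt j → src i ≠ tgt i → src j ≠ tgt j →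
    i = j
  tgt_vis : ∀ j, b ≤ j → j < h → src j ≠ tgt j → vis (tgt j) = 1
  vis_le : ∀ p < n, vis p ≤ 1
  hv_le : hv ≤ 1
  go_le : go ≤ 1
  cur_vis : hv = 1 → cur < n ∧ vis cur = 1
  cov : PathCov d g f o b h src tgt own fun p => vis p = 1 ∧ ¬ (hv = 1 ∧ p = cur)
  bound : h + pathPotential n o vis hv cur ≤ b + 3 * N
  halted : go = 0 → hv = 0 ∧ ∀ p < n, o p = 1 → vis p = 1

variable {N : ℕ} {src₀ tgt₀ own₀ vis : ℕ → ℕ} {hv go cur : ℕ}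

/-- No record is pushed: the three units of an unvisited owner become the two of a current one. -/
theorem PathInv.restart {p : ℕ}
    (hi : PathInv d g f o b N src₀ tgt₀ own₀ src tgt own vis h 0 1 cur)
    (hp : p < n) (ho : o p = 1) (hvis : vis p = 0) :
    PathInv d g f o b N src₀ tgt₀ own₀ src tgt own (Function.update vis p 1) h 1 1 p ∧
      pathPotential n o (Function.update vis p 1) 1 p < pathPotential n o vis 0 cur := by
  have hu := unvisited_update hp ho hvis
  have hpot : pathPotential n o (Function.update vis p 1) 1 p < pathPotential n o vis 0 cur := by
    simp [pathPotential, ho]; omega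
  refine ⟨⟨hi.le, hi.old, hi.record, hi.inj, fun j h1 h2 h3 => ?_, fun q hq => ?_, le_rfl, le_rfl,
    fun _ => ⟨hp, by simp⟩, hi.cov.congr_proc fun q => ?_, by have := hi.bound; omega,
    fun h => by omega⟩, hpot⟩
  · rw [Function.update_apply]; split_ifs; rfl; exact hi.tgt_vis j h1 h2 h3
  · rw [Function.update_apply]; split_ifs; rfl; exact hi.vis_le q hq
  · by_cases hq : q = p
    · subst hq; simp [hvis]
    · simp [hq]

theorem PathInv.finish (hi : PathInv d g f o b N src₀ tgt₀ own₀ src tgt own vis h 0 1 cur)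
    (hall : ∀ p < n, o p = 1 → vis p = 1) :
    PathInv d g f o b N src₀ tgt₀ own₀ src tgt own vis h 0 0 cur :=
  ⟨hi.le, hi.old, hi.record, hi.inj, hi.tgt_vis, hi.vis_le, hi.hv_le, by omega, hi.cur_vis, hi.cov,
    hi.bound, fun _ => ⟨rfl, hall⟩⟩

/-- The end of a path is recorded as a loop. It is no pair of opposite sites, so it never competes,
but it keeps the owner mark of the site; no candidate is left that it would have to cover. -/
theorem PathInv.stuck (hi : PathInv d g f o b N src₀ tgt₀ own₀ src tgt own vis h 1 1 cur)
    (hno : ∀ q, ¬ (Opp n g cur q ∧ vis q = 0 ∧ (o cur = 1 ∨ o q = 1))) :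
    PathInv d g f o b N src₀ tgt₀ own₀ (Function.update src h cur) (Function.update tgt h cur)
      (Function.update own h (o cur)) vis (h + 1) 0 1 cur ∧
      pathPotential n o vis 0 cur < pathPotential n o vis 1 cur := by
  obtain ⟨hcn, hcv⟩ := hi.cur_vis rfl
  have hpot : pathPotential n o vis 0 cur < pathPotential n o vis 1 cur := by
    simp only [pathPotential, reduceIte, zero_ne_one]; split_ifs <;> omega
  have hle := hi.le
  have hbound := hi.bound
  have hcov := hi.cov.push (c := cur) (q₀ := cur) hle (by simp) fun q hq hopp ho => by
    refine (hno q ⟨hopp, ?_, ho⟩).elim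
    have hqn : q < n := by rcases hopp with ⟨⟨_, h⟩, _⟩ | ⟨⟨h, _⟩, _⟩ <;> exact h
    have := hi.vis_le q hqn
    have := hopp.ne
    by_contra hc
    exact hq ⟨by omega, fun h => this h.2.symm⟩
  refine ⟨⟨by omega, fun j hj => ?_, fun j h1 h2 => ?_, fun i j h1 h2 h3 h4 => ?_,
    fun j h1 h2 => ?_, hi.vis_le, by omega, le_rfl, fun h => by omega,
    hcov.congr_proc fun p => ?_, by omega, fun h => by omega⟩, hpot⟩
  · have : j ≠ h := by omega
    simpa [this] using hi.old j hj
  · by_cases hj : j = h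
    · subst hj; simp [hcn]
    · simpa [hj] using hi.record j h1 (by omega)
  · by_cases hih : i = h <;> by_cases hjh : j = h <;> simp [hih, hjh]
    exact hi.inj i j h1 (by omega) h3 (by omega)
  · by_cases hj : j = h
    · subst hj; simp
    · simpa [hj] using hi.tgt_vis j h1 (by omega)
  · by_cases hp : p = cur
    · subst hp; simp [hcv]
    · simp [hp]

/-- The potential pays for the record. Moving from an owner to a non-owner releases one unit. Any
move to an owner uses up three units of an unvisited one and returns at most two. Since `q` was
unvisited, no earlier record other than a loop leads to it. -/
theorem PathInv.extend {q : ℕ}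
    (hi : PathInv d g f o b N src₀ tgt₀ own₀ src tgt own vis h 1 1 cur)
    (hq : Opp n g cur q ∧ vis q = 0 ∧ (o cur = 1 ∨ o q = 1))
    (hmin : ∀ q', Opp n g cur q' ∧ vis q' = 0 ∧ (o cur = 1 ∨ o q' = 1) →
      pairCost d g f cur q ≤ pairCost d g f cur q') :
    PathInv d g f o b N src₀ tgt₀ own₀ (Function.update src h cur) (Function.update tgt h q)
      (Function.update own h (o cur)) (Function.update vis q 1) (h + 1) 1 1 q ∧
      pathPotential n o (Function.update vis q 1) 1 q < pathPotential n o vis 1 cur := by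
  obtain ⟨hcn, hcv⟩ := hi.cur_vis rfl
  obtain ⟨hopp, hqv, hown⟩ := hq
  have hqn : q < n := by rcases hopp with ⟨⟨_, h⟩, _⟩ | ⟨⟨h, _⟩, _⟩ <;> exact h
  have hpot : pathPotential n o (Function.update vis q 1) 1 q < pathPotential n o vis 1 cur := by
    by_cases ho : o q = 1
    · have := unvisited_update hqn ho hqv
      simp [pathPotential, ho]; split_ifs <;> omega
    · have := unvisited_update_of_ne (n := n) (vis := vis) ho
      simp [pathPotential, ho, hown.resolve_right ho, this]
  have hle := hi.le
  have hbound := hi.bound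
  have hcov := hi.cov.push (c := cur) (q₀ := q) hle (by simp) fun q' hq' hopp' ho => by
    refine ⟨hopp, hmin q' ⟨hopp', ?_, ho⟩⟩
    have hqn : q' < n := by rcases hopp' with ⟨⟨_, h⟩, _⟩ | ⟨⟨h, _⟩, _⟩ <;> exact h
    have := hi.vis_le q' hqn
    have := hopp'.ne
    by_contra hc
    exact hq' ⟨by omega, fun h => this h.2.symm⟩
  have hnew : ∀ j, b ≤ j → j < h → src j ≠ tgt j → tgt j ≠ q := by
    intro j h1 h2 h3 h4
    have := hi.tgt_vis j h1 h2 h3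
    rw [h4, hqv] at this
    omega
  refine ⟨⟨by omega, fun j hj => ?_, fun j h1 h2 => ?_, fun i j h1 h2 h3 h4 => ?_,
    fun j h1 h2 => ?_, fun p hp => ?_, le_rfl, le_rfl, fun _ => ⟨hqn, by simp⟩,
    hcov.congr_proc fun p => ?_, by omega, fun h => by omega⟩, hpot⟩
  · have : j ≠ h := by omega
    simpa [this] using hi.old j hj
  · by_cases hj : j = h
    · subst hj; simp [hcn, hqn]
    · simpa [hj] using hi.record j h1 (by omega)
  · by_cases hih : i = h <;> by_cases hjh : j = h <;> simp [hih, hjh]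
    · intro e1 e2 e3
      exact absurd e1.symm (hnew j h3 (by omega) e3)
    · intro e1 e2
      exact absurd e1 (hnew i h1 (by omega) e2)
    · exact hi.inj i j h1 (by omega) h3 (by omega)
  · by_cases hj : j = h
    · subst hj; simp
    · simp only [ne_eq, hj, not_false_eq_true, Function.update_of_ne]
      intro h3
      rw [Function.update_of_ne (hnew j h1 (by omega) h3)]
      exact hi.tgt_vis j h1 (by omega) h3
  · rw [Function.update_apply]; split_ifs; rfl; exact hi.vis_le p hp
  · by_cases hp : p = q
    · subst hp; simp [hqv, hopp.ne.symm]
    · by_cases hp' : p = cur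
      · subst hp'; simp [hcv, hp]
      · simp [hp, hp']

/-- After the halt there is no current end, so every owner is processed and the clause `owner` of
`PathCov` applies. -/
theorem PathInv.covered (hi : PathInv d g f o b N src₀ tgt₀ own₀ src tgt own vis h hv 0 cur)
    {p q : ℕ} (hopp : Opp n g p q) (ho : o p = 1 ∨ o q = 1) :
    Covered d g f b h src tgt own p q := by
  obtain ⟨rfl, hall⟩ := hi.halted rfl
  have hlt : p < n ∧ q < n := by
    rcases hopp with ⟨⟨h1, h2⟩, -⟩ | ⟨⟨h1, h2⟩, -⟩ <;> exact ⟨by assumption, by assumption⟩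
  rcases ho with ho | ho
  · exact hi.cov.owner p q ⟨hall p hlt.1 ho, by simp⟩ ho hopp
  · exact (hi.cov.owner q p ⟨hall q hlt.2 ho, by simp⟩ ho hopp.symm).symm hopp.symm

theorem PathInv.start (hv : ∀ p < n, vis p = 0) :
    PathInv d g f o b (unvisited n o vis) src tgt own src tgt own vis b 0 1 cur :=
  have hno : ∀ p q, Opp n g p q → vis p ≠ 1 := fun p q hopp => by
    rw [hv p (by rcases hopp with ⟨⟨h, _⟩, _⟩ | ⟨⟨_, h⟩, _⟩ <;> exact h)]; omega
  ⟨le_rfl, fun _ _ => ⟨rfl, rfl, rfl⟩, fun j _ _ => by omega, fun i _ _ _ => by omega,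
    fun j _ _ => by omega, fun p hp => by rw [hv p hp]; omega, by omega, le_rfl, fun h => by omega,
    ⟨fun p _ hp _ hopp => absurd hp.1 (hno p _ hopp), fun p _ hp _ _ _ hopp =>
      absurd hp.1 (hno p _ hopp)⟩, by simp [pathPotential], fun h => by omega⟩

end CongaPath

/-- Extend the path by one site, or start anew at an owner. -/
def congaPathStep : Prog :=
  .ite (.eq 24 3)
    (congaFindOwner ;;
      .ite (.eq 30 2) (.block [.copy 26 31, .const 24 1, .store 8 26 2]) (.block [.const 25 0]))
    (.block [.load 27 7 26, .load 28 1 26] ;; congaFindNext ;;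
      .ite (.eq 30 2)
        (.block [.store 3 11 26, .store 5 11 27, .store 4 11 31, .store 8 31 2, .copy 26 31,
          .add 11 11 2])
        (.block [.store 3 11 26, .store 5 11 27, .store 4 11 26, .const 24 0, .add 11 11 2]))

/-- Push a path on the stack, from the height `reg 23` on. -/
def congaPath : Prog :=
  .block [.copy 11 23, .const 24 0, .const 25 1] ;; .loop (.eq 25 2) congaPathStep

/-! ### Running the construction of a path -/

section CongaPath

variable {R : Type u} [AddCommGroup R] [LinearOrder R] {n : ℕ}

/-- What is fixed while a path is constructed. -/
structure PathEnv (n S W b N : ℕ) (σ : State R) : Prop where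
  reg_zero : σ.reg 0 = n
  reg_two : σ.reg 2 = 1
  reg_three : σ.reg 3 = 0
  flag_le : ∀ p, σ.mem 1 p ≤ 1
  next_lt : ∀ p, σ.mem 2 p < n
  owner_le : ∀ p < n, σ.mem 7 p ≤ 1
  two_le : 2 ≤ W
  space : n ≤ S
  word : n ≤ W
  height_space : b + 3 * N ≤ S
  height_word : b + 3 * N ≤ W

/-- The invariant of the construction, for a state `σ` that arose from the state `σ₀`. -/
structure PathState (d : Fin n → Fin n → R) (b N : ℕ) (σ₀ σ : State R) : Prop where
  reg : ∀ r < 24, r ≠ 11 → σ.reg r = σ₀.reg r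
  mem : ∀ a < 8, a ≠ 3 → a ≠ 4 → a ≠ 5 → σ.mem a = σ₀.mem a
  inv : PathInv d (σ₀.mem 1) (σ₀.mem 2) (σ₀.mem 7) b N (σ₀.mem 3) (σ₀.mem 4) (σ₀.mem 5) (σ.mem 3)
    (σ.mem 4) (σ.mem 5) (σ.mem 8) (σ.reg 11) (σ.reg 24) (σ.reg 25) (σ.reg 26)

variable {d : Fin n → Fin n → R} {S W b N : ℕ} {σ₀ σ : State R}

/-- The flag in register 25 is part of the measure because the last step merely clears it. -/
theorem PathState.step (he : PathEnv n S W b N σ₀) (h : PathState d b N σ₀ σ)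
    (hgo : σ.reg 25 = 1) :
    Runs d S W congaPathStep (26 * n + 13) σ fun σ' => PathState d b N σ₀ σ' ∧
      pathPotential n (σ₀.mem 7) (σ'.mem 8) (σ'.reg 24) (σ'.reg 26) + σ'.reg 25 <
        pathPotential n (σ₀.mem 7) (σ.mem 8) (σ.reg 24) (σ.reg 26) + σ.reg 25 := by
  have hinv := h.inv
  have h0 : σ.reg 0 = n := by rw [h.reg 0 (by omega) (by omega), he.reg_zero]
  have h2 : σ.reg 2 = 1 := by rw [h.reg 2 (by omega) (by omega), he.reg_two]
  have h3 : σ.reg 3 = 0 := by rw [h.reg 3 (by omega) (by omega), he.reg_three]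
  have hm1 := h.mem 1 (by omega) (by omega) (by omega) (by omega)
  have hm2 := h.mem 2 (by omega) (by omega) (by omega) (by omega)
  have hm7 := h.mem 7 (by omega) (by omega) (by omega) (by omega)
  obtain ⟨hS, hW, hW2, hhS, hhW⟩ := And.intro he.space
    (And.intro he.word (And.intro he.two_le (And.intro he.height_space he.height_word)))
  rw [hgo] at hinv
  refine Runs.mono (T := (26 * n + 12) + 1) (Runs.ite (fun hc => ?_) fun hc => ?_) (by omega)
    fun _ h => h
  · rw [holds_eq, h3] at hc
    rw [hc] at hinv
    refine Runs.mono (T := (8 * n + 3) + 4) (Runs.seq (runs_congaFindOwner h0 h2 h3 hS hW (by omega)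
      hinv.vis_le (by rw [hm7]; exact he.owner_le)) ?_) (by omega) fun _ h => h
    rintro σ₁ ⟨hr, hm, hd, hcase⟩
    rw [hm7] at hcase
    refine Runs.of_wp_le ?_ (by decide)
    rcases hcase with ⟨h30, h31, ho, hvis⟩ | ⟨h30, hall⟩
    · obtain ⟨hi, hlt⟩ := hinv.restart h31 ho hvis
      simp [wp_cons, wp_nil, wp_ite, wpi_copy, wpi_const, wpi_store, holds_eq, h30, hr, h2, hm]
      refine ⟨by omega, by omega, by omega, ⟨fun r hr' hr'' => ?_, fun a h1 h3 h4 h5 => ?_, ?_⟩, ?_⟩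
      · simp (disch := omega) [hr r (by omega), h.reg r hr' hr'']
      · simp (disch := omega) [h.mem a h1 h3 h4 h5]
      · simpa [hr, hgo] using hi
      · rw [hc]; exact hlt
    · have hi := hinv.finish hall
      simp [wp_cons, wp_nil, wp_ite, wpi_copy, wpi_const, wpi_store, holds_eq, h30, hr, h2, hm]
      refine ⟨⟨fun r hr' hr'' => ?_, fun a h1 h3 h4 h5 => ?_, ?_⟩, ?_⟩
      · simp (disch := omega) [hr r (by omega), h.reg r hr' hr'']
      · simp [hm, h.mem a h1 h3 h4 h5]
      · simpa [hr, hm, hc] using hi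
      · rw [hgo]; omega
  · rw [holds_eq, h3] at hc
    have hhv := hinv.hv_le
    have hc1 : σ.reg 24 = 1 := by omega
    rw [hc1] at hinv
    obtain ⟨hcn, hcv⟩ := hinv.cur_vis rfl
    have hoc := he.owner_le _ hcn
    have hgc := he.flag_le (σ.reg 26)
    refine Runs.mono (T := 2 + ((26 * n + 3) + 7)) (Runs.seq (P := fun σ' =>
      (∀ r < 27, σ'.reg r = σ.reg r) ∧ σ'.mem = σ.mem ∧ σ'.reg 27 = σ₀.mem 7 (σ.reg 26) ∧
      σ'.reg 28 = σ₀.mem 1 (σ.reg 26)) (Runs.of_wp ?_) fun σ₁ h₁ => ?_) (by omega) fun _ h => h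
    · simp [wp_cons, wp_nil, wpi_load, hm1, hm7]
      exact ⟨by omega, by omega, by omega, by omega, fun r hr => by simp (disch := omega)⟩
    obtain ⟨hr₁, hm₁, h27, h28⟩ := h₁
    refine Runs.seq (runs_congaFindNext (g := σ₀.mem 1) (f := σ₀.mem 2) (c := σ.reg 26)
      (by rw [hr₁ 0 (by omega), h0]) (by rw [hr₁ 2 (by omega), h2])
      (by rw [hr₁ 3 (by omega), h3]) hS hW hW2 (by rw [hm₁]; exact hinv.vis_le)
      (by rw [hm₁, hm7]; exact he.owner_le) (by rw [hm₁, hm1]) (by rw [hm₁, hm2]) he.flag_le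
      he.next_lt (hr₁ 26 (by omega)) hcn (by rw [h27, hm₁, hm7]) h28) fun σ₂ h₂ => ?_
    have hr₂ : ∀ r < 27, σ₂.reg r = σ.reg r := fun r hr => by
      rw [h₂.reg r (by omega), hr₁ r hr]
    have hm₂ : σ₂.mem = σ.mem := by rw [h₂.mem, hm₁]
    have h27₂ : σ₂.reg 27 = σ₀.mem 7 (σ.reg 26) := by rw [h₂.reg 27 (by omega), h27]
    have hbest := h₂.best
    rw [hm₁, hm7] at hbest
    have hlt : ∀ q, Opp n (σ₀.mem 1) (σ.reg 26) q → q < n := by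
      rintro q (⟨⟨_, h⟩, _⟩ | ⟨⟨h, _⟩, _⟩) <;> exact h
    refine Runs.of_wp_le ?_ (by decide)
    rcases hbest with ⟨h30, ⟨h31n, hcand⟩, -, hmin⟩ | ⟨h30, hno⟩
    · obtain ⟨hi, hpot⟩ := hinv.extend hcand fun q' hq' => hmin q' ⟨hlt q' hq'.1, hq'⟩
      have hbound := hi.bound
      simp [wp_cons, wp_nil, wp_ite, wpi_copy, wpi_const, wpi_store, wpi_add, holds_eq, h30, hr₂,
        h2, hm₂, h27₂]
      refine ⟨by omega, by omega, by omega, by omega,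
        ⟨fun r hr' hr'' => ?_, fun a h1 h3 h4 h5 => ?_, ?_⟩, ?_⟩
      · simp (disch := omega) [hr₂ r (by omega), h.reg r hr' hr'']
      · simp (disch := omega) [h.mem a h1 h3 h4 h5]
      · simpa [hr₂, hgo, hc1] using hi
      · rw [hc1]; omega
    · obtain ⟨hi, hpot⟩ := hinv.stuck fun q hq => hno q ⟨hlt q hq.1, hq⟩
      have hbound := hi.bound
      simp [wp_cons, wp_nil, wp_ite, wpi_copy, wpi_const, wpi_store, wpi_add, holds_eq, h30, hr₂,
        h2, hm₂, h27₂]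
      refine ⟨by omega, by omega,
        ⟨fun r hr' hr'' => ?_, fun a h1 h3 h4 h5 => ?_, ?_⟩, ?_⟩
      · simp (disch := omega) [hr₂ r (by omega), h.reg r hr' hr'']
      · simp (disch := omega) [h.mem a h1 h3 h4 h5]
      · simpa [hr₂, hgo, hc1] using hi
      · rw [hc1]; omega

theorem runs_congaPath (hN : N = unvisited n (σ₀.mem 7) (σ₀.mem 8)) (he : PathEnv n S W b N σ₀)
    (h23 : σ₀.reg 23 = b) (hv : ∀ p < n, σ₀.mem 8 p = 0) :
    Runs d S W congaPath ((26 * n + 14) * (3 * N + 1) + 4) σ₀ fun σ => PathState d b N σ₀ σ ∧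
      σ.reg 25 = 0 := by
  have hW2 := he.two_le
  have hhW := he.height_word
  refine Runs.mono (T := 3 + ((26 * n + 14) * (3 * N + 1) + 1)) (Runs.seq (P := fun σ =>
    PathState d b N σ₀ σ ∧ σ.reg 24 = 0 ∧ σ.reg 25 = 1 ∧ σ.mem 8 = σ₀.mem 8) (Runs.of_wp ?_)
    fun σ₁ h₁ => ?_) (by omega) fun _ h => h
  · simp [wp_cons, wp_nil, wpi_const, wpi_copy, h23]
    refine ⟨by omega, by omega, fun r hr hr' => by simp (disch := omega), fun _ _ _ _ _ => rfl, ?_⟩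
    subst hN
    simpa using PathInv.start hv
  · obtain ⟨hst, h24, h25, hm8⟩ := h₁
    have := Runs.loop_measure (d := d) (S := S) (W := W) (b := .eq 25 2) (p := congaPathStep)
      (PathState d b N σ₀)
      (fun σ => pathPotential n (σ₀.mem 7) (σ.mem 8) (σ.reg 24) (σ.reg 26) + σ.reg 25)
      (26 * n + 13) (fun σ hσ hb => ?_) hst
    · refine this.mono ?_ ?_
      · rw [h24, h25, hm8, hN]
        simp [pathPotential]
      · rintro σ ⟨hσ, hb⟩
        rw [holds_eq, hσ.reg 2 (by omega) (by omega), he.reg_two] at hb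
        exact ⟨hσ, by have := hσ.inv.go_le; omega⟩
    · rw [holds_eq, hσ.reg 2 (by omega) (by omega), he.reg_two] at hb
      exact hσ.step he hb

end CongaPath

/-! ### Combinatorics of the stack: height, depth and discarded owners -/

section Schedule

/-- The sources of the records from `b` to `h - 1` that are owners. -/
def ownerSources (src own : ℕ → ℕ) (b h : ℕ) : Finset ℕ :=
  ((Finset.Ico b h).filter fun j => own j = 1).image src

/-- The records below `h` that lead to `z`. -/
def recordsTo (src tgt : ℕ → ℕ) (z h : ℕ) : Finset ℕ :=
  (Finset.range h).filter fun j => tgt j = z ∧ src j ≠ z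

/-- The records from `b` to `h - 1` form paths with at most `B` owners. -/
structure Segment (src tgt own : ℕ → ℕ) (b h B : ℕ) : Prop where
  le : b ≤ h
  height : h ≤ b + 3 * B
  inj : ∀ i j, b ≤ i → i < h → b ≤ j → j < h → tgt i = tgt j → src i ≠ tgt i → src j ≠ tgt j →
    i = j
  owners : (ownerSources src own b h).card ≤ B

/-- Structure of the stack after the update number `u`, if `hts` gives the heights after the
updates. Each update `u` discards what was pushed since the update `u - gcd K u`. -/
inductive Stack (K L : ℕ) (src tgt own hts : ℕ → ℕ) : ℕ → Prop
  | base {u : ℕ} (hg : K.gcd u = K) (hs : Segment src tgt own 0 (hts u) (4 * L * K)) :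
    Stack K L src tgt own hts u
  | step {u : ℕ} (hg : K.gcd u ≠ K) (h : Stack K L src tgt own hts (u - K.gcd u))
    (hs : Segment src tgt own (hts (u - K.gcd u)) (hts u) (4 * L * K.gcd u)) :
    Stack K L src tgt own hts u

variable {K L : ℕ} {src tgt own hts src' tgt' own' hts' : ℕ → ℕ} {b h B u : ℕ}

theorem ownerSources_congr (he : ∀ j < h, src' j = src j ∧ own' j = own j) :
    ownerSources src' own' b h = ownerSources src own b h := by
  ext p
  simp only [ownerSources, Finset.mem_image, Finset.mem_filter, Finset.mem_Ico]
  constructor <;> rintro ⟨j, ⟨hj, h1⟩, h2⟩ <;> obtain ⟨e1, e2⟩ := he j hj.2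
  · exact ⟨j, ⟨hj, by rw [← e2, h1]⟩, by rw [← e1, h2]⟩
  · exact ⟨j, ⟨hj, by rw [e2, h1]⟩, by rw [e1, h2]⟩

theorem card_ownerSources_le {m : ℕ} (hbm : b ≤ m) (hmh : m ≤ h) :
    (ownerSources src own b h).card ≤
      (ownerSources src own b m).card + (ownerSources src own m h).card := by
  rw [ownerSources, ← Finset.Ico_union_Ico_eq_Ico hbm hmh, Finset.filter_union,
    Finset.image_union]
  exact Finset.card_union_le _ _

theorem Segment.congr (hs : Segment src tgt own b h B)
    (he : ∀ j < h, src' j = src j ∧ tgt' j = tgt j ∧ own' j = own j) :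
    Segment src' tgt' own' b h B := by
  refine ⟨hs.le, hs.height, fun i j h1 h2 h3 h4 => ?_, ?_⟩
  · rw [(he i h2).1, (he i h2).2.1, (he j h4).1, (he j h4).2.1]
    exact hs.inj i j h1 h2 h3 h4
  · rw [ownerSources_congr fun j hj => ⟨(he j hj).1, (he j hj).2.2⟩]
    exact hs.owners

theorem Segment.card_recordsTo_le (hs : Segment src tgt own b h B) (z : ℕ) :
    (recordsTo src tgt z h).card ≤ (recordsTo src tgt z b).card + 1 := by
  have hsub : recordsTo src tgt z h ⊆ recordsTo src tgt z b ∪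
      (Finset.Ico b h).filter fun j => tgt j = z ∧ src j ≠ z := by
    intro j
    simp only [recordsTo, Finset.mem_union, Finset.mem_filter, Finset.mem_range, Finset.mem_Ico]
    intro hj
    by_cases hb : j < b
    · exact .inl ⟨hb, hj.2⟩
    · exact .inr ⟨⟨by omega, hj.1⟩, hj.2⟩
  refine (Finset.card_le_card hsub).trans ((Finset.card_union_le _ _).trans
    (Nat.add_le_add_left (Finset.card_le_one.2 fun i hi j hj => ?_) _))
  simp only [Finset.mem_filter, Finset.mem_Ico] at hi hj
  obtain ⟨⟨h1, h2⟩, h3, h4⟩ := hi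
  obtain ⟨⟨h5, h6⟩, h7, h8⟩ := hj
  exact hs.inj i j h1 h2 h5 h6 (by rw [h3, h7]) (by rw [h3]; exact h4) (by rw [h7]; exact h8)

theorem Stack.congr (hs : Stack K L src tgt own hts u)
    (he : ∀ j < hts u, src' j = src j ∧ tgt' j = tgt j ∧ own' j = own j)
    (hh : ∀ v ≤ u, hts' v = hts v) : Stack K L src' tgt' own' hts' u := by
  induction hs with
  | base hg hs =>
    refine .base hg ?_
    rw [hh _ le_rfl]
    exact hs.congr he
  | @step u hg h hs ih =>
    refine .step hg (ih (fun j hj => he j (hj.trans_le hs.le)) fun v hv => hh v (by omega)) ?_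
    rw [hh _ le_rfl, hh _ (by omega)]
    exact hs.congr he

/-- An update other than a multiple of `2 ^ k` goes back to one with a larger power of two. -/
theorem two_mul_gcd_le {k : ℕ} (hg : (2 ^ k).gcd u ≠ 2 ^ k) :
    2 * (2 ^ k).gcd u ≤ (2 ^ k).gcd (u - (2 ^ k).gcd u) := by
  obtain ⟨i, hi, hgi⟩ := (Nat.dvd_prime_pow Nat.prime_two).1 (Nat.gcd_dvd_left (2 ^ k) u)
  have hik : i < k := lt_of_le_of_ne hi fun h => hg (by rw [hgi, h])
  have h2 : 2 * (2 ^ k).gcd u ∣ 2 ^ k := by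
    rw [hgi, ← pow_succ']
    exact pow_dvd_pow 2 hik
  have hpos : 0 < (2 ^ k).gcd u := Nat.gcd_pos_of_pos_left _ (by positivity)
  obtain ⟨m, hm⟩ := Nat.gcd_dvd_right (2 ^ k) u
  -- An even cofactor would make twice the gcd a common divisor. Hence subtracting the gcd leaves an
  -- even multiple of it.
  have hodd : m % 2 = 1 := by
    by_contra hc
    obtain ⟨l, rfl⟩ : 2 ∣ m := by omega
    have : 2 * (2 ^ k).gcd u ∣ (2 ^ k).gcd u :=
      Nat.dvd_gcd h2 ⟨l, hm.trans (by ring)⟩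
    have := Nat.le_of_dvd hpos this
    omega
  refine Nat.le_of_dvd (Nat.gcd_pos_of_pos_left _ (by positivity)) (Nat.dvd_gcd h2 ?_)
  refine ⟨m / 2, ?_⟩
  generalize (2 ^ k).gcd u = c at *
  obtain ⟨l, rfl⟩ : ∃ l, m = 2 * l + 1 := ⟨m / 2, by omega⟩
  rw [hm, show (2 * l + 1) / 2 = l by omega, show c * (2 * l + 1) = 2 * c * l + c by ring]
  simp

/-- A segment has at most `12 * L` times its gcd records, and the gcds at least double downward. The
second summand is the slack that carries the geometric sum through the induction. -/
theorem Stack.height_le {k : ℕ} (hs : Stack (2 ^ k) L src tgt own hts u) :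
    hts u + 12 * L * (2 ^ k).gcd u ≤ 24 * L * 2 ^ k := by
  induction hs with
  | base hg hs =>
    have := hs.height
    rw [hg]
    linarith
  | @step u hg h hs ih =>
    have := hs.height
    have := Nat.mul_le_mul_left (12 * L) (two_mul_gcd_le hg)
    linarith

/-- Each segment adds at most one record that leads to `z`, while the gcd at least halves. -/
theorem Stack.pow_card_recordsTo_le {k : ℕ} (hs : Stack (2 ^ k) L src tgt own hts u) (z : ℕ) :
    2 ^ (recordsTo src tgt z (hts u)).card * (2 ^ k).gcd u ≤ 2 ^ (k + 1) := by
  induction hs with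
  | @base u hg hs =>
    have : (recordsTo src tgt z (hts u)).card ≤ 1 := by
      simpa [recordsTo] using hs.card_recordsTo_le z
    rw [hg, ← pow_add]
    exact Nat.pow_le_pow_right (by omega) (by omega)
  | @step u hg h hs ih =>
    refine le_trans ?_ ih
    refine (Nat.mul_le_mul_right _ (Nat.pow_le_pow_right (by omega)
      (hs.card_recordsTo_le z))).trans ?_
    rw [pow_succ, mul_assoc]
    exact Nat.mul_le_mul_left _ (two_mul_gcd_le hg)

theorem Stack.card_recordsTo_le {k : ℕ} (hs : Stack (2 ^ k) L src tgt own hts u) (z : ℕ) :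
    (recordsTo src tgt z (hts u)).card ≤ k + 1 := by
  have h1 := hs.pow_card_recordsTo_le z
  have h2 : 0 < (2 ^ k).gcd u := Nat.gcd_pos_of_pos_left _ (by positivity)
  exact (Nat.pow_le_pow_iff_right (a := 2) (by omega)).1 ((Nat.le_mul_of_pos_right _ h2).trans h1)

/-- The chain of updates below `u` passes through `w`. The segments above `w` have gcds that sum to
`u - w`, which bounds their owners. -/
theorem Stack.pop {k g w : ℕ} (hs : Stack (2 ^ k) L src tgt own hts u) (hg : g ∣ 2 ^ k)
    (hw : g ∣ w) (hwu : w ≤ u) (huw : u < w + g) :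
    Stack (2 ^ k) L src tgt own hts w ∧ hts w ≤ hts u ∧
      (ownerSources src own (hts w) (hts u)).card ≤ 4 * L * (u - w) := by
  obtain ⟨i, hi, rfl⟩ := (Nat.dvd_prime_pow Nat.prime_two).1 hg
  rcases hwu.eq_or_lt with rfl | hwu
  · exact ⟨hs, le_rfl, by simp [ownerSources]⟩
  have hnd : ¬ 2 ^ i ∣ u := by
    intro hd
    have := Nat.le_of_dvd (by omega) (Nat.dvd_sub hd hw)
    omega
  induction hs with
  | base hg' hs =>
    exact (hnd (hg.trans (hg' ▸ Nat.gcd_dvd_right _ _))).elim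
  | @step u hg' h hs ih =>
    obtain ⟨l, hl, hgl⟩ := (Nat.dvd_prime_pow Nat.prime_two).1 (Nat.gcd_dvd_left (2 ^ k) u)
    have hli : l < i := by
      by_contra hc
      exact hnd ((pow_dvd_pow 2 (by omega)).trans (hgl ▸ Nat.gcd_dvd_right (2 ^ k) u))
    have hpos : 0 < (2 ^ k).gcd u := Nat.gcd_pos_of_pos_left _ (by positivity)
    -- The backward step divides the distance to `w`, so it cannot jump over `w`.
    have hdw : (2 ^ k).gcd u ∣ u - w :=
      Nat.dvd_sub (Nat.gcd_dvd_right _ _) (hgl ▸ (pow_dvd_pow 2 hli.le).trans hw)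
    have hle := Nat.le_of_dvd (by omega) hdw
    have key : Stack (2 ^ k) L src tgt own hts w ∧ hts w ≤ hts (u - (2 ^ k).gcd u) ∧
        (ownerSources src own (hts w) (hts (u - (2 ^ k).gcd u))).card ≤
          4 * L * (u - (2 ^ k).gcd u - w) := by
      rcases (show w ≤ u - (2 ^ k).gcd u by omega).eq_or_lt with he | hlt
      · rw [he]
        exact ⟨h, le_rfl, by simp [ownerSources]⟩
      · have hnd' : ¬ 2 ^ i ∣ u - (2 ^ k).gcd u := by
          intro hd
          have := Nat.le_of_dvd (by omega) (Nat.dvd_sub hd hw)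
          omega
        exact ih (by omega) (by omega) hlt hnd'
    obtain ⟨h1, h2, h3⟩ := key
    refine ⟨h1, h2.trans hs.le, (card_ownerSources_le h2 hs.le).trans
      ((add_le_add h3 hs.owners).trans ?_)⟩
    rw [← Nat.mul_add]
    exact Nat.mul_le_mul_left _ (by omega)

/-- Each of the `k + 1` powers of two contributes itself once per multiple, about `n` in total. -/
theorem sum_gcd_two_pow_le (n k : ℕ) :
    ∑ t ∈ Finset.range n, (2 ^ k).gcd t ≤ (k + 1) * (n + 2 ^ k) := by
  induction k with
  | zero => simp
  | succ k ih =>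
    -- Raising the exponent changes the gcd only at multiples of `2 ^ (k + 1)`.
    have h1 : ∀ t ∈ Finset.range n, (2 ^ (k + 1)).gcd t ≤
        (2 ^ k).gcd t + if t ≡ 0 [MOD 2 ^ (k + 1)] then 2 ^ (k + 1) else 0 := by
      intro t _
      split_ifs with hd
      · exact (Nat.le_of_dvd (by positivity) (Nat.gcd_dvd_left _ _)).trans (by omega)
      · obtain ⟨i, hi, hgi⟩ :=
          (Nat.dvd_prime_pow Nat.prime_two).1 (Nat.gcd_dvd_left (2 ^ (k + 1)) t)
        have hik : i ≠ k + 1 := by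
          rintro rfl
          exact hd ((Nat.modEq_zero_iff_dvd).2 (hgi ▸ Nat.gcd_dvd_right _ t))
        refine le_add_right (Nat.le_of_dvd (Nat.gcd_pos_of_pos_left _ (by positivity))
          (Nat.dvd_gcd ?_ (Nat.gcd_dvd_right _ _)))
        rw [hgi]
        exact pow_dvd_pow 2 (by omega)
    have h2 : ((Finset.range n).filter fun t => t ≡ 0 [MOD 2 ^ (k + 1)]).card * 2 ^ (k + 1) ≤
        n + 2 ^ (k + 1) := by
      rw [← Nat.count_eq_card_filter_range, Nat.count_modEq_card _ (by positivity)]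
      have := Nat.div_mul_le_self n (2 ^ (k + 1))
      split_ifs <;> simp only [add_mul, one_mul, zero_mul] <;> omega
    refine (Finset.sum_le_sum h1).trans ?_
    rw [Finset.sum_add_distrib, ← Finset.sum_filter, Finset.sum_const, smul_eq_mul]
    have h3 : (k + 1) * (n + 2 ^ k) ≤ (k + 1) * (n + 2 ^ (k + 1)) :=
      Nat.mul_le_mul_left _ (Nat.add_le_add_left (Nat.pow_le_pow_right (by omega) (by omega)) _)
    linarith

end Schedule

/-! ### Programs and parameters of an update of the stack -/

/-- `reg 20` becomes the greatest common divisor of `reg 10` and `reg 6`. -/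
def congaGcd : Prog :=
  .block [.copy 20 10, .copy 21 6] ;;
  .loop (.lt 3 21)
    (.block [.div 22 20 21, .mul 22 22 21, .sub 22 20 22, .copy 20 21, .copy 21 22])

/-- Find the height to which the stack is reduced, and whether all sites become owners. -/
def congaBase : Prog :=
  .ite (.eq 20 10) (.block [.const 22 1, .const 23 0])
    (.block [.const 22 0, .sub 23 6 20, .load 23 6 23])

/-- Initialize the flags of the owners and of the visited sites. -/
def congaClear : Prog :=
  .block [.const 24 0] ;;
  .loop (.lt 24 0) (.block [.store 7 24 22, .store 8 24 3, .add 24 24 2])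

/-- Mark the owners. -/
def congaMark : Prog :=
  .block [.store 7 4 2, .store 7 5 2, .const 24 0] ;;
  .loop (.lt 24 11) (.block [.load 25 3 24, .load 26 4 24, .load 27 5 24] ;;
    .ite (.eq 26 4) (.block [.store 7 25 2]) (.ite (.eq 26 5) (.block [.store 7 25 2])
      (.ite (.lt 24 23) .skip (.ite (.eq 27 2) (.block [.store 7 25 2]) .skip))) ;;
    .block [.add 24 24 2])

/-- Read off the cheapest insertion. -/
def congaAnswer : Prog :=
  .ite (.eq 30 2) (.block [.load 40 3 31, .load 41 4 31, .load 42 1 40] ;;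
    .ite (.eq 42 2) (.block [.copy 4 40, .copy 5 41]) (.block [.copy 4 41, .copy 5 40])) .skip

/-- Find the part of the stack to be discarded and the owners of the next path. -/
def congaPrepare : Prog := congaGcd ;; congaBase ;; congaClear ;; congaMark

/-- Replace a part of the stack by a path. -/
def congaPush : Prog := congaPrepare ;; congaPath ;; .block [.store 6 6 11]

/-- Cheapest insertion with a stack of conga lines. -/
def congaUpdate : Prog := congaPush ;; congaFindMin ;; congaAnswer

/-- `reg 10` becomes the period of the stack, a power of two. -/
def congaInit : Prog :=
  .block [.const 12 1, .const 20 1] ;;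
  .loop (.lt 20 0) (.block [.add 20 20 20, .add 12 12 2]) ;;
  .block [.const 10 1, .copy 21 12] ;;
  .loop (.lt 21 0) (.block [.add 21 21 21, .add 10 10 10])

/-- Bound for the number of levels of the stack. -/
def congaLevels (n : ℕ) : ℕ := Nat.clog 2 n + 1

theorem exists_le_two_pow_mul (n : ℕ) : ∃ k, n ≤ 2 ^ k * congaLevels n :=
  ⟨n, Nat.lt_two_pow_self.le.trans (Nat.le_mul_of_pos_right _ (Nat.succ_pos _))⟩

/-- The binary logarithm of the period of the stack. -/
def congaExp (n : ℕ) : ℕ := Nat.find (exists_le_two_pow_mul n)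

theorem le_two_pow_congaExp (n : ℕ) : n ≤ 2 ^ congaExp n * congaLevels n :=
  Nat.find_spec (exists_le_two_pow_mul n)

theorem congaExp_le {n k : ℕ} (h : n ≤ 2 ^ k * congaLevels n) : congaExp n ≤ k :=
  Nat.find_min' (exists_le_two_pow_mul n) h

theorem congaLevels_le (n : ℕ) : congaLevels n ≤ n + 1 :=
  Nat.succ_le_succ (Nat.clog_le_of_le_pow Nat.lt_two_pow_self.le)

theorem congaExp_lt (n : ℕ) : congaExp n + 1 ≤ congaLevels n :=
  Nat.succ_le_succ (congaExp_le ((Nat.le_pow_clog (by omega) n).trans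
    (Nat.le_mul_of_pos_right _ (Nat.succ_pos _))))

/-- By minimality the preceding power is too small, so this one overshoots `n` by less than a factor
of two, unless the exponent is zero. This makes the stack linear in height. -/
theorem two_pow_congaExp_mul_le (n : ℕ) : 2 ^ congaExp n * congaLevels n ≤ 2 * n + 2 := by
  rcases h : congaExp n with _ | k
  · have := congaLevels_le n
    omega
  · have := mt congaExp_le (show ¬ congaExp n ≤ k by omega)
    rw [pow_succ, mul_right_comm]
    omega

theorem two_pow_congaExp_le (n : ℕ) : 2 ^ congaExp n ≤ 2 * n + 2 :=
  (Nat.le_mul_of_pos_right _ (Nat.succ_pos _)).trans (two_pow_congaExp_mul_le n)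

section Conga

variable {R : Type u} [AddCommGroup R] [LinearOrder R] {n : ℕ}

variable {d : Fin n → Fin n → R} {S W : ℕ} {σ : State R}

theorem runs_congaInit (h0 : σ.reg 0 = n) (h2 : σ.reg 2 = 1) (hn : 1 ≤ n) (hW : 2 * n + 2 ≤ W) :
    Runs d S W congaInit (6 * n + 6) σ fun σ' => (∀ r < 10, σ'.reg r = σ.reg r) ∧
      σ'.reg 11 = σ.reg 11 ∧ σ'.mem = σ.mem ∧ σ'.reg 10 = 2 ^ congaExp n := by
  let I : State R → Prop := fun σ' => (∀ r < 12, σ'.reg r = σ.reg r) ∧ σ'.mem = σ.mem ∧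
    ∃ k ≤ Nat.clog 2 n, σ'.reg 20 = 2 ^ k ∧ σ'.reg 12 = k + 1
  let I' : State R → Prop := fun σ' => ((∀ r < 10, σ'.reg r = σ.reg r) ∧
    σ'.reg 11 = σ.reg 11 ∧ σ'.mem = σ.mem) ∧
    ∃ k ≤ congaExp n, σ'.reg 10 = 2 ^ k ∧ σ'.reg 21 = 2 ^ k * congaLevels n
  have hL := congaLevels_le n
  refine Runs.mono (T := 2 + ((3 * n + 1) + (2 + (3 * n + 1)))) (Runs.seq (P := fun σ' => I σ' ∧
    σ'.reg 20 = 1) (Runs.of_wp ?_) ?_) (by omega) fun _ h => h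
  · simp [wp_cons, wp_nil, wpi_const, I]
    exact ⟨by omega, fun r hr => by simp (disch := omega)⟩
  rintro σ₁ ⟨h₁, h20⟩
  refine Runs.seq (P := fun σ' => (∀ r < 12, σ'.reg r = σ.reg r) ∧ σ'.mem = σ.mem ∧
    σ'.reg 12 = congaLevels n) ?_ ?_
  · refine (Runs.loop_measure I (fun σ' => n - σ'.reg 20) 2 ?_ h₁).mono (by omega) ?_
    · rintro σ₂ ⟨hr, hm, k, hk, h20, h12⟩ hb
      rw [holds_lt, hr 0 (by omega), h0, h20] at hb
      have hk' : k < Nat.clog 2 n := (Nat.lt_clog_iff_pow_lt (by omega)).2 hb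
      refine Runs.of_wp ?_
      have hL' : congaLevels n = Nat.clog 2 n + 1 := rfl
      have hpos : 0 < 2 ^ k := by positivity
      simp [wp_cons, wp_nil, wpi_add, I, hr, h20, h12, h2, hm]
      exact ⟨by omega, by omega, ⟨fun r hr' => by simp (disch := omega) [hr r hr'],
        by omega, by rw [pow_succ]; omega⟩, by omega⟩
    · rintro σ₂ ⟨⟨hr, hm, k, hk, h20, h12⟩, hb⟩
      rw [holds_lt, hr 0 (by omega), h0, h20] at hb
      refine ⟨hr, hm, ?_⟩
      rw [h12, congaLevels, le_antisymm hk (Nat.clog_le_of_le_pow (by omega))]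
  rintro σ₂ ⟨hr, hm, h12⟩
  refine Runs.seq (P := I') (Runs.of_wp ?_) fun σ₃ h₃ => ?_
  · simp [wp_cons, wp_nil, wpi_const, wpi_copy, I', hr, hm, h12]
    exact ⟨by omega, by omega, fun r hr' => by simp (disch := omega) [hr r (by omega)],
      0, by omega, rfl, by simp⟩
  refine (Runs.loop_measure I' (fun σ' => n - σ'.reg 21) 2 ?_ h₃).mono (by omega) ?_
  · rintro σ₄ ⟨⟨hr, h11, hm⟩, k, hk, h10, h21⟩ hb
    rw [holds_lt, hr 0 (by omega), h0, h21] at hb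
    have hk' : k < congaExp n := by
      by_contra hc
      have := le_two_pow_congaExp n
      rw [show congaExp n = k by omega] at this
      omega
    have hpos : 0 < 2 ^ k := by positivity
    have hle : 2 ^ k ≤ 2 ^ k * congaLevels n := Nat.le_mul_of_pos_right _ (Nat.succ_pos _)
    refine Runs.of_wp ?_
    simp [wp_cons, wp_nil, wpi_add, I', h10, h21, h11, hm]
    exact ⟨by omega, by omega, ⟨fun r hr' => by simp (disch := omega) [hr r hr'],
      k + 1, by omega, by rw [pow_succ]; omega, by rw [pow_succ, mul_right_comm]; omega⟩,
      by omega⟩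
  · rintro σ₄ ⟨⟨⟨hr, h11, hm⟩, k, hk, h10, h21⟩, hb⟩
    rw [holds_lt, hr 0 (by omega), h0, h21] at hb
    exact ⟨hr, h11, hm, by rw [h10, le_antisymm hk (congaExp_le (by omega))]⟩

/-- Euclid's algorithm with the crude bound of `t` rounds, which suffices since other parts of an
update take linear time anyway. -/
theorem runs_congaGcd {K t : ℕ} (h3 : σ.reg 3 = 0) (h10 : σ.reg 10 = K) (h6 : σ.reg 6 = t)
    (hK : K ≤ W) (ht : t ≤ W) :
    Runs d S W congaGcd (6 * t + 3) σ fun σ' => (∀ r < 20, σ'.reg r = σ.reg r) ∧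
      σ'.mem = σ.mem ∧ σ'.reg 20 = K.gcd t := by
  let I : State R → Prop := fun σ' => ((∀ r < 20, σ'.reg r = σ.reg r) ∧ σ'.mem = σ.mem) ∧
    (σ'.reg 20).gcd (σ'.reg 21) = K.gcd t ∧ σ'.reg 20 ≤ W ∧ σ'.reg 21 ≤ W
  refine Runs.mono (T := 2 + (6 * t + 1)) (Runs.seq (P := fun σ' => I σ' ∧ σ'.reg 21 = t)
    (Runs.of_wp ?_) ?_) (by omega) fun _ h => h
  · simp [wp_cons, wp_nil, wpi_copy, I, h10, h6]
    exact ⟨by omega, by omega, fun r hr => by simp (disch := omega), by omega, by omega⟩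
  rintro σ₁ ⟨h₁, h21⟩
  refine (Runs.loop_measure I (fun σ' => σ'.reg 21) 5 ?_ h₁).mono (by rw [h21]) ?_
  · rintro σ₂ ⟨⟨hr, hm⟩, hg, h20, h21⟩ hb
    rw [holds_lt, hr 3 (by omega), h3] at hb
    have h1 := Nat.div_mul_le_self (σ₂.reg 20) (σ₂.reg 21)
    have h2 := Nat.div_le_self (σ₂.reg 20) (σ₂.reg 21)
    have h4 : σ₂.reg 20 - σ₂.reg 20 / σ₂.reg 21 * σ₂.reg 21 = σ₂.reg 20 % σ₂.reg 21 := by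
      have := Nat.div_add_mod (σ₂.reg 20) (σ₂.reg 21)
      rw [mul_comm] at this
      omega
    have h5 := Nat.mod_lt (σ₂.reg 20) hb
    refine Runs.of_wp ?_
    simp [wp_cons, wp_nil, wpi_div, wpi_mul, wpi_sub, wpi_copy, I, hm, h4]
    refine ⟨by omega, by omega, by omega, by omega, by omega, ⟨fun r hr' => by
      simp (disch := omega) [hr r hr'], ?_, by omega, by omega⟩, h5⟩
    rw [← hg, Nat.gcd_comm, ← Nat.gcd_rec, Nat.gcd_comm]
  · rintro σ₂ ⟨⟨⟨hr, hm⟩, hg, -⟩, hb⟩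
    rw [holds_lt, hr 3 (by omega), h3] at hb
    rw [show σ₂.reg 21 = 0 by omega, Nat.gcd_zero_right] at hg
    exact ⟨hr, hm, hg⟩

/-- The sites marked as owners after the scan of the records below `k`. -/
def Marked (c a x b : ℕ) (src tgt own : ℕ → ℕ) (k p : ℕ) : Prop :=
  c = 1 ∨ p = a ∨ p = x ∨ ∃ j < k, src j = p ∧ (tgt j = a ∨ tgt j = x ∨ (b ≤ j ∧ own j = 1))

theorem marked_succ {c a x b : ℕ} {src tgt own : ℕ → ℕ} {k p : ℕ} :
    Marked c a x b src tgt own (k + 1) p ↔ Marked c a x b src tgt own k p ∨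
      (src k = p ∧ (tgt k = a ∨ tgt k = x ∨ (b ≤ k ∧ own k = 1))) := by
  simp only [Marked, Nat.lt_succ_iff_lt_or_eq, or_and_right, exists_or, exists_eq_left, or_assoc]

theorem runs_congaClear {c : ℕ} (h0 : σ.reg 0 = n) (h2 : σ.reg 2 = 1) (h3 : σ.reg 3 = 0)
    (h22 : σ.reg 22 = c) (hS : n ≤ S) (hW : n ≤ W) :
    Runs d S W congaClear (4 * n + 2) σ fun σ' => (∀ r < 24, σ'.reg r = σ.reg r) ∧
      (∀ a, a ≠ 7 → a ≠ 8 → σ'.mem a = σ.mem a) ∧ ∀ p < n, σ'.mem 7 p = c ∧ σ'.mem 8 p = 0 := by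
  let I : ℕ → State R → Prop := fun k σ' => (σ'.reg 24 = k ∧ σ'.reg 0 = n) ∧
    (∀ r < 24, σ'.reg r = σ.reg r) ∧
    (∀ a, a ≠ 7 → a ≠ 8 → σ'.mem a = σ.mem a) ∧ ∀ p < k, σ'.mem 7 p = c ∧ σ'.mem 8 p = 0
  refine Runs.mono (T := 1 + ((3 + 1) * (n - 0) + 1)) (Runs.seq (P := I 0) (Runs.of_wp ?_)
    fun σ₁ h₁ => (Runs.loop_count I 3 (fun k σ h => h.1) ?_ (Nat.zero_le n) h₁).mono le_rfl
      fun σ h => h.2) (by omega) fun _ h => h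
  · simp [wp_cons, wp_nil, wpi_const, I, h0]
    exact fun r hr => by simp (disch := omega)
  · rintro k σ₁ hk ⟨⟨h24, -⟩, hr, hm, hp⟩
    refine Runs.of_wp ?_
    simp [wp_cons, wp_nil, wpi_store, wpi_add, I, h24, hr, h0, h2, h3, h22]
    refine ⟨by omega, by omega, fun r hr' => by simp (disch := omega) [hr r hr'],
      fun a h7 h8 => by simp [h7, h8, hm a h7 h8], fun p hpk => ?_⟩
    by_cases hpe : p = k
    · simp [hpe]
    · simpa [hpe] using hp p (by omega)

theorem runs_congaMark {c b h : ℕ} (h2 : σ.reg 2 = 1) (h11 : σ.reg 11 = h)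
    (h4 : σ.reg 4 < n) (h5 : σ.reg 5 < n) (h23 : σ.reg 23 = b) (hc : c ≤ 1)
    (hm7 : ∀ p < n, σ.mem 7 p = c)
    (hS : n ≤ S) (hW : n ≤ W) (hhS : h ≤ S) (hhW : h ≤ W) (hsrc : ∀ j < h, σ.mem 3 j < n)
    (htgt : ∀ j < h, σ.mem 4 j < n) (hown : ∀ j < h, σ.mem 5 j ≤ 1) :
    Runs d S W congaMark (10 * h + 4) σ fun σ' => (∀ r < 24, σ'.reg r = σ.reg r) ∧
      (∀ a, a ≠ 7 → σ'.mem a = σ.mem a) ∧ ∀ p < n, σ'.mem 7 p ≤ 1 ∧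
        (σ'.mem 7 p = 1 ↔
          Marked c (σ.reg 4) (σ.reg 5) b (σ.mem 3) (σ.mem 4) (σ.mem 5) h p) := by
  let M : ℕ → ℕ → Prop := Marked c (σ.reg 4) (σ.reg 5) b (σ.mem 3) (σ.mem 4) (σ.mem 5)
  let I : ℕ → State R → Prop := fun k σ' => (σ'.reg 24 = k ∧ σ'.reg 11 = h) ∧
    (∀ r < 24, σ'.reg r = σ.reg r) ∧
    (∀ a, a ≠ 7 → σ'.mem a = σ.mem a) ∧ ∀ p < n, σ'.mem 7 p ≤ 1 ∧ (σ'.mem 7 p = 1 ↔ M k p)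
  refine Runs.mono (T := 3 + ((9 + 1) * (h - 0) + 1)) (Runs.seq (P := I 0) (Runs.of_wp ?_)
    fun σ₁ h₁ => (Runs.loop_count I 9 (fun k σ h => h.1) ?_ (Nat.zero_le h) h₁).mono le_rfl
      fun σ h => h.2) (by omega) fun _ h => h
  · simp [wp_cons, wp_nil, wpi_const, wpi_store, I, M, h11, h2]
    refine ⟨by omega, by omega, fun r hr => by simp (disch := omega),
      fun a ha => by simp [ha], fun p hp => ?_⟩
    have := hm7 p hp
    rw [Function.update_apply, Function.update_apply]
    simp only [Marked, Nat.not_lt_zero, false_and, exists_false, or_false]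
    split_ifs <;> omega
  · rintro k σ₁ hk ⟨⟨h24, -⟩, hr, hm, hp⟩
    have hs := hsrc k hk
    have ht := htgt k hk
    have ho := hown k hk
    have hyes : (σ.mem 4 k = σ.reg 4 ∨ σ.mem 4 k = σ.reg 5 ∨ (b ≤ k ∧ σ.mem 5 k = 1)) →
        ∀ p < n, Function.update (σ₁.mem 7) (σ.mem 3 k) 1 p ≤ 1 ∧
          (Function.update (σ₁.mem 7) (σ.mem 3 k) 1 p = 1 ↔ M (k + 1) p) := by
      intro hy p hpn
      simp only [M, marked_succ, hy, and_true]
      by_cases hpe : p = σ.mem 3 k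
      · simp [hpe]
      · simpa [hpe, Ne.symm hpe] using hp p hpn
    have hno : ¬ (σ.mem 4 k = σ.reg 4 ∨ σ.mem 4 k = σ.reg 5 ∨ (b ≤ k ∧ σ.mem 5 k = 1)) →
        ∀ p < n, σ₁.mem 7 p ≤ 1 ∧ (σ₁.mem 7 p = 1 ↔ M (k + 1) p) := by
      intro hy p hpn
      simp only [M, marked_succ, hy, and_false, or_false]
      exact hp p hpn
    refine Runs.of_wp_le ?_ (by decide)
    simp [wp_cons, wp_nil, wp_seq, wp_ite, wp_skip, wpi_load, wpi_store, wpi_add, holds_eq,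
      holds_lt, I, h24, hr, hm, h2, h11, h23]
    have hframe : ∀ c d e f r : ℕ, r < 24 → Function.update (Function.update (Function.update
        (Function.update σ₁.reg 25 c) 26 d) 27 e) 24 f r = σ.reg r := by
      intro c d e f r hr'
      simp (disch := omega) [hr r hr']
    refine ⟨by omega, by omega, by omega, by omega, by omega, by omega,
      fun e4 => ⟨by omega, by omega, hframe _ _ _ _, fun a ha => by simp [ha, hm a ha],
        hyes (.inl e4)⟩, fun e4 => ⟨fun e5 => ⟨by omega, by omega, hframe _ _ _ _,
        fun a ha => by simp [ha, hm a ha], hyes (.inr (.inl e5))⟩, fun e5 =>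
        ⟨fun hb => ⟨by omega, hframe _ _ _ _, hm, hno (by omega)⟩, fun hb => ⟨fun e1 =>
        ⟨by omega, by omega, hframe _ _ _ _, fun a ha => by simp [ha, hm a ha],
        hyes (by omega)⟩, fun e1 => ⟨by omega, hframe _ _ _ _, hm, hno (by omega)⟩⟩⟩⟩⟩

end Conga

/-- The height to which the stack is reduced by the update number `t`. -/
def congaHeight (K t : ℕ) (hts : ℕ → ℕ) : ℕ :=
  if K.gcd t = K then 0 else hts (t - K.gcd t)

/-- The stack before the update number `t`, of height `h`. -/
def StackBefore (K L : ℕ) (src tgt own hts : ℕ → ℕ) (t h : ℕ) : Prop :=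
  (t = 0 ∧ h = 0) ∨ ∃ u, t = u + 1 ∧ Stack K L src tgt own hts u ∧ h = hts u

/-! ### The stack just before an update -/

section Schedule

variable {k L t h n : ℕ} {src tgt own hts : ℕ → ℕ}

theorem StackBefore.height_le (hs : StackBefore (2 ^ k) L src tgt own hts t h) :
    h ≤ 24 * L * 2 ^ k := by
  rcases hs with ⟨-, rfl⟩ | ⟨u, -, hs, rfl⟩
  · exact Nat.zero_le _
  · have := hs.height_le
    omega

/-- The last update `t - 1` lies less than the gcd above the target, hence the factor `gcd - 1`. The
saved unit leaves room for the other owners. -/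
theorem StackBefore.pop (hs : StackBefore (2 ^ k) L src tgt own hts t h)
    (hg : (2 ^ k).gcd t ≠ 2 ^ k) :
    Stack (2 ^ k) L src tgt own hts (t - (2 ^ k).gcd t) ∧ hts (t - (2 ^ k).gcd t) ≤ h ∧
      (ownerSources src own (hts (t - (2 ^ k).gcd t)) h).card ≤ 4 * L * ((2 ^ k).gcd t - 1) := by
  rcases hs with ⟨rfl, -⟩ | ⟨u, rfl, hs, rfl⟩
  · simp at hg
  · have hpos : 0 < (2 ^ k).gcd (u + 1) := Nat.gcd_pos_of_pos_left _ (by positivity)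
    have hle := Nat.le_of_dvd (by omega) (Nat.gcd_dvd_right (2 ^ k) (u + 1))
    obtain ⟨h1, h2, h3⟩ := hs.pop (w := u + 1 - (2 ^ k).gcd (u + 1))
      (Nat.gcd_dvd_left (2 ^ k) (u + 1))
      (Nat.dvd_sub (Nat.gcd_dvd_right _ _) (dvd_refl _)) (by omega) (by omega)
    refine ⟨h1, h2, h3.trans (Nat.mul_le_mul_left _ (by omega))⟩

theorem StackBefore.congaHeight_le (hs : StackBefore (2 ^ k) L src tgt own hts t h) :
    congaHeight (2 ^ k) t hts ≤ h := by
  unfold congaHeight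
  split_ifs with hg
  · exact Nat.zero_le _
  · exact (hs.pop hg).2.1

/-- Guarantees room for the segment to be pushed. -/
theorem StackBefore.congaHeight_add_le (hs : StackBefore (2 ^ k) L src tgt own hts t h) :
    congaHeight (2 ^ k) t hts + 12 * L * (2 ^ k).gcd t ≤ 24 * L * 2 ^ k := by
  unfold congaHeight
  split_ifs with hg
  · rw [hg]
    linarith [Nat.zero_le (L * 2 ^ k)]
  · have h1 := (hs.pop hg).1.height_le
    have h2 := Nat.mul_le_mul_left (12 * L) (two_mul_gcd_le hg)
    linarith [Nat.zero_le (12 * L * (2 ^ k).gcd t)]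

/-- An update marks few owners. -/
theorem StackBefore.unvisited_le {a x : ℕ} {o vis : ℕ → ℕ}
    (hs : StackBefore (2 ^ k) L src tgt own hts t h) (hk : k + 1 ≤ L) (hn : n ≤ 2 ^ k * L)
    (ho : ∀ p < n, o p = 1 → Marked (if (2 ^ k).gcd t = 2 ^ k then 1 else 0) a x
      (congaHeight (2 ^ k) t hts) src tgt own h p) :
    unvisited n o vis ≤ 4 * L * (2 ^ k).gcd t := by
  by_cases hg : (2 ^ k).gcd t = 2 ^ k
  -- At a rebuild all sites may be owners; the period is large enough to afford this.
  · refine (Finset.card_le_card (Finset.filter_subset _ _)).trans ?_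
    rw [Finset.card_range, hg]
    linarith [Nat.zero_le (L * 2 ^ k)]
  · obtain ⟨-, -, hown⟩ := hs.pop hg
    have hrec : ∀ z, (recordsTo src tgt z h).card ≤ L := by
      rcases hs with ⟨rfl, -⟩ | ⟨u, rfl, hs, rfl⟩
      · simp at hg
      · exact fun z => (hs.card_recordsTo_le z).trans hk
    simp only [hg, congaHeight, if_false] at ho
    have hsub : ((Finset.range n).filter fun p => o p = 1 ∧ vis p = 0) ⊆
        (({a, x} ∪ (recordsTo src tgt a h).image src) ∪ (recordsTo src tgt x h).image src) ∪
          ownerSources src own (hts (t - (2 ^ k).gcd t)) h := by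
      intro p hp
      simp only [Finset.mem_filter, Finset.mem_range] at hp
      simp only [Finset.mem_union, Finset.mem_insert, Finset.mem_singleton, recordsTo,
        ownerSources, Finset.mem_image, Finset.mem_filter, Finset.mem_range, Finset.mem_Ico]
      rcases ho p hp.1 hp.2.1 with h0 | h1 | h2 | ⟨j, hj, rfl, h3 | h3 | h3⟩
      · omega
      · exact .inl (.inl (.inl (.inl h1)))
      · exact .inl (.inl (.inl (.inr h2)))
      · by_cases he : src j = a
        · exact .inl (.inl (.inl (.inl he)))
        · exact .inl (.inl (.inr ⟨j, ⟨hj, h3, he⟩, rfl⟩))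
      · by_cases he : src j = x
        · exact .inl (.inl (.inl (.inr he)))
        · exact .inl (.inr ⟨j, ⟨hj, h3, he⟩, rfl⟩)
      · exact .inr ⟨j, ⟨⟨h3.1, hj⟩, h3.2⟩, rfl⟩
    have h1 := Finset.card_le_card hsub
    have h2 := Finset.card_union_le
      (({a, x} ∪ (recordsTo src tgt a h).image src) ∪ (recordsTo src tgt x h).image src)
      (ownerSources src own (hts (t - (2 ^ k).gcd t)) h)
    have h3 := Finset.card_union_le ({a, x} ∪ (recordsTo src tgt a h).image src)
      ((recordsTo src tgt x h).image src)
    have h4 := Finset.card_union_le {a, x} ((recordsTo src tgt a h).image src)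
    have h5 := Finset.card_le_two (a := a) (b := x)
    have h6 := (Finset.card_image_le (s := recordsTo src tgt a h) (f := src)).trans (hrec a)
    have h7 := (Finset.card_image_le (s := recordsTo src tgt x h) (f := src)).trans (hrec x)
    have hpos : 0 < (2 ^ k).gcd t := Nat.gcd_pos_of_pos_left _ (by positivity)
    obtain ⟨c, hc⟩ : ∃ c, (2 ^ k).gcd t = c + 1 := ⟨_, (Nat.succ_pred_eq_of_pos hpos).symm⟩
    -- The discarded owners use `4 * L * c`; the two changed sites and at most `L` sources for each
    -- fit into the remaining `4 * L`.
    have h8 : 4 * L * (c + 1) = 4 * L * c + 4 * L := by ring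
    rw [hc, Nat.add_sub_cancel] at hown
    rw [unvisited, hc, h8]
    rw [hc] at h1 h2
    omega

end Schedule

/-! ### Correctness of pushing a path -/

section Conga

variable {R : Type u} [AddCommGroup R] [LinearOrder R] {n : ℕ}

variable {d : Fin n → Fin n → R} {S W : ℕ} {σ : State R}

/-- Effect of the preparations for a path. -/
structure Prepared (n K t h : ℕ) (σ σ' : State R) : Prop where
  reg : ∀ r < 20, σ'.reg r = σ.reg r
  mem : ∀ a, a ≠ 7 → a ≠ 8 → σ'.mem a = σ.mem a
  base : σ'.reg 23 = congaHeight K t (σ.mem 6)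
  vis : ∀ p < n, σ'.mem 8 p = 0
  owner_le : ∀ p < n, σ'.mem 7 p ≤ 1
  owner : ∀ p < n, (σ'.mem 7 p = 1 ↔ Marked (if K.gcd t = K then 1 else 0) (σ.reg 4) (σ.reg 5)
    (congaHeight K t (σ.mem 6)) (σ.mem 3) (σ.mem 4) (σ.mem 5) h p)

theorem runs_congaPrepare {K t h : ℕ} (h0 : σ.reg 0 = n) (h2 : σ.reg 2 = 1) (h3 : σ.reg 3 = 0)
    (h4 : σ.reg 4 < n) (h5 : σ.reg 5 < n) (h6 : σ.reg 6 = t) (h10 : σ.reg 10 = K)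
    (h11 : σ.reg 11 = h) (hK : K ≤ W) (ht : t < n) (hS : n ≤ S) (hW : n ≤ W) (hhS : h ≤ S)
    (hhW : h ≤ W) (hsrc : ∀ j < h, σ.mem 3 j < n) (htgt : ∀ j < h, σ.mem 4 j < n)
    (hown : ∀ j < h, σ.mem 5 j ≤ 1) (hbase : congaHeight K t (σ.mem 6) ≤ h) :
    Runs d S W congaPrepare (10 * n + 10 * h + 13) σ (Prepared n K t h σ) := by
  refine Runs.mono (T := (6 * t + 3) + (4 + ((4 * n + 2) + (10 * h + 4)))) (Runs.seq
    (runs_congaGcd h3 h10 h6 hK (by omega)) ?_) (by omega) fun _ h => h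
  rintro σ₁ ⟨hr₁, hm₁, h20⟩
  refine Runs.seq (P := fun σ' => (∀ r < 20, σ'.reg r = σ.reg r) ∧ σ'.mem = σ.mem ∧
    σ'.reg 22 = (if K.gcd t = K then 1 else 0) ∧ σ'.reg 23 = congaHeight K t (σ.mem 6))
    (Runs.of_wp_le ?_ (by decide)) ?_
  · unfold congaHeight at hbase ⊢
    simp [congaBase, wp_cons, wp_nil, wp_ite, wpi_const, wpi_sub, wpi_load, holds_eq, hr₁, hm₁, h20,
      h10, h6]
    refine ⟨fun hg => ⟨by omega, fun r hr => by simp (disch := omega) [hr₁ r hr], by simp [hg],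
      by simp [hg]⟩, fun hg => ?_⟩
    rw [if_neg hg] at hbase
    exact ⟨by omega, by omega, by omega, fun r hr => by simp (disch := omega) [hr₁ r hr],
      by simp [hg], by simp [hg]⟩
  rintro σ₂ ⟨hr₂, hm₂, h22, h23⟩
  refine Runs.seq (runs_congaClear (by rw [hr₂ 0 (by omega), h0]) (by rw [hr₂ 2 (by omega), h2])
    (by rw [hr₂ 3 (by omega), h3]) h22 hS hW) ?_
  rintro σ₃ ⟨hr₃, hm₃, hp₃⟩
  have e3 : σ₃.mem 3 = σ.mem 3 := by rw [hm₃ 3 (by omega) (by omega), hm₂]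
  have e4 : σ₃.mem 4 = σ.mem 4 := by rw [hm₃ 4 (by omega) (by omega), hm₂]
  have e5 : σ₃.mem 5 = σ.mem 5 := by rw [hm₃ 5 (by omega) (by omega), hm₂]
  have hr : ∀ r < 20, σ₃.reg r = σ.reg r := fun r hr => by rw [hr₃ r (by omega), hr₂ r hr]
  refine (runs_congaMark (c := if K.gcd t = K then 1 else 0) (b := congaHeight K t (σ.mem 6))
    (h := h) (by rw [hr 2 (by omega), h2]) (by rw [hr 11 (by omega), h11])
    (by rw [hr 4 (by omega)]; exact h4) (by rw [hr 5 (by omega)]; exact h5)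
    (by rw [hr₃ 23 (by omega), h23]) (by split_ifs <;> omega) (fun p hp => (hp₃ p hp).1) hS hW hhS
    hhW (by rwa [e3]) (by rwa [e4]) (by rwa [e5])).mono le_rfl ?_
  rintro σ₄ ⟨hr₄, hm₄, hp₄⟩
  rw [e3, e4, e5, hr 4 (by omega), hr 5 (by omega)] at hp₄
  exact ⟨fun r hr' => by rw [hr₄ r (by omega), hr r hr'],
    fun a h7 h8 => by rw [hm₄ a h7, hm₃ a h7 h8, hm₂],
    by rw [hr₄ 23 (by omega), hr₃ 23 (by omega), h23],
    fun p hp => by rw [hm₄ 8 (by omega), (hp₃ p hp).2], fun p hp => (hp₄ p hp).1,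
    fun p hp => (hp₄ p hp).2⟩

/-- Pairs of sites that are not owners are still covered after a change of the tour at the sites
`a` and `x`. -/
theorem covered_of_change {g f g' f' : ℕ → ℕ} {a x b h h' c : ℕ}
    {src tgt own src' tgt' own' o : ℕ → ℕ} (hg : ∀ p, g p ≤ 1) (hg' : ∀ p, g' p ≤ 1)
    (hge : ∀ p, p ≠ a → p ≠ x → g' p = g p) (hfe : ∀ p, p ≠ a → p ≠ x → f' p = f p)
    (hcov : ∀ p q, Opp n g p q → Covered d g f 0 h src tgt own p q)
    (hmark : ∀ p < n, Marked c a x b src tgt own h p → o p = 1)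
    (hbh : b ≤ h') (hold : ∀ j < b, src' j = src j ∧ tgt' j = tgt j ∧ own' j = own j)
    (hnew : ∀ p q, Opp n g' p q → o p = 1 ∨ o q = 1 →
      Covered d g' f' b h' src' tgt' own' p q) (p q : ℕ) (hopp : Opp n g' p q) :
    Covered d g' f' 0 h' src' tgt' own' p q := by
  by_cases ho : o p = 1 ∨ o q = 1
  · obtain ⟨i, hi, j, hj, -, h⟩ := hnew p q hopp ho
    exact ⟨i, hi, j, hj, Nat.zero_le _, h⟩
  have hopp' := (opp_iff hg').1 hopp
  have hne : ∀ z, z = p ∨ z = q → z < n ∧ ¬ Marked c a x b src tgt own h z := by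
    rintro z (rfl | rfl)
    · exact ⟨hopp'.1, fun hm => ho (.inl (hmark _ hopp'.1 hm))⟩
    · exact ⟨hopp'.2.1, fun hm => ho (.inr (hmark _ hopp'.2.1 hm))⟩
  have hax : ∀ z, z = p ∨ z = q → z ≠ a ∧ z ≠ x := fun z hz =>
    ⟨fun h => (hne z hz).2 (.inr (.inl h)), fun h => (hne z hz).2 (.inr (.inr (.inl h)))⟩
  have hcost : ∀ z y, z ≠ a → z ≠ x → y ≠ a → y ≠ x →
      pairCost d g' f' z y = pairCost d g f z y := by
    intro z y h1 h2 h3 h4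
    simp only [pairCost, insCost, hge z h1 h2, hfe z h1 h2, hfe y h3 h4]
  obtain ⟨hp1, hp2⟩ := hax p (.inl rfl)
  obtain ⟨hq1, hq2⟩ := hax q (.inr rfl)
  have hopp₀ : Opp n g p q := by
    rw [opp_iff hg, ← hge p hp1 hp2, ← hge q hq1 hq2]
    exact hopp'
  obtain ⟨i, hi, j, hj, -, hio, hsi, hsj, hoj, hle⟩ := hcov p q hopp₀
  -- Otherwise the owner record `i` would be discarded and its source, `p` or `q`, marked again. So
  -- `i` survives, and with it `j ≤ i`; this is why `Covered` asks for that order.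
  have hib : i < b := by
    by_contra hc
    exact (hne _ hsi).2 (.inr (.inr (.inr ⟨i, hi, rfl, .inr (.inr ⟨by omega, hio⟩)⟩)))
  -- Sources of records that lead to a changed site are marked, so the record `j` keeps its cost.
  have htj : tgt j ≠ a ∧ tgt j ≠ x :=
    ⟨fun h => (hne _ hsj).2 (.inr (.inr (.inr ⟨j, by omega, rfl, .inl h⟩))),
      fun h => (hne _ hsj).2 (.inr (.inr (.inr ⟨j, by omega, rfl, .inr (.inl h)⟩)))⟩
  obtain ⟨e1, -, e3⟩ := hold i hib
  obtain ⟨e4, e5, -⟩ := hold j (by omega)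
  obtain ⟨hs1, hs2⟩ := hax _ hsj
  refine ⟨i, by omega, j, hj, Nat.zero_le _, by rw [e3, hio], by rwa [e1], by rwa [e4], ?_, ?_⟩
  · rw [e4, e5, opp_iff hg', hge _ hs1 hs2, hge _ htj.1 htj.2]
    exact (opp_iff hg).1 hoj
  · rw [e4, e5, hcost _ _ hs1 hs2 htj.1 htj.2, hcost _ _ hp1 hp2 hq1 hq2]
    exact hle

/-- The invariant of the stack of conga lines. -/
structure CongaInv (d : Fin n → Fin n → R) (t : ℕ) (g f : ℕ → ℕ) (σ : State R) : Prop where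
  flag_le : ∀ p, g p ≤ 1
  period : σ.reg 10 = 2 ^ congaExp n
  record : ∀ j < σ.reg 11, σ.mem 3 j < n ∧ σ.mem 4 j < n ∧ σ.mem 5 j ≤ 1
  stack : StackBefore (2 ^ congaExp n) (congaLevels n) (σ.mem 3) (σ.mem 4) (σ.mem 5) (σ.mem 6) t
    (σ.reg 11)
  covered : ∀ p q, Opp n g p q →
    Covered d g f 0 (σ.reg 11) (σ.mem 3) (σ.mem 4) (σ.mem 5) p q

theorem CongaInv.congr {t : ℕ} {g f : ℕ → ℕ} {σ' : State R} (h : CongaInv d t g f σ)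
    (hr : ∀ r, 10 ≤ r → r < 20 → σ'.reg r = σ.reg r) (hm : ∀ a, 3 ≤ a → σ'.mem a = σ.mem a) :
    CongaInv d t g f σ' := by
  obtain ⟨h1, h2, h3, h4, h5⟩ := h
  have e10 := hr 10 (by omega) (by omega)
  have e11 := hr 11 (by omega) (by omega)
  have e3 := hm 3 (by omega)
  have e4 := hm 4 (by omega)
  have e5 := hm 5 (by omega)
  have e6 := hm 6 (by omega)
  constructor
  · exact h1
  · rwa [e10]
  · rwa [e11, e3, e4, e5]
  · rwa [e11, e3, e4, e5, e6]
  · rwa [e11, e3, e4, e5]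

/-- The path that was pushed is a segment of the stack. -/
theorem PathInv.segment {g f o : ℕ → ℕ} {b N h hv go cur B : ℕ}
    {src₀ tgt₀ own₀ src tgt own vis : ℕ → ℕ}
    (hi : PathInv d g f o b N src₀ tgt₀ own₀ src tgt own vis h hv go cur)
    (hN : N ≤ B) (ho : ((Finset.range n).filter fun p => o p = 1).card ≤ N) :
    Segment src tgt own b h B := by
  refine ⟨hi.le, by have := hi.bound; omega, hi.inj,
    (Finset.card_le_card fun p hp => ?_).trans (ho.trans hN)⟩
  simp only [ownerSources, Finset.mem_image, Finset.mem_filter, Finset.mem_Ico] at hp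
  obtain ⟨j, ⟨⟨h1, h2⟩, h3⟩, rfl⟩ := hp
  obtain ⟨h4, -, h5⟩ := hi.record j h1 h2
  simp only [Finset.mem_filter, Finset.mem_range]
  exact ⟨h4, by rw [← h5, h3]⟩

theorem unvisited_eq {o vis : ℕ → ℕ} (hv : ∀ p < n, vis p = 0) :
    unvisited n o vis = ((Finset.range n).filter fun p => o p = 1).card := by
  unfold unvisited
  congr 1
  refine Finset.filter_congr fun p hp => ?_
  simp [hv p (Finset.mem_range.1 hp)]

/-- What remains is the stack of an earlier update, whose records and heights are untouched; the
path becomes its top segment. -/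
theorem Stack.push {k L t b h : ℕ} {src tgt own hts src' tgt' own' : ℕ → ℕ} {h₀ : ℕ}
    (hs : StackBefore (2 ^ k) L src tgt own hts t h₀) (hb : b = congaHeight (2 ^ k) t hts)
    (hold : ∀ j < b, src' j = src j ∧ tgt' j = tgt j ∧ own' j = own j)
    (hseg : Segment src' tgt' own' b h (4 * L * (2 ^ k).gcd t)) :
    Stack (2 ^ k) L src' tgt' own' (Function.update hts t h) t := by
  subst hb
  unfold congaHeight at hold hseg
  by_cases hg : (2 ^ k).gcd t = 2 ^ k
  · rw [if_pos hg, hg] at hseg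
    exact .base hg (by simpa using hseg)
  · rw [if_neg hg] at hseg hold
    have hpos : 0 < (2 ^ k).gcd t := Nat.gcd_pos_of_pos_left _ (by positivity)
    have ht : 0 < t := by
      rcases Nat.eq_zero_or_pos t with rfl | h
      · simp at hg
      · exact h
    have hne : ∀ v ≤ t - (2 ^ k).gcd t, Function.update hts t h v = hts v := fun v hv =>
      Function.update_of_ne (by omega) _ _
    refine .step hg ((hs.pop hg).1.congr hold hne) ?_
    rw [hne _ le_rfl, Function.update_self]
    exact hseg

end Conga

/-- Bound for the time of the update number `t`. -/
def congaTime (n t : ℕ) : ℕ :=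
  (26 * n + 14) * (12 * congaLevels n * (2 ^ congaExp n).gcd t + 1) +
    31 * (24 * congaLevels n * 2 ^ congaExp n) + 10 * n + 40

/-! ### Time and correctness of an update of the stack -/

section Conga

variable {R : Type u} [AddCommGroup R] [LinearOrder R] {n : ℕ}

variable {d : Fin n → Fin n → R} {S W : ℕ} {σ : State R}

theorem conga_space (n : ℕ) : 24 * congaLevels n * 2 ^ congaExp n ≤ 48 * (n + 1) := by
  have := two_pow_congaExp_mul_le n
  linarith

theorem runs_congaPush {t : ℕ} {g f : ℕ → ℕ} (ht : t < n) (hJ : CongaInv d t g f σ)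
    (hr : Ready n t g f σ) (hS : 48 * (n + 1) ≤ S) (hW : 48 * (n + 1) ≤ W) :
    Runs d S W congaPush ((26 * n + 14) * (12 * congaLevels n * (2 ^ congaExp n).gcd t + 1) +
      10 * (24 * congaLevels n * 2 ^ congaExp n) + 10 * n + 18) σ fun σ' =>
      CongaInv d (t + 1) (σ.mem 1) (σ.mem 2) σ' ∧ (∀ r < 7, σ'.reg r = σ.reg r) ∧
        ∀ a < 3, σ'.mem a = σ.mem a := by
  have hsp := conga_space n
  have hK := two_pow_congaExp_le n
  have hh := hJ.stack.height_le
  have hb := hJ.stack.congaHeight_le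
  have hb' := hJ.stack.congaHeight_add_le
  have hk := congaExp_lt n
  have hn := le_two_pow_congaExp n
  set k := congaExp n
  set L := congaLevels n
  set b := congaHeight (2 ^ k) t (σ.mem 6) with hbdef
  refine Runs.mono (T := (10 * n + 10 * σ.reg 11 + 13) +
    (((26 * n + 14) * (12 * L * (2 ^ k).gcd t + 1) + 4) + 1)) (Runs.seq
    (runs_congaPrepare hr.reg_zero hr.reg_two hr.reg_three hr.reg_four hr.reg_five hr.reg_six
      hJ.period rfl (hK.trans (by omega)) ht (by omega) (by omega) (by omega) (by omega)
      (fun j hj => (hJ.record j hj).1) (fun j hj => (hJ.record j hj).2.1)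
      (fun j hj => (hJ.record j hj).2.2) hb) ?_) (by omega) fun _ h => h
  intro σ₁ h₁
  have hN : unvisited n (σ₁.mem 7) (σ₁.mem 8) ≤ 4 * L * (2 ^ k).gcd t :=
    hJ.stack.unvisited_le hk hn fun p hp hm => (h₁.owner p hp).1 hm
  have e1 : σ₁.mem 1 = σ.mem 1 := h₁.mem 1 (by omega) (by omega)
  have e2 : σ₁.mem 2 = σ.mem 2 := h₁.mem 2 (by omega) (by omega)
  have e3 : σ₁.mem 3 = σ.mem 3 := h₁.mem 3 (by omega) (by omega)
  have e4 : σ₁.mem 4 = σ.mem 4 := h₁.mem 4 (by omega) (by omega)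
  have e5 : σ₁.mem 5 = σ.mem 5 := h₁.mem 5 (by omega) (by omega)
  have e6 : σ₁.mem 6 = σ.mem 6 := h₁.mem 6 (by omega) (by omega)
  have hN3 : 3 * unvisited n (σ₁.mem 7) (σ₁.mem 8) ≤ 12 * L * (2 ^ k).gcd t := by linarith
  have henv : PathEnv n S W b (unvisited n (σ₁.mem 7) (σ₁.mem 8)) σ₁ :=
    ⟨by rw [h₁.reg 0 (by omega), hr.reg_zero], by rw [h₁.reg 2 (by omega), hr.reg_two],
      by rw [h₁.reg 3 (by omega), hr.reg_three], by rw [e1]; exact hr.flag_le,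
      by rw [e2]; exact hr.next_lt, h₁.owner_le, by omega, by omega, by omega, by omega, by omega⟩
  refine Runs.seq ((runs_congaPath rfl henv h₁.base h₁.vis).mono
    (Nat.add_le_add_right (Nat.mul_le_mul_left _ (by omega)) _) fun _ h => h) ?_
  rintro σ₂ ⟨h₂, h25⟩
  have hinv := h₂.inv
  rw [h25, e1, e2, e3, e4, e5] at hinv
  have hbound := hinv.bound
  have hreg : ∀ r < 20, r ≠ 11 → σ₂.reg r = σ.reg r := fun r hr hr' => by
    rw [h₂.reg r (by omega) hr', h₁.reg r hr]
  have m6 : σ₂.mem 6 = σ.mem 6 := by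
    rw [h₂.mem 6 (by omega) (by omega) (by omega) (by omega), e6]
  refine Runs.of_wp ?_
  simp only [wp_cons, wp_nil, wpi_store, hreg 6 (by omega) (by omega), hr.reg_six, m6]
  refine ⟨by omega, ⟨hr.flag_le, ?_, ?_, ?_, ?_⟩, fun r hr => hreg r (by omega) (by omega),
    fun a ha => ?_⟩
  · simpa using (hreg 10 (by omega) (by omega)).trans hJ.period
  · intro j hj
    simp only [ne_eq, OfNat.ofNat_eq_ofNat, Nat.reduceEqDiff, not_false_eq_true,
      Function.update_of_ne] at hj ⊢
    by_cases hjb : j < b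
    · obtain ⟨o1, o2, o3⟩ := hinv.old j hjb
      rw [o1, o2, o3]
      exact hJ.record j (by omega)
    · obtain ⟨o1, o2, o3⟩ := hinv.record j (by omega) hj
      rw [o3]
      exact ⟨o1, o2, h₁.owner_le _ o1⟩
  · refine .inr ⟨t, rfl, ?_, by simp⟩
    simp only [ne_eq, OfNat.ofNat_eq_ofNat, Nat.reduceEqDiff, not_false_eq_true,
      Function.update_of_ne, Function.update_self]
    exact Stack.push hJ.stack rfl hinv.old (hinv.segment hN (unvisited_eq h₁.vis).ge)
  · simp only [ne_eq, OfNat.ofNat_eq_ofNat, Nat.reduceEqDiff, not_false_eq_true,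
      Function.update_of_ne]
    exact covered_of_change hJ.flag_le hr.flag_le hr.flag_eq hr.next_eq hJ.covered
      (fun p hp hm => (h₁.owner p hp).2 hm) hinv.le hinv.old fun p q hopp ho =>
        hinv.covered hopp ho
  · rw [Function.update_of_ne (by omega), h₂.mem a (by omega) (by omega) (by omega) (by omega),
      h₁.mem a (by omega) (by omega)]

theorem runs_congaAnswer {g f : ℕ → ℕ} {h : ℕ} (h2 : σ.reg 2 = 1) (hm1 : σ.mem 1 = g)
    (hg : ∀ p, g p ≤ 1) (hS : n ≤ S) (hW : n ≤ W) (hhS : h ≤ S) (hn : 1 ≤ n)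
    (hb : IsBest (fun j => j < h ∧ Opp n g (σ.mem 3 j) (σ.mem 4 j))
      (fun j => pairCost d g f (σ.mem 3 j) (σ.mem 4 j)) (σ.reg 30) (σ.reg 31) (σ.dreg 2)) :
    Runs d S W congaAnswer 7 σ fun σ' => (∀ r < 30, r ≠ 4 → r ≠ 5 → σ'.reg r = σ.reg r) ∧
      σ'.mem = σ.mem ∧ σ'.dmem = σ.dmem ∧ (σ.reg 30 = 1 →
        Valid n g (σ'.reg 4) (σ'.reg 5) ∧
          insCost d f (σ'.reg 4) (σ'.reg 5) =
            pairCost d g f (σ.mem 3 (σ.reg 31)) (σ.mem 4 (σ.reg 31))) := by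
  refine Runs.of_wp_le ?_ (by decide)
  rcases hb with ⟨h30, ⟨hj, hopp⟩, -, -⟩ | ⟨h30, -⟩
  · obtain ⟨hs, ht, hne⟩ := (opp_iff hg).1 hopp
    have hgs := hg (σ.mem 3 (σ.reg 31))
    have hgt := hg (σ.mem 4 (σ.reg 31))
    simp [congaAnswer, wp_cons, wp_nil, wp_seq, wp_ite, wp_skip, wpi_load, wpi_copy, holds_eq, h30,
      h2, hm1]
    refine ⟨by omega, by omega, by omega, by omega, by omega, by omega, fun h1 => ⟨by omega, by omega,
      fun r hr h4 h5 => by simp (disch := omega) [h4, h5], ⟨⟨hs, ht⟩, h1, by omega⟩,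
      by simp [pairCost, h1]⟩, fun h1 => ⟨by omega, by omega,
      fun r hr h4 h5 => by simp (disch := omega) [h4, h5], ⟨⟨ht, hs⟩, by omega, by omega⟩,
      by simp [pairCost, h1]⟩⟩
  · simp [congaAnswer, wp_ite, wp_skip, holds_eq, h30, h2]

/-- Every valid pair is covered by a record that is at most as expensive, and every record of
opposite sites is itself a possible insertion. So the cheapest such record is a cheapest insertion.
-/
theorem runs_congaUpdate {t : ℕ} {g f : ℕ → ℕ} (ht : t < n) (hJ : CongaInv d t g f σ)
    (hr : Ready n t g f σ) (hS : 48 * (n + 1) ≤ S) (hW : 48 * (n + 1) ≤ W) :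
    Runs d S W congaUpdate (congaTime n t) σ fun σ' =>
      CongaInv d (t + 1) (σ.mem 1) (σ.mem 2) σ' ∧ Keeps σ σ' ∧
      ((∃ p q, Valid n (σ.mem 1) p q) →
        MinPair d (σ.mem 1) (σ.mem 2) (σ'.reg 4) (σ'.reg 5)) := by
  refine (Runs.seq (T' := 21 * (24 * congaLevels n * 2 ^ congaExp n) + 10)
    (runs_congaPush ht hJ hr hS hW) ?_).mono (by unfold congaTime; omega) fun _ h => h
  rintro σ₁ ⟨h₁, hr₁, hm₁⟩
  have hh := h₁.stack.height_le
  have hsp := conga_space n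
  have e1 := hm₁ 1 (by omega)
  have e2 := hm₁ 2 (by omega)
  refine Runs.mono (T := (21 * σ₁.reg 11 + 3) + 7) (Runs.seq (runs_congaFindMin
    (by rw [hr₁ 2 (by omega), hr.reg_two]) rfl (by omega) (by omega) (by omega) (by omega)
    (by omega) (fun j hj => (h₁.record j hj).1) (fun j hj => (h₁.record j hj).2.1) e1 e2 hr.flag_le
    hr.next_lt) ?_) (by omega) fun _ h => h
  intro σ₂ h₂
  have hbest := h₂.best
  rw [← h₂.mem] at hbest
  refine (runs_congaAnswer (f := σ.mem 2) (g := σ.mem 1) (h := σ₁.reg 11)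
    (by rw [h₂.reg 2 (by omega), hr₁ 2 (by omega), hr.reg_two]) (by rw [h₂.mem, e1]) hr.flag_le
    (by omega) (by omega) (by omega) (by omega) hbest).mono le_rfl ?_
  rintro σ₃ ⟨hr₃, hm₃, hd₃, hans⟩
  have hreg : ∀ r < 29, r ≠ 4 → r ≠ 5 → σ₃.reg r = σ₁.reg r := fun r hr h4 h5 => by
    rw [hr₃ r (by omega) h4 h5, h₂.reg r hr]
  have hmem : σ₃.mem = σ₁.mem := by rw [hm₃, h₂.mem]
  refine ⟨h₁.congr (fun r h10 h20 => hreg r (by omega) (by omega) (by omega))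
    fun a ha => by rw [hmem], ⟨fun r h7 h4 h5 => by rw [hreg r (by omega) h4 h5, hr₁ r h7],
    fun a ha => by rw [hmem, hm₁ a ha]⟩, ?_⟩
  have hcover : ∀ p q, Valid n (σ.mem 1) p q → ∃ j < σ₁.reg 11,
      Opp n (σ.mem 1) (σ₂.mem 3 j) (σ₂.mem 4 j) ∧
      pairCost d (σ.mem 1) (σ.mem 2) (σ₂.mem 3 j) (σ₂.mem 4 j) ≤ insCost d (σ.mem 2) p q := by
    intro p q hv
    obtain ⟨i, hi, j, hj, -, -, -, -, ho, hle⟩ := h₁.covered p q (.inl hv)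
    rw [h₂.mem]
    refine ⟨j, by omega, ho, ?_⟩
    exact hle.trans_eq (if_pos hv.2.1)
  rintro ⟨p, q, hv⟩
  rcases hbest with ⟨h30, -, -, hmin⟩ | ⟨-, hno⟩
  · obtain ⟨hvalid, hcost⟩ := hans h30
    refine ⟨hvalid, fun p q hv => ?_⟩
    obtain ⟨j, hj, ho, hle⟩ := hcover p q hv
    rw [hcost]
    exact (hmin j ⟨hj, ho⟩).trans hle
  · obtain ⟨j, hj, ho, -⟩ := hcover p q hv
    exact (hno j ⟨hj, ho⟩).elim

theorem maintains_conga (hn : 1 ≤ n) (hS : 48 * (n + 1) ≤ S) (hW : 48 * (n + 1) ≤ W) :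
    Maintains d S W congaInit congaUpdate (6 * n + 6) (congaTime n) (CongaInv d) where
  congr h hr hm _ := h.congr hr hm
  init σ h0 h2 hr hm := by
    refine (runs_congaInit h0 h2 hn (by omega)).mono le_rfl ?_
    rintro σ' ⟨hr', h11, hm', h10⟩
    rw [hr 11 (by omega)] at h11
    refine ⟨⟨fun _ => Nat.zero_le _, h10, fun j hj => by omega, .inl ⟨rfl, h11⟩, fun p q hopp => ?_⟩,
      ⟨fun r hr _ _ => hr' r (by omega), fun a _ => by rw [hm']⟩, hr' 4 (by omega),
      hr' 5 (by omega)⟩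
    exact absurd rfl ((opp_iff fun _ => Nat.zero_le _).1 hopp).2.2
  update t g f σ ht hJ hr := runs_congaUpdate ht hJ hr hS hW

/-- The dominant term is `n * L` times the sum of the gcds, and that sum is `O(n * L)`. -/
theorem sum_congaTime_le (n : ℕ) (hn : 1 ≤ n) :
    6 * n + 6 + ∑ t ∈ Finset.range n, (congaTime n t + 10) + 10 ≤
      10000 * (n * congaLevels n) ^ 2 := by
  have h1 := two_pow_congaExp_le n
  have h2 := two_pow_congaExp_mul_le n
  have h3 := congaExp_lt n
  have h4 := sum_gcd_two_pow_le n (congaExp n)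
  have hsum : ∑ t ∈ Finset.range n, (congaTime n t + 10) =
      (26 * n + 14) * (12 * congaLevels n * ∑ t ∈ Finset.range n, (2 ^ congaExp n).gcd t + n) +
        n * (31 * (24 * congaLevels n * 2 ^ congaExp n) + 10 * n + 50) := by
    simp only [congaTime, Finset.sum_add_distrib, ← Finset.mul_sum, Finset.sum_const,
      Finset.card_range, smul_eq_mul]
    ring
  rw [hsum]
  set L := congaLevels n
  set s := ∑ t ∈ Finset.range n, (2 ^ congaExp n).gcd t
  have hL : 1 ≤ L := by omega
  -- Here `2 ^ congaExp n ≤ 2 * n + 2 ≤ 4 * n`.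
  have hs : s ≤ 5 * (n * L) := by
    refine h4.trans ((Nat.mul_le_mul h3 (show n + 2 ^ congaExp n ≤ 5 * n by omega)).trans ?_)
    linarith
  have hnL : n ≤ n * L := Nat.le_mul_of_pos_right _ hL
  have hLs : L * s ≤ 5 * (n * L * L) := by nlinarith
  have hnL' : n * L ≤ n * L * L := Nat.le_mul_of_pos_right _ hL
  have a1 : (26 * n + 14) * (12 * L * s + n) ≤ 40 * n * (61 * (n * L * L)) :=
    Nat.mul_le_mul (by omega) (by rw [mul_assoc]; omega)
  have a2 : n * (31 * (24 * L * 2 ^ congaExp n) + 10 * n + 50) ≤ n * (4000 * (n * L * L)) := by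
    refine Nat.mul_le_mul_left _ ?_
    have : 24 * L * 2 ^ congaExp n ≤ 96 * n := by nlinarith
    omega
  have a3 : n * (n * L * L) = (n * L) ^ 2 := by ring
  have a4 : n ≤ (n * L) ^ 2 := by rw [← a3]; nlinarith
  nlinarith

end Conga

/-! ### Asymptotic bounds -/

theorem congaLevels_le_log {n : ℕ} (hn : 2 ≤ n) : (congaLevels n : ℝ) ≤ 6 * Real.log n := by
  have h1 := Nat.pow_pred_clog_lt_self (b := 2) (by omega) (show 1 < n by omega)
  have h2 : ((Nat.clog 2 n - 1 : ℕ) : ℝ) * Real.log 2 ≤ Real.log n := by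
    rw [← Real.log_pow]
    exact Real.log_le_log (by positivity) (by exact_mod_cast h1.le)
  have h3 : Real.log 2 ≤ Real.log n := Real.log_le_log (by norm_num) (by exact_mod_cast hn)
  have h4 : (1 / 2 : ℝ) ≤ Real.log 2 := by linarith [Real.log_two_gt_d9]
  -- With `1 / 2 ≤ Real.log 2`, the first summand is at most `2 * Real.log n` and the second at most
  -- `4 * Real.log n`.
  have h5 : (congaLevels n : ℝ) ≤ (Nat.clog 2 n - 1 : ℕ) + 2 := by
    unfold congaLevels
    exact_mod_cast (show Nat.clog 2 n + 1 ≤ Nat.clog 2 n - 1 + 2 by omega)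
  have h6 : (0 : ℝ) ≤ (Nat.clog 2 n - 1 : ℕ) := Nat.cast_nonneg _
  nlinarith

theorem isBigO_of_natCast_le {u : ℕ → ℕ} {v : ℕ → ℝ} (C : ℝ)
    (h : ∀ n, 2 ≤ n → (u n : ℝ) ≤ C * v n) (hv : ∀ n, 0 ≤ v n) :
    (fun n => (u n : ℝ)) =O[atTop] v := by
  refine IsBigO.of_bound C ((eventually_ge_atTop 2).mono fun n hn => ?_)
  rw [Real.norm_of_nonneg (Nat.cast_nonneg _), Real.norm_of_nonneg (hv n)]
  exact h n hn

theorem two_pow_clog_le {n : ℕ} (hn : 1 ≤ n) : 2 ^ Nat.clog 2 n ≤ 2 * n := by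
  rcases hn.eq_or_lt with rfl | hn
  · simp
  · have h1 := Nat.pow_pred_clog_lt_self (b := 2) (by omega) hn
    obtain ⟨k, hk⟩ : ∃ k, Nat.clog 2 n = k + 1 :=
      ⟨_, (Nat.succ_pred_eq_of_pos (Nat.clog_pos (by omega) hn)).symm⟩
    rw [hk] at h1 ⊢
    rw [Nat.pred_succ] at h1
    rw [pow_succ]
    omega

/-- Cheapest insertion in quadratic time. -/
theorem exists_implements_quadratic : ∃ (P : Prog) (T S W : ℕ → ℕ), Implements.{u} P T S W ∧
    PolyBounded W ∧ (fun n => (T n : ℝ)) =O[atTop] (fun n : ℕ => (n : ℝ) ^ 2) := by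
  refine ⟨driver pyrInit pyrUpdate, fun n => 1000 * n ^ 2, fun n => 16 * (n + 1) ^ 2,
    fun n => 16 * (n + 1) ^ 2, ?_, ⟨2, ?_⟩, ?_⟩
  · refine implements_driver (T := fun n => 2 * n + 3)
      (T' := fun n _ => 432 * 2 ^ Nat.clog 2 n + 10) (fun n => by nlinarith)
      (fun n _ => by nlinarith) (fun n hn => ?_) fun R _ _ n d hn => ?_
    · have h := Nat.mul_le_mul_left n (two_pow_clog_le hn)
      rw [Finset.sum_const, Finset.card_range, smul_eq_mul]
      nlinarith
    · have h := two_pow_clog_le hn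
      have h' : 2 ^ (Nat.clog 2 n + 1) * 2 ^ (Nat.clog 2 n + 1) ≤ 16 * (n + 1) ^ 2 :=
        (Nat.mul_le_mul (show 2 ^ (Nat.clog 2 n + 1) ≤ 4 * n by rw [pow_succ]; omega)
          (show 2 ^ (Nat.clog 2 n + 1) ≤ 4 * n by rw [pow_succ]; omega)).trans (by nlinarith)
      exact ⟨_, maintains_pyramid hn h' h'⟩
  · refine isBigO_of_natCast_le 64 (fun n hn => ?_) fun n => by positivity
    have : (2 : ℝ) ≤ n := by exact_mod_cast hn
    push_cast
    nlinarith
  · exact isBigO_of_natCast_le 1000 (fun n hn => by push_cast; exact le_rfl) fun n => by positivity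

/-- Cheapest insertion in linear space. -/
theorem exists_implements_linear_space : ∃ (P : Prog) (T S W : ℕ → ℕ), Implements.{u} P T S W ∧
    PolyBounded W ∧
    (fun n => (T n : ℝ)) =O[atTop] (fun n : ℕ => (n : ℝ) ^ 2 * Real.log (n : ℝ) ^ 2) ∧
    (fun n => (S n : ℝ)) =O[atTop] (fun n : ℕ => (n : ℝ)) := by
  refine ⟨driver congaInit congaUpdate, fun n => 10000 * (n * congaLevels n) ^ 2,
    fun n => 48 * (n + 1), fun n => 48 * (n + 1), ?_, ⟨1, ?_⟩, ?_, ?_⟩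
  · exact implements_driver (T := fun n => 6 * n + 6) (T' := congaTime) (fun n => by omega)
      (fun n _ => by omega) (fun n hn => sum_congaTime_le n hn)
      fun R _ _ n d hn => ⟨_, maintains_conga hn le_rfl le_rfl⟩
  · refine isBigO_of_natCast_le 96 (fun n hn => ?_) fun n => by positivity
    have : (2 : ℝ) ≤ n := by exact_mod_cast hn
    push_cast
    linarith
  -- The constant is `10000 * 6 ^ 2`.
  · refine isBigO_of_natCast_le 360000 (fun n hn => ?_) fun n => by positivity
    have h := pow_le_pow_left₀ (Nat.cast_nonneg _) (congaLevels_le_log hn) 2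
    push_cast
    have := mul_le_mul_of_nonneg_left h (show (0 : ℝ) ≤ 10000 * (n : ℝ) ^ 2 by positivity)
    linarith
  · refine isBigO_of_natCast_le 96 (fun n hn => ?_) fun n => Nat.cast_nonneg n
    have : (2 : ℝ) ≤ n := by exact_mod_cast hn
    push_cast
    linarith

end CheapestInsertion

theorem mainTheorem5 :
    (∃ (P : CheapestInsertion.Prog) (T S W : ℕ → ℕ),
      CheapestInsertion.Implements.{u} P T S W ∧
      CheapestInsertion.PolyBounded W ∧
      (fun n => (T n : ℝ)) =O[atTop] (fun n : ℕ => (n : ℝ) ^ 2)) ∧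
    (∃ (P : CheapestInsertion.Prog) (T S W : ℕ → ℕ),
      CheapestInsertion.Implements.{u} P T S W ∧
      CheapestInsertion.PolyBounded W ∧
      (fun n => (T n : ℝ)) =O[atTop] (fun n : ℕ => (n : ℝ) ^ 2 * Real.log (n : ℝ) ^ 2) ∧
      (fun n => (S n : ℝ)) =O[atTop] (fun n : ℕ => (n : ℝ))) :=
  ⟨CheapestInsertion.exists_implements_quadratic,
    CheapestInsertion.exists_implements_linear_space⟩
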